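/- Let $\mathbf{R}$ be a real closed field with its order topology, let $\mathbf{C}$ be its algebraic closure, and give $\mathbf{R}^n$ the product (Euclidean) topology. A set $S\subset\mathbf{R}^n$ is semi-algebraic if it is a finite Boolean combination of sets $\{p>0\}$ with $p\in\mathbf{R}[x_1,\dots,x_n]$; it is semi-algebraically connected if any two of its points are joined by a continuous map $\gamma\colon[0,1]\to S$ with semi-algebraic graph, where $[0,1]\subset\mathbf{R}$; a semi-algebraically connected component of $S$ is a non-empty semi-algebraically connected semi-algebraic subset of $S$ that is both open and closed in $S$. Let $Z\subset\mathbf{C}^n$ be an algebraic set defined by polynomials with coefficients in $\mathbf{R}$, and assume that $Z$ is equidimensional of dimension $d>0$, i.e. all its irreducible components have dimension $d$. A point $y\in Z$ is regular if the Jacobian matrix at $y$ of a finite set of generators of the ideal $I(Z)\subset\mathbf{C}[x_1,\dots,x_n]$ has rank $n-d$, and singular otherwise. Let $\varphi\in\mathbf{R}[x_1,\dots,x_n]$, regarded also as a map $\mathbf{C}^n\to\mathbf{C}$. Let $K(\varphi,Z)$ be the set of those $y\in Z$ which are either singular points of $Z$, or regular points of $Z$ at which the differential $d_y\varphi$ does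 not map the tangent space $T_yZ$ onto $\mathbf{C}$. Let $u\in\mathbf{R}$, and put $Z_{|\varphi<u}=\{x\in Z\cap\mathbf{R}^n:\varphi(x)<u\}$, $Z_{|\varphi\le u}=\{x\in Z\cap\mathbf{R}^n:\varphi(x)\le u\}$ and $Z_{|\varphi=u}=\{x\in Z\cap\mathbf{R}^n:\varphi(x)=u\}$. Suppose that $Z_{|\varphi=u}\cap K(\varphi,Z)=\emptyset$. Then for every semi-algebraically connected component $C$ of $Z_{|\varphi\le u}$, the set $\{x\in C:\varphi(x)<u\}$ is a semi-algebraically connected component of $Z_{|\varphi<u}$ (in particular, it is non-empty). -/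

import Mathlib

/-! ### Semi-algebraic sets over an ordered field -/

/-- The semi-algebraic subsets of `R^σ`: the smallest family of subsets that contains all sets
`{p > 0}`, `p` a polynomial, and is stable under complements and (finite) intersections. -/
inductive IsSemialgebraic {R σ : Type*} [Field R] [LinearOrder R] : Set (σ → R) → Prop
  | pos (p : MvPolynomial σ R) : IsSemialgebraic {x | 0 < MvPolynomial.eval x p}
  | compl {A : Set (σ → R)} : IsSemialgebraic A → IsSemialgebraic Aᶜ
  | inter {A B : Set (σ → R)} : IsSemialgebraic A → IsSemialgebraic B → IsSemialgebraic (A ∩ B)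

/-- `γ` restricts to a continuous semi-algebraic map `[0,1] → S` (semi-algebraic: its graph is a
semi-algebraic subset of `R^(1+n)`). The values of `γ` outside `[0,1]` play no role. -/
structure IsSemialgebraicPath {R : Type*} [Field R] [LinearOrder R] [TopologicalSpace R] {n : ℕ}
    (S : Set (Fin n → R)) (γ : R → Fin n → R) : Prop where
  continuousOn : ContinuousOn γ (Set.Icc 0 1)
  semialgebraic : IsSemialgebraic
    {p : Fin (n + 1) → R | p 0 ∈ Set.Icc (0 : R) 1 ∧ Fin.tail p = γ (p 0)}
  mapsTo : Set.MapsTo γ (Set.Icc 0 1) S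

/-- A semi-algebraic set is semi-algebraically connected if any two of its points are joined
by a continuous semi-algebraic path inside it. -/
structure IsSemialgConnected {R : Type*} [Field R] [LinearOrder R] [TopologicalSpace R] {n : ℕ}
    (S : Set (Fin n → R)) : Prop where
  semialgebraic : IsSemialgebraic S
  joined : ∀ y ∈ S, ∀ y' ∈ S, ∃ γ : R → Fin n → R,
    IsSemialgebraicPath S γ ∧ γ 0 = y ∧ γ 1 = y'

/-- `C` is a semi-algebraically connected component of `S`: a non-empty semi-algebraically
connected semi-algebraic subset of `S` that is both open and closed in `S`. -/
structure IsSemialgComponent {R : Type*} [Field R] [LinearOrder R] [TopologicalSpace R] {n : ℕ}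
    (C S : Set (Fin n → R)) : Prop where
  subset : C ⊆ S
  nonempty : C.Nonempty
  connected : IsSemialgConnected C
  isOpen_in : ∃ U : Set (Fin n → R), IsOpen U ∧ C = U ∩ S
  isClosed_in : ∃ F : Set (Fin n → R), IsClosed F ∧ C = F ∩ S

/-! ### Algebraic sets over an algebraically closed field, regular and critical points -/

/-- `Z ⊆ K^n` is the set of solutions in `K^n` of a finite system of polynomial equations with
coefficients in `k`. -/
def IsAlgebraicSetOver (k : Type*) {K : Type*} [Field k] [Field K] [Algebra k K] {n : ℕ}
    (Z : Set (Fin n → K)) : Prop :=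
  ∃ s : Finset (MvPolynomial (Fin n) k), Z = {z | ∀ f ∈ s, MvPolynomial.aeval z f = 0}

/-- All irreducible components of the algebraic set `Z` have dimension `d`. The irreducible
components are the zero loci of the minimal primes `p` over the ideal `I(Z)`, and the dimension
of such a component is the Krull dimension of its coordinate ring `K[x_1, …, x_n] / p`. -/
def IsEquidimensional {K : Type*} [Field K] {n : ℕ} (Z : Set (Fin n → K)) (d : ℕ) : Prop :=
  ∀ p ∈ (MvPolynomial.vanishingIdeal K Z).minimalPrimes,
    ringKrullDim (MvPolynomial (Fin n) K ⧸ p) = d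

/-- The Jacobian matrix of the tuple `g` at the point `y`. -/
noncomputable def jacobianMatrixAt {K : Type*} [Field K] {n m : ℕ}
    (g : Fin m → MvPolynomial (Fin n) K) (y : Fin n → K) : Matrix (Fin m) (Fin n) K :=
  Matrix.of fun i j => MvPolynomial.eval y (MvPolynomial.pderiv j (g i))

/-- The differential `v ↦ ∑ j, ∂f/∂x_j(y) v_j` of the polynomial `f` at `y`. -/
noncomputable def polyDifferential {K : Type*} [Field K] {n : ℕ} (f : MvPolynomial (Fin n) K)
    (y : Fin n → K) : (Fin n → K) →ₗ[K] K :=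
  ∑ j, MvPolynomial.eval y (MvPolynomial.pderiv j f) • LinearMap.proj j

/-- The (Zariski) tangent space to the algebraic set `Z` at `y`: the common kernel of the
differentials at `y` of all polynomials of `I(Z)`. -/
noncomputable def algTangentSpace {K : Type*} [Field K] {n : ℕ} (Z : Set (Fin n → K))
    (y : Fin n → K) : Submodule K (Fin n → K) :=
  ⨅ f ∈ MvPolynomial.vanishingIdeal K Z, LinearMap.ker (polyDifferential f y)

/-- The regular points of the `d`-equidimensional algebraic set `Z`: the points of `Z` where the
Jacobian matrix of a finite set of generators of `I(Z)` has rank `n - d`. (The rank does not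
depend on the choice of the generators.) -/
def regPoints {K : Type*} [Field K] {n : ℕ} (Z : Set (Fin n → K)) (d : ℕ) : Set (Fin n → K) :=
  {y | y ∈ Z ∧ ∃ (m : ℕ) (g : Fin m → MvPolynomial (Fin n) K),
    Ideal.span (Set.range g) = MvPolynomial.vanishingIdeal K Z ∧
      (jacobianMatrixAt g y).rank + d = n}

/-- The singular points of `Z`. -/
def singPoints {K : Type*} [Field K] {n : ℕ} (Z : Set (Fin n → K)) (d : ℕ) : Set (Fin n → K) :=
  Z \ regPoints Z d

/-- The critical points on `Z` of the polynomial function `f`: the regular points `y` of `Z` where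
the differential of `f` does not map the tangent space of `Z` at `y` onto `K`. -/
def critPoints {K : Type*} [Field K] {n : ℕ} (f : MvPolynomial (Fin n) K) (Z : Set (Fin n → K))
    (d : ℕ) : Set (Fin n → K) :=
  {y | y ∈ regPoints Z d ∧ (algTangentSpace Z y).map (polyDifferential f y) ≠ ⊤}

/-- The set `K(f, Z)` of singular points of `f` on `Z`: the critical points of `f` on `Z` together
with the singular points of `Z`. -/
def singPointsOf {K : Type*} [Field K] {n : ℕ} (f : MvPolynomial (Fin n) K) (Z : Set (Fin n → K))
    (d : ℕ) : Set (Fin n → K) :=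
  critPoints f Z d ∪ singPoints Z d

/-! ### Real traces -/

/-- The inclusion `R^n → K^n`. -/
def toExtension {R : Type*} (K : Type*) [Field R] [Field K] [Algebra R K] {n : ℕ}
    (x : Fin n → R) : Fin n → K :=
  fun i => algebraMap R K (x i)

/-- `X ∩ f⁻¹(U) ∩ R^n`, as a subset of `R^n`. -/
def realFiber {R K : Type*} [Field R] [Field K] [Algebra R K] {n : ℕ} (X : Set (Fin n → K))
    (f : MvPolynomial (Fin n) R) (U : Set R) : Set (Fin n → R) :=
  {x | toExtension K x ∈ X ∧ MvPolynomial.eval x f ∈ U}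

section

open Polynomial

/-! ### Real closed fields -/

section Closure

/-! Let V be the set of real points of Z. At a point of V with φ = u, the set Z is smooth and φ
restricts to a submersion. The implicit function theorem therefore gives local coordinates of R^n,
one of which is φ, such that V is the zero set of some of the others. Near such a point V contains
points with φ < u, and any two of these are joined below the level by interpolating their
coordinates linearly. So every point of V with φ ≤ u is attached to one path class of {φ < u}, its
`nearClass`, and this class does not change along a semi-algebraic path in {φ ≤ u}. Hence two points
below the level that are joined in {φ ≤ u} are joined in {φ < u} (`IsChartSystem.joined_of_joined`);
as C is open and closed, the new path stays in C.

Since R is an arbitrary real closed field, its intervals need be neither compact nor connected, and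
every topological argument has to run through definable sets. The basis is the Tarski–Seidenberg
theorem `Def.exists_of_prod`, deduced from root functions in a maximal algebra of functions whose
positivity sets are definable. It yields suprema of definable sets, minima of polynomials on balls,
an inverse function theorem with explicit radii (`GoodBall.exists_polyEval_eq`), and continuation
along intervals (`eq_of_locally_eq`). The latter requires a path to be cut at finitely many
parameters into pieces that stay below the level, or stay in the level and in the domain of one
chart. Pieces of the second kind are pushed below the level by `IsPathOn.exists_lift`.

That n - d equations suffice locally is the Jacobian criterion
`exists_mul_mem_span_of_isEquidimensional`: such elements of I(Z) with independent gradients at a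
point are part of a regular system of parameters there, so they generate a prime ideal of the local
ring, and a dimension count identifies it with the prime of the component through the point. Complex
conjugation shows that I(Z) is generated by real polynomials (`exists_real_generators`), so the
charts can be chosen real. -/

theorem Polynomial.exists_root_of_natDegree_eq_two {F : Type*} [Field F] [CharZero F]
    (hsq : ∀ x : F, IsSquare x) (p : F[X]) (hp : p.natDegree = 2) : ∃ x, p.IsRoot x := by
  have h2 : p.coeff 2 ≠ 0 := by
    have : p.leadingCoeff ≠ 0 := by
      rw [leadingCoeff_ne_zero]; rintro rfl; simp at hp
    rwa [leadingCoeff, hp] at this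
  obtain ⟨s, hs⟩ := hsq (discrim (p.coeff 2) (p.coeff 1) (p.coeff 0))
  obtain ⟨x, hx⟩ := exists_quadratic_eq_zero h2 ⟨s, hs⟩
  refine ⟨x, ?_⟩
  rw [IsRoot, eval_eq_sum_range, hp]
  simp only [Finset.sum_range_succ, Finset.range_zero, Finset.sum_empty]
  linear_combination hx

/-- A nontrivial 2-group has a subgroup of index 2. Its fixed field would be a quadratic extension
of a field in which every quadratic polynomial has a root. -/
theorem finrank_eq_one_of_card_aut_two_pow {F L : Type*} [Field F] [CharZero F] [Field L]
    [Algebra F L] [FiniteDimensional F L] [IsGalois F L] (hsq : ∀ x : F, IsSquare x) (m : ℕ)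
    (hm : Module.finrank F L = 2 ^ m) : Module.finrank F L = 1 := by
  have : Fact (Nat.Prime 2) := ⟨Nat.prime_two⟩
  rcases m with _ | m
  · simpa using hm
  exfalso
  have hcard : Nat.card (L ≃ₐ[F] L) = 2 ^ (m + 1) := by rw [IsGalois.card_aut_eq_finrank, hm]
  obtain ⟨H, hH⟩ := Sylow.exists_subgroup_card_pow_prime (G := L ≃ₐ[F] L) 2 (n := m)
    (by rw [hcard]; exact pow_dvd_pow 2 (Nat.le_succ m))
  set M := IntermediateField.fixedField H
  have h1 : Module.finrank M L = 2 ^ m := by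
    rw [IntermediateField.finrank_fixedField_eq_card, hH]
  have h2 : Module.finrank F M * Module.finrank M L = Module.finrank F L :=
    Module.finrank_mul_finrank F M L
  have h3 : Module.finrank F M = 2 := by
    rw [h1, hm, pow_succ, mul_comm] at h2
    exact Nat.eq_of_mul_eq_mul_left (pow_pos two_pos m) h2
  have hbot : (⊥ : Subalgebra F M) = ⊤ := by
    refine (eq_top_iff.2 fun y _ => ?_).symm.symm
    have hint : IsIntegral F y := Algebra.IsIntegral.isIntegral y
    have hirr := minpoly.irreducible hint
    have hdvd : (minpoly F y).natDegree ∣ 2 := h3 ▸ minpoly.degree_dvd hint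
    have hd1 : (minpoly F y).natDegree = 1 := by
      rcases (Nat.dvd_prime Nat.prime_two).1 hdvd with h | h
      · exact h
      · obtain ⟨x, hx⟩ := exists_root_of_natDegree_eq_two hsq _ h
        have := degree_eq_one_of_irreducible_of_root hirr hx
        exact natDegree_eq_of_degree_eq_some this
    have hd1' : (minpoly F y).degree = 1 := by
      rw [degree_eq_natDegree hirr.ne_zero, hd1]; rfl
    exact Algebra.mem_bot.2 (minpoly.mem_range_of_degree_eq_one F y hd1')
  have := Subalgebra.bot_eq_top_iff_finrank_eq_one.1 hbot
  omega

theorem mem_adjoin_sqrt_neg_one {R K : Type*} [Field R] [Field K] [Algebra R K] {i : K} (hi : i * i = -1) {x : K}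
    (hx : x ∈ IntermediateField.adjoin R {i}) :
    ∃ a b : R, x = algebraMap R K a + algebraMap R K b * i := by
  have hint : IsAlgebraic R i := by
    refine ⟨X ^ 2 + 1, ?_, by simp [sq, hi]⟩
    have : (X ^ 2 + C 1 : R[X]).Monic := monic_X_pow_add_C 1 two_ne_zero
    simpa using this.ne_zero
  rw [← IntermediateField.mem_toSubalgebra,
    IntermediateField.adjoin_simple_toSubalgebra_of_isAlgebraic hint] at hx
  induction hx using Algebra.adjoin_induction with
  | mem y hy => exact ⟨0, 1, by simp_all⟩
  | algebraMap r => exact ⟨r, 0, by simp⟩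
  | add x y _ _ hx hy =>
    obtain ⟨a, b, rfl⟩ := hx
    obtain ⟨c, d, rfl⟩ := hy
    exact ⟨a + c, b + d, by simp; ring⟩
  | mul x y _ _ hx hy =>
    obtain ⟨a, b, rfl⟩ := hx
    obtain ⟨c, d, rfl⟩ := hy
    exact ⟨a * c - b * d, a * d + b * c, by
      simp only [map_sub, map_mul, map_add]; linear_combination (algebraMap R K b * algebraMap R K d) * hi⟩

variable {R : Type*} [Field R] [IsRealClosed R]

theorem IsRealClosed.finrank_eq_one_of_odd {F : Type*} [CharZero R] [Field F] [Algebra R F]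
    [FiniteDimensional R F] (h : Odd (Module.finrank R F)) : Module.finrank R F = 1 := by
  obtain ⟨α, hα⟩ := Field.exists_primitive_element R F
  have hint : IsIntegral R α := Algebra.IsIntegral.isIntegral α
  have hdeg : (minpoly R α).natDegree = Module.finrank R F :=
    (Field.primitive_element_iff_minpoly_natDegree_eq R α).1 hα
  obtain ⟨x, hx⟩ := IsRealClosed.exists_isRoot_of_odd_natDegree (f := minpoly R α) (hdeg ▸ h)
  have := degree_eq_one_of_irreducible_of_root (minpoly.irreducible hint) hx
  rw [← hdeg]
  exact natDegree_eq_of_degree_eq_some this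

/-- The fixed field of a Sylow 2-subgroup has odd degree over R, hence equals R. -/
theorem IsRealClosed.exists_finrank_eq_two_pow {L : Type*} [CharZero R] [Field L] [Algebra R L]
    [FiniteDimensional R L] [IsGalois R L] : ∃ m, Module.finrank R L = 2 ^ m := by
  have : Fact (Nat.Prime 2) := ⟨Nat.prime_two⟩
  obtain ⟨P⟩ : Nonempty (Sylow 2 (L ≃ₐ[R] L)) := inferInstance
  set M := IntermediateField.fixedField (P : Subgroup (L ≃ₐ[R] L))
  have h1 : Module.finrank M L = Nat.card P := IntermediateField.finrank_fixedField_eq_card _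
  have h2 : Module.finrank R M * Module.finrank M L = Module.finrank R L :=
    Module.finrank_mul_finrank R M L
  have hc : Nat.card P = 2 ^ (Nat.card (L ≃ₐ[R] L)).factorization 2 := P.card_eq_multiplicity
  have hodd : Odd (Module.finrank R M) := by
    have hidx : Module.finrank R M = (P : Subgroup (L ≃ₐ[R] L)).index := by
      have h3 := (P : Subgroup (L ≃ₐ[R] L)).card_mul_index
      rw [IsGalois.card_aut_eq_finrank, ← h2, h1, mul_comm] at h3
      exact (Nat.eq_of_mul_eq_mul_right Nat.card_pos h3).symm
    rw [hidx, ← Nat.not_even_iff_odd, even_iff_two_dvd]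
    exact P.not_dvd_index
  rw [IsRealClosed.finrank_eq_one_of_odd hodd, one_mul, h1, hc] at h2
  exact ⟨_, h2.symm⟩

variable [LinearOrder R] [IsStrictOrderedRing R] {K : Type*} [Field K] [Algebra R K]

/-- Half-angle formulas: c² = (r + a)/2 and d² = (r - a)/2 with r = √(a² + b²); the sign of d is
dictated by b = 2cd. -/
theorem IsRealClosed.exists_sqrt {i : K} (hi : i * i = -1) (a b : R) : ∃ c d : R,
    algebraMap R K a + algebraMap R K b * i =
      (algebraMap R K c + algebraMap R K d * i) * (algebraMap R K c + algebraMap R K d * i) := by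
  suffices ∃ c d : R, a = c * c - d * d ∧ b = 2 * c * d by
    obtain ⟨c, d, rfl, rfl⟩ := this
    refine ⟨c, d, ?_⟩
    simp only [map_sub, map_mul, map_ofNat]
    linear_combination - (algebraMap R K d * algebraMap R K d) * hi
  have h0 : 0 ≤ a * a + b * b := add_nonneg (mul_self_nonneg a) (mul_self_nonneg b)
  obtain ⟨r', hr'⟩ := IsRealClosed.nonneg_iff_isSquare.1 h0
  obtain ⟨r, hr, hr0⟩ : ∃ r : R, a * a + b * b = r * r ∧ 0 ≤ r :=
    ⟨|r'|, by rw [abs_mul_abs_self, hr'], abs_nonneg r'⟩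
  have hra : |a| ≤ r := abs_le_of_sq_le_sq (by nlinarith [mul_self_nonneg b]) hr0
  obtain ⟨hra1, hra2⟩ := abs_le.1 hra
  obtain ⟨c', hc'⟩ := IsRealClosed.nonneg_iff_isSquare.1 (show 0 ≤ (r + a) / 2 by linarith)
  obtain ⟨d', hd'⟩ := IsRealClosed.nonneg_iff_isSquare.1 (show 0 ≤ (r - a) / 2 by linarith)
  have key : b = 2 * c' * d' ∨ b = 2 * c' * (-d') := by
    have : (b - 2 * c' * d') * (b + 2 * c' * d') = 0 := by
      have e : c' * c' * (d' * d') = (r + a) / 2 * ((r - a) / 2) := by rw [hc', hd']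
      linear_combination hr - 4 * e
    rcases mul_eq_zero.1 this with h | h
    · left; linear_combination h
    · right; linear_combination h
  rcases key with h | h
  · exact ⟨c', d', by rw [← hc', ← hd']; ring, h⟩
  · exact ⟨c', -d', by rw [neg_mul_neg, ← hc', ← hd']; ring, h⟩

/-- The elements i and x lie in a finite Galois extension L of R. Over F = R(i) its degree is a
power of 2, while every element of F is a square, so L = F. -/
theorem IsRealClosed.exists_re_im [IsAlgClosure R K] {i : K} (hi : i * i = -1) (x : K) :
    ∃ a b : R, x = algebraMap R K a + algebraMap R K b * i := by
  have : IsAlgClosed K := IsAlgClosure.isAlgClosed R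
  have : Algebra.IsAlgebraic R K := IsAlgClosure.isAlgebraic
  have : CharZero R := IsStrictOrderedRing.toCharZero
  have hgal : IsGalois R K := {}
  set L₀ : IntermediateField R K := IntermediateField.adjoin R {i, x}
  have hfin : FiniteDimensional R L₀ :=
    IntermediateField.finiteDimensional_adjoin fun y _ => Algebra.IsIntegral.isIntegral y
  set L := IntermediateField.normalClosure R L₀ K
  have hLfin : FiniteDimensional R L := inferInstance
  have hLgal : IsGalois R L := IsGalois.normalClosure R L₀ K
  have hle : L₀ ≤ L := IntermediateField.le_normalClosure L₀
  have hiL : i ∈ L := hle (IntermediateField.subset_adjoin R _ (by simp))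
  have hxL : x ∈ L := hle (IntermediateField.subset_adjoin R _ (by simp))
  set j : L := ⟨i, hiL⟩
  have hj : j * j = -1 := Subtype.ext hi
  set F : IntermediateField R L := IntermediateField.adjoin R {j}
  obtain ⟨m, hm⟩ := IsRealClosed.exists_finrank_eq_two_pow (R := R) (L := L)
  have hdvd : Module.finrank F L ∣ 2 ^ m :=
    ⟨Module.finrank R F, by rw [← hm, mul_comm, Module.finrank_mul_finrank R F L]⟩
  obtain ⟨k, -, hk⟩ := (Nat.dvd_prime_pow Nat.prime_two).1 hdvd
  have hjF : j ∈ F := IntermediateField.mem_adjoin_simple_self R j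
  have hsq : ∀ y : F, IsSquare y := by
    rintro ⟨y, hy⟩
    obtain ⟨a, b, rfl⟩ := mem_adjoin_sqrt_neg_one hj hy
    obtain ⟨c, d, hcd⟩ := IsRealClosed.exists_sqrt hj a b
    refine ⟨⟨algebraMap R L c + algebraMap R L d * j, ?_⟩, Subtype.ext hcd⟩
    exact F.add_mem (F.algebraMap_mem c) (F.mul_mem (F.algebraMap_mem d) hjF)
  have h1 := finrank_eq_one_of_card_aut_two_pow hsq k hk
  have htop : (⊥ : Subalgebra F L) = ⊤ := Subalgebra.bot_eq_top_iff_finrank_eq_one.2 h1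
  obtain ⟨y, hy⟩ := Algebra.mem_bot.1 (htop ▸ (Algebra.mem_top : (⟨x, hxL⟩ : L) ∈ ⊤))
  obtain ⟨a, b, hab⟩ := mem_adjoin_sqrt_neg_one hj y.2
  refine ⟨a, b, ?_⟩
  have : (⟨x, hxL⟩ : L) = algebraMap R L a + algebraMap R L b * j := by rw [← hy, ← hab]; rfl
  exact congrArg Subtype.val this

end Closure

/-! ### Intermediate values and Rolle's theorem for polynomials -/

section IVT

variable {R : Type*} [Field R] [LinearOrder R] [IsStrictOrderedRing R] [IsRealClosed R]

/-- A zero a + bi of p in the algebraic closure is also a zero of X² - 2aX + a² + b². -/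
theorem IsRealClosed.natDegree_le_two_of_irreducible {p : R[X]} (hp : Irreducible p) :
    p.natDegree ≤ 2 := by
  let K := AlgebraicClosure R
  obtain ⟨z, hz⟩ := IsAlgClosed.exists_aeval_eq_zero K p (degree_pos_of_irreducible hp).ne'
  obtain ⟨i, hi⟩ := IsAlgClosed.exists_pow_nat_eq (-1 : K) two_pos
  obtain ⟨a, b, hab⟩ := IsRealClosed.exists_re_im (R := R) (by rw [← sq, hi]) z
  have hq : aeval z (X ^ 2 + (C (-(2 * a)) * X + C (a * a + b * b)) : R[X]) = 0 := by
    rw [hab]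
    simp only [map_add, map_pow, aeval_X, map_mul, aeval_C, map_neg, map_ofNat]
    linear_combination (algebraMap R K b) ^ 2 * hi
  have hmon : (X ^ 2 + (C (-(2 * a)) * X + C (a * a + b * b)) : R[X]).natDegree = 2 := by
    compute_degree!
  have h1 := minpoly.dvd R z hq
  have hint : IsIntegral R z := Algebra.IsIntegral.isIntegral z
  have h2 : Associated (minpoly R z) p :=
    (minpoly.irreducible hint).associated_of_dvd hp (minpoly.dvd R z hz)
  rw [← natDegree_eq_of_degree_eq (degree_eq_degree_of_associated h2), ← hmon]
  refine natDegree_le_of_dvd h1 fun h => ?_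
  rw [h] at hmon; simp at hmon

/-- A polynomial without zero in `[a, b]` has the same sign at `a` and `b`. -/
theorem IsRealClosed.eval_mul_eval_pos {a b : R} (hab : a ≤ b) (p : R[X])
    (hp : ∀ x ∈ Set.Icc a b, p.eval x ≠ 0) : 0 < p.eval a * p.eval b := by
  induction p using WfDvdMonoid.induction_on_irreducible with
  | zero => exact absurd eval_zero (hp a ⟨le_rfl, hab⟩)
  | unit u hu =>
    obtain ⟨c, hc, rfl⟩ := isUnit_iff.1 hu
    simpa using hc.ne_zero
  | mul p q hp0 hq ih =>
    have h1 : ∀ x ∈ Set.Icc a b, p.eval x ≠ 0 := fun x hx h => hp x hx (by simp [h])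
    have h2 : ∀ x ∈ Set.Icc a b, q.eval x ≠ 0 := fun x hx h => hp x hx (by simp [h])
    have h3 := ih h1
    suffices 0 < q.eval a * q.eval b by
      rw [eval_mul, eval_mul, mul_mul_mul_comm]; exact mul_pos this h3
    have hdeg := natDegree_le_two_of_irreducible hq
    have hpos := hq.natDegree_pos
    -- A linear factor changes sign only at its root, which is outside [a, b]. A quadratic factor
    -- without root has negative discriminant and keeps the sign of its leading coefficient.
    by_cases hr : ∃ r, q.IsRoot r
    · obtain ⟨r, hr⟩ := hr
      have hdeg1 : q.natDegree = 1 :=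
        natDegree_eq_of_degree_eq_some (degree_eq_one_of_irreducible_of_root hq hr)
      obtain ⟨s, hs⟩ := dvd_iff_isRoot.2 hr
      have hs0 : s.natDegree = 0 := by
        have hne : q ≠ 0 := hq.ne_zero
        rw [hs] at hne hdeg1
        rw [natDegree_mul (left_ne_zero_of_mul hne) (right_ne_zero_of_mul hne)] at hdeg1
        simpa using hdeg1
      obtain ⟨c, rfl⟩ := natDegree_eq_zero.1 hs0
      have hc : c ≠ 0 := by rintro rfl; exact hq.ne_zero (by simp [hs])
      have hrab : ¬ (a ≤ r ∧ r ≤ b) := fun h => h2 r h hr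
      simp only [hs, eval_mul, eval_sub, eval_X, eval_C]
      have : 0 < (a - r) * (b - r) := by
        by_cases h : a ≤ r
        · have : b < r := not_le.1 fun h' => hrab ⟨h, h'⟩
          exact mul_pos_of_neg_of_neg (by linarith) (by linarith)
        · exact mul_pos (by linarith [not_le.1 h]) (by linarith [not_le.1 h])
      have hcc : 0 < c * c := mul_self_pos.2 hc
      have := mul_pos this hcc
      linarith
    · have hdeg2 : q.natDegree = 2 := by
        have : q.natDegree ≠ 1 := fun h => hr
          (by simpa using exists_root_of_degree_eq_one ((degree_eq_iff_natDegree_eq_of_pos one_pos).2 h))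
        omega
      have hev : ∀ x, q.eval x = q.coeff 2 * (x * x) + q.coeff 1 * x + q.coeff 0 := by
        intro x
        rw [eval_eq_sum_range, hdeg2]
        simp only [Finset.sum_range_succ, Finset.range_zero, Finset.sum_empty]
        ring
      have hc2 : q.coeff 2 ≠ 0 := by
        have := leadingCoeff_ne_zero.2 hq.ne_zero
        rwa [leadingCoeff, hdeg2] at this
      have hneg : discrim (q.coeff 2) (q.coeff 1) (q.coeff 0) < 0 := by
        by_contra h
        obtain ⟨s, hs⟩ := IsRealClosed.nonneg_iff_isSquare.1 (not_lt.1 h)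
        obtain ⟨x, hx⟩ := exists_quadratic_eq_zero hc2 ⟨s, hs⟩
        exact hr ⟨x, by rw [IsRoot, hev, hx]⟩
      have hcv : ∀ x, 0 < q.coeff 2 * q.eval x := by
        intro x
        rw [hev]
        rw [discrim] at hneg
        nlinarith [sq_nonneg (2 * q.coeff 2 * x + q.coeff 1)]
      have := mul_pos (hcv a) (hcv b)
      rw [mul_mul_mul_comm] at this
      exact pos_of_mul_pos_right this (mul_self_nonneg _)

/-- The intermediate value theorem for polynomials. -/
theorem IsRealClosed.exists_eval_eq_zero {a b : R} (hab : a ≤ b) (p : R[X])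
    (h : p.eval a * p.eval b < 0) : ∃ x, a < x ∧ x < b ∧ p.eval x = 0 := by
  by_contra! H
  refine (IsRealClosed.eval_mul_eval_pos hab p fun x hx hx0 => ?_).not_gt h
  rcases hx.1.eq_or_lt with rfl | h1
  · simp [hx0] at h
  rcases hx.2.eq_or_lt with rfl | h2
  · simp [hx0] at h
  exact H x h1 h2 hx0

/-- Rolle's theorem for polynomials. -/
theorem IsRealClosed.exists_derivative_eq_zero {a b : R} (hab : a < b) (p : R[X])
    (ha : p.eval a = 0) (hb : p.eval b = 0) : ∃ x, a < x ∧ x < b ∧ p.derivative.eval x = 0 := by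
  by_cases hp0 : p = 0
  · exact ⟨(a + b) / 2, by linarith, by linarith, by simp [hp0]⟩
  -- pass to the next root after `a`
  obtain ⟨c, hac, hcb, hc, hmin⟩ : ∃ c, a < c ∧ c ≤ b ∧ p.eval c = 0 ∧
      ∀ x, a < x → x < c → p.eval x ≠ 0 := by
    classical
    set S := p.roots.toFinset.filter (fun x => a < x)
    have hS : S.Nonempty := ⟨b, by simp [S, hp0, hb, hab]⟩
    have hm := S.min'_mem hS
    refine ⟨S.min' hS, ?_, S.min'_le b (by simp [S, hp0, hb, hab]), ?_, ?_⟩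
    · exact (Finset.mem_filter.1 hm).2
    · have := (Finset.mem_filter.1 hm).1
      simpa [hp0] using this
    · intro x hx1 hx2 hx3
      exact absurd (S.min'_le x (by simp [S, hp0, hx1, hx3])) (not_le.2 hx2)
  obtain ⟨q, hq, hqa⟩ := exists_eq_pow_rootMultiplicity_mul_and_not_dvd p hp0 a
  have hq0 : q ≠ 0 := by rintro rfl; simp at hqa
  obtain ⟨r, hr, hrc⟩ := exists_eq_pow_rootMultiplicity_mul_and_not_dvd q hq0 c
  set m := p.rootMultiplicity a
  set n := q.rootMultiplicity c
  have hm : 0 < m := (rootMultiplicity_pos hp0).2 ha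
  have hqa' : q.eval a ≠ 0 := fun h => hqa (dvd_iff_isRoot.2 h)
  have hrc' : r.eval c ≠ 0 := fun h => hrc (dvd_iff_isRoot.2 h)
  have hqc : q.eval c = 0 := by
    rw [hq, eval_mul, mul_eq_zero] at hc
    refine hc.resolve_left ?_
    simp only [eval_pow, eval_sub, eval_X, eval_C]
    exact pow_ne_zero _ (sub_ne_zero.2 hac.ne')
  have hn : 0 < n := (rootMultiplicity_pos hq0).2 hqc
  have hra' : r.eval a ≠ 0 := fun h => hqa' (by rw [hr, eval_mul, h, mul_zero])
  have hr0 : ∀ x ∈ Set.Icc a c, r.eval x ≠ 0 := by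
    intro x hx h
    rcases hx.1.eq_or_lt with rfl | h1
    · exact hra' h
    rcases hx.2.eq_or_lt with rfl | h2
    · exact hrc' h
    exact hmin x h1 h2 (by rw [hq, hr]; simp [h])
  have hrpos := IsRealClosed.eval_mul_eval_pos hac.le r hr0
  obtain ⟨m', hm'⟩ : ∃ m', m = m' + 1 := ⟨m - 1, by omega⟩
  obtain ⟨n', hn'⟩ : ∃ n', n = n' + 1 := ⟨n - 1, by omega⟩
  -- With p = (X - a)^m (X - c)^n r, this is the cofactor of (X - a)^(m-1) (X - c)^(n-1) in p'.
  -- Since r has no zero in [a, c], g has opposite signs at a and c.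
  set g : R[X] := C ((m' : R) + 1) * (X - C c) * r + C ((n' : R) + 1) * (X - C a) * r +
    (X - C a) * (X - C c) * derivative r with hg
  have hder : derivative p = (X - C a) ^ m' * (X - C c) ^ n' * g := by
    rw [hq, hr, hm', hn', hg]
    simp only [derivative_mul, derivative_pow, derivative_sub, derivative_X, derivative_C,
      Nat.add_sub_cancel, Nat.cast_add, Nat.cast_one, map_add, map_one, map_natCast]
    ring
  have hm'0 : (0 : R) < m' + 1 := by positivity
  have hn'0 : (0 : R) < n' + 1 := by positivity
  have hsign : g.eval a * g.eval c < 0 := by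
    have h1 : g.eval a = ((m' : R) + 1) * (a - c) * r.eval a := by simp [hg]
    have h2 : g.eval c = ((n' : R) + 1) * (c - a) * r.eval c := by simp [hg]
    rw [h1, h2]
    have h3 : 0 < c - a := sub_pos.2 hac
    have h4 : 0 < ((m' : R) + 1) * ((n' : R) + 1) * ((c - a) * (c - a)) *
        (r.eval a * r.eval c) := by positivity
    linarith
  obtain ⟨x, hx1, hx2, hx⟩ := IsRealClosed.exists_eval_eq_zero hac.le g hsign
  exact ⟨x, hx1, hx2.trans_le hcb, by rw [hder, eval_mul, hx, mul_zero]⟩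

end IVT

end

section

/-! ### Definable predicates on coordinate spaces -/

section Framework

/-- A type with a distinguished algebra of polynomial functions. -/
class CoordSpace (R : Type*) [Field R] (X : Type*) where
  coordAlg : Subalgebra R (X → R)

open CoordSpace

variable {R : Type*} [Field R]

instance CoordSpace.self : CoordSpace R R := ⟨Algebra.adjoin R {id}⟩

instance CoordSpace.pi {ι : Type*} : CoordSpace R (ι → R) :=
  ⟨Algebra.adjoin R (Set.range fun i x => x i)⟩

instance CoordSpace.prod {X Y : Type*} [CoordSpace R X] [CoordSpace R Y] : CoordSpace R (X × Y) :=
  ⟨Algebra.adjoin R ({f | ∃ g ∈ coordAlg (R := R) (X := X), f = fun p => g p.1} ∪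
    {f | ∃ g ∈ coordAlg (R := R) (X := Y), f = fun p => g p.2})⟩

/-- Maps that are given by polynomials in the coordinates. -/
@[fun_prop]
def PolyMap (R : Type*) [Field R] {X Y : Type*} [CoordSpace R X] [CoordSpace R Y] (g : X → Y) :
    Prop :=
  ∀ f ∈ coordAlg (R := R) (X := Y), (fun x => f (g x)) ∈ coordAlg (R := R) (X := X)

variable {X Y W : Type*} [CoordSpace R X] [CoordSpace R Y] [CoordSpace R W]

theorem mem_coordAlg_comp_of_adjoin {X Y : Type*} [CoordSpace R X] {s : Set (Y → R)} {g : X → Y}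
    (h : ∀ f ∈ s, (fun x => f (g x)) ∈ coordAlg (R := R) (X := X)) {f : Y → R}
    (hf : f ∈ Algebra.adjoin R s) : (fun x => f (g x)) ∈ coordAlg (R := R) (X := X) := by
  induction hf using Algebra.adjoin_induction with
  | mem y hy => exact h y hy
  | algebraMap r => exact Subalgebra.algebraMap_mem _ r
  | add x y _ _ hx hy => exact Subalgebra.add_mem _ hx hy
  | mul x y _ _ hx hy => exact Subalgebra.mul_mem _ hx hy

theorem polyMap_iff {f : X → R} : PolyMap R f ↔ f ∈ coordAlg (R := R) (X := X) :=
  ⟨fun h => h id (Algebra.subset_adjoin rfl),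
    fun h _ hg => mem_coordAlg_comp_of_adjoin (by rintro _ rfl; exact h) hg⟩

@[fun_prop]
theorem PolyMap.id' : PolyMap R (fun x : X => x) := fun _ hf => hf

@[fun_prop]
theorem PolyMap.const (y : Y) : PolyMap R (fun _ : X => y) :=
  fun f _ => Subalgebra.algebraMap_mem (coordAlg (R := R) (X := X)) (f y)

@[fun_prop]
theorem PolyMap.comp {g : Y → W} {f : X → Y} (hg : PolyMap R g) (hf : PolyMap R f) :
    PolyMap R (fun x => g (f x)) := fun h hh => hf _ (hg h hh)

@[fun_prop]
theorem PolyMap.fst {f : X → Y × W} (hf : PolyMap R f) : PolyMap R (fun x => (f x).1) :=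
  PolyMap.comp (g := Prod.fst)
    (fun g hg => Algebra.subset_adjoin (Or.inl ⟨g, hg, rfl⟩)) hf

@[fun_prop]
theorem PolyMap.snd {f : X → Y × W} (hf : PolyMap R f) : PolyMap R (fun x => (f x).2) :=
  PolyMap.comp (g := Prod.snd)
    (fun g hg => Algebra.subset_adjoin (Or.inr ⟨g, hg, rfl⟩)) hf

@[fun_prop]
theorem PolyMap.prodMk {f : X → Y} {g : X → W} (hf : PolyMap R f) (hg : PolyMap R g) :
    PolyMap R (fun x => (f x, g x)) := by
  refine fun h hh => mem_coordAlg_comp_of_adjoin ?_ hh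
  rintro _ (⟨k, hk, rfl⟩ | ⟨k, hk, rfl⟩)
  · exact hf k hk
  · exact hg k hk

@[fun_prop]
theorem PolyMap.apply {ι : Type*} (i : ι) : PolyMap R (fun x : ι → R => x i) :=
  polyMap_iff.2 (Algebra.subset_adjoin ⟨i, rfl⟩)

@[fun_prop]
theorem PolyMap.pi {ι : Type*} {f : X → ι → R} (hf : ∀ i, PolyMap R (fun x => f x i)) :
    PolyMap R (fun x i => f x i) := by
  refine fun h hh => mem_coordAlg_comp_of_adjoin ?_ hh
  rintro _ ⟨i, rfl⟩
  exact polyMap_iff.1 (hf i)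

@[fun_prop]
theorem PolyMap.add {f g : X → R} (hf : PolyMap R f) (hg : PolyMap R g) :
    PolyMap R (fun x => f x + g x) :=
  polyMap_iff.2 (Subalgebra.add_mem _ (polyMap_iff.1 hf) (polyMap_iff.1 hg))

@[fun_prop]
theorem PolyMap.mul {f g : X → R} (hf : PolyMap R f) (hg : PolyMap R g) :
    PolyMap R (fun x => f x * g x) :=
  polyMap_iff.2 (Subalgebra.mul_mem _ (polyMap_iff.1 hf) (polyMap_iff.1 hg))

@[fun_prop]
theorem PolyMap.sub {f g : X → R} (hf : PolyMap R f) (hg : PolyMap R g) :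
    PolyMap R (fun x => f x - g x) :=
  polyMap_iff.2 (Subalgebra.sub_mem _ (polyMap_iff.1 hf) (polyMap_iff.1 hg))

@[fun_prop]
theorem PolyMap.neg {f : X → R} (hf : PolyMap R f) : PolyMap R (fun x => - f x) :=
  polyMap_iff.2 (Subalgebra.neg_mem _ (polyMap_iff.1 hf))

@[fun_prop]
theorem PolyMap.pow {f : X → R} (hf : PolyMap R f) (k : ℕ) : PolyMap R (fun x => f x ^ k) :=
  polyMap_iff.2 (Subalgebra.pow_mem _ (polyMap_iff.1 hf) k)

@[fun_prop]
theorem PolyMap.sum {ι : Type*} (s : Finset ι) {f : ι → X → R} (hf : ∀ i, PolyMap R (f i)) :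
    PolyMap R (fun x => ∑ i ∈ s, f i x) := by
  have : (∑ i ∈ s, f i) ∈ coordAlg (R := R) (X := X) :=
    Subalgebra.sum_mem _ fun i _ => polyMap_iff.1 (hf i)
  rw [polyMap_iff]
  convert this using 1
  ext x; simp

@[fun_prop]
theorem PolyMap.mvEval {ι : Type*} (p : MvPolynomial ι R) {f : X → ι → R} (hf : PolyMap R f) :
    PolyMap R (fun x => MvPolynomial.eval (f x) p) := by
  refine PolyMap.comp (g := fun y => MvPolynomial.eval y p) ?_ hf
  induction p using MvPolynomial.induction_on with
  | C a => simpa using PolyMap.const a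
  | add p q hp hq => simpa using hp.add hq
  | mul_X p i hp => simpa using hp.mul (PolyMap.apply i)

variable [LinearOrder R]

/-- Predicates defined by boolean combinations of polynomial inequalities. -/
inductive Def (R : Type*) [Field R] [LinearOrder R] {X : Type*} [CoordSpace R X] :
    (X → Prop) → Prop
  | pos {f : X → R} (hf : f ∈ coordAlg (R := R) (X := X)) : Def R (fun x => 0 < f x)
  | not {P : X → Prop} : Def R P → Def R (fun x => ¬ P x)
  | and {P Q : X → Prop} : Def R P → Def R Q → Def R (fun x => P x ∧ Q x)

namespace Def

theorem congr' {P Q : X → Prop} (h : Def R P) (hPQ : ∀ x, Q x ↔ P x) : Def R Q := by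
  rwa [show Q = P from funext fun x => propext (hPQ x)]

theorem comp {P : Y → Prop} (hP : Def R P) {g : X → Y} (hg : PolyMap R g) :
    Def R (fun x => P (g x)) := by
  induction hP with
  | pos hf => exact .pos (hg _ hf)
  | not _ ih => exact ih.not
  | and _ _ ih1 ih2 => exact ih1.and ih2

theorem or {P Q : X → Prop} (hP : Def R P) (hQ : Def R Q) : Def R (fun x => P x ∨ Q x) :=
  (hP.not.and hQ.not).not.congr' fun x => by tauto

theorem imp {P Q : X → Prop} (hP : Def R P) (hQ : Def R Q) : Def R (fun x => P x → Q x) :=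
  (hP.and hQ.not).not.congr' fun x => by tauto

theorem const (p : Prop) : Def R (fun _ : X => p) := by
  have h : Def R (fun _ : X => (0 : R) < 0) := .pos (Subalgebra.zero_mem _)
  by_cases hp : p
  · exact h.not.congr' fun x => by simp [hp]
  · exact h.congr' fun x => by simp [hp]

theorem forall_mem_finset {ι : Type*} (s : Finset ι) {P : ι → X → Prop}
    (h : ∀ i ∈ s, Def R (P i)) : Def R (fun x => ∀ i ∈ s, P i x) := by
  classical
  induction s using Finset.induction_on with
  | empty => exact (const True).congr' fun x => by simp
  | insert a s _ ih =>
    exact ((h a (by simp)).and (ih fun i hi => h i (by simp [hi]))).congr' fun x => by simp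

theorem exists_mem_finset {ι : Type*} (s : Finset ι) {P : ι → X → Prop}
    (h : ∀ i ∈ s, Def R (P i)) : Def R (fun x => ∃ i ∈ s, P i x) :=
  (forall_mem_finset s fun i hi => (h i hi).not).not.congr' fun x => by simp

theorem forall_fintype {ι : Type*} [Finite ι] {P : ι → X → Prop}
    (h : ∀ i, Def R (P i)) : Def R (fun x => ∀ i, P i x) := by
  have := Fintype.ofFinite ι
  exact (forall_mem_finset Finset.univ fun i _ => h i).congr' fun x => by simp

variable [IsStrictOrderedRing R]

theorem lt {f g : X → R} (hf : PolyMap R f) (hg : PolyMap R g) : Def R (fun x => f x < g x) :=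
  (pos (polyMap_iff.1 (hg.sub hf))).congr' fun x => by simp

theorem le {f g : X → R} (hf : PolyMap R f) (hg : PolyMap R g) : Def R (fun x => f x ≤ g x) :=
  (lt hg hf).not.congr' fun x => by simp

theorem eq {f g : X → R} (hf : PolyMap R f) (hg : PolyMap R g) : Def R (fun x => f x = g x) :=
  ((le hf hg).and (le hg hf)).congr' fun _ => le_antisymm_iff

end Def

end Framework

end

section

open Polynomial CoordSpace

/-! ### Elimination of quantifiers -/

section Elimination

variable {R : Type*} [Field R] [LinearOrder R] {X : Type*} [CoordSpace R X]

/-- Evaluation at a point of the elements of an algebra of functions. -/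
def evalAt {R X : Type*} [Field R] (A : Subalgebra R (X → R)) (x : X) : A →+* R :=
  (Pi.evalRingHom (fun _ : X => R) x).comp A.val.toRingHom

theorem evalAt_apply {R X : Type*} [Field R] (A : Subalgebra R (X → R)) (x : X) (a : A) :
    evalAt A x a = a.1 x := rfl

theorem aeval_function_apply {R X : Type*} [Field R] (A : Subalgebra R (X → R)) (ξ : X → R)
    (Q : A[X]) (x : X) : (aeval ξ Q) x = (Q.map (evalAt A x)).eval (ξ x) := by
  rw [eval_map, aeval_def]
  exact hom_eval₂ Q (algebraMap A (X → R)) (Pi.evalRingHom (fun _ : X => R) x) ξ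

/-- A maximal algebra of functions whose positivity sets are definable. -/
structure IsTame (A : Subalgebra R (X → R)) : Prop where
  coordAlg_le : coordAlg ≤ A
  pos : ∀ a ∈ A, Def R (fun x => 0 < a x)
  mem : ∀ ξ : X → R, (∀ Q : A[X], Def R (fun x => 0 < (Q.map (evalAt A x)).eval (ξ x))) → ξ ∈ A

/-- Zorn's lemma: the condition concerns one function at a time, so it passes to unions of chains.
-/
theorem exists_maximal_subalgebra_of_pos : ∃ A : Subalgebra R (X → R), coordAlg ≤ A ∧
    Maximal (fun A : Subalgebra R (X → R) => ∀ a ∈ A, Def R (fun x => 0 < a x)) A := by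
  refine zorn_le_nonempty₀ {A : Subalgebra R (X → R) | ∀ a ∈ A, Def R (fun x => 0 < a x)} ?_
    coordAlg (fun a ha => Def.pos ha)
  intro c hc hchain y hy
  refine ⟨sSup c, ?_, fun z hz => le_sSup hz⟩
  intro a ha
  have hne : Nonempty c := ⟨⟨y, hy⟩⟩
  rw [sSup_eq_iSup', ← SetLike.mem_coe,
    Subalgebra.coe_iSup_of_directed hchain.directed] at ha
  obtain ⟨B, hB⟩ := Set.mem_iUnion.1 ha
  exact hc B.2 a hB

theorem pos_of_mem_adjoin {A : Subalgebra R (X → R)} {ξ : X → R}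
    (hξ : ∀ Q : A[X], Def R (fun x => 0 < (Q.map (evalAt A x)).eval (ξ x)))
    {a : X → R} (ha : a ∈ Algebra.adjoin A {ξ}) : Def R (fun x => 0 < a x) := by
  rw [Algebra.adjoin_singleton_eq_range_aeval] at ha
  obtain ⟨Q, hQ⟩ := ha
  refine (hξ Q).congr' fun x => ?_
  rw [← aeval_function_apply A ξ Q x, ← hQ]
  rfl

/-- If all Q(ξ) with Q over A have definable positivity sets, the algebra A[ξ] satisfies the
condition for which A is maximal, so ξ belongs to A. -/
theorem exists_isTame : ∃ A : Subalgebra R (X → R), IsTame A := by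
  obtain ⟨A, hA, hpos, hmax⟩ := exists_maximal_subalgebra_of_pos (R := R) (X := X)
  refine ⟨A, hA, hpos, fun ξ hξ => ?_⟩
  have hle : A ≤ (Algebra.adjoin A {ξ}).restrictScalars R := fun a ha =>
    Subalgebra.algebraMap_mem (Algebra.adjoin A {ξ}) (⟨a, ha⟩ : A)
  have hB : ∀ a ∈ (Algebra.adjoin A {ξ}).restrictScalars R, Def R (fun x => 0 < a x) :=
    fun a ha => pos_of_mem_adjoin hξ ((Subalgebra.mem_restrictScalars R).1 ha)
  exact hmax hB hle ((Subalgebra.mem_restrictScalars R).2 (Algebra.subset_adjoin rfl))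

theorem eval_map_evalAt_mem {R X : Type*} [Field R] {A : Subalgebra R (X → R)} (Q : A[X]) (ξ : A) :
    (fun x => (Q.map (evalAt A x)).eval (ξ.1 x)) ∈ A := by
  have : (fun x => (Q.map (evalAt A x)).eval (ξ.1 x)) = (Q.eval ξ).1 := by
    ext x
    rw [← evalAt_apply, ← evalAt_apply, eval_map, eval₂_at_apply]
  exact this ▸ (Q.eval ξ).2

namespace IsTame

variable {A : Subalgebra R (X → R)} (hA : IsTame A)

include hA

theorem pos_eval (Q : A[X]) (ξ : A) : Def R (fun x => 0 < (Q.map (evalAt A x)).eval (ξ.1 x)) :=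
  hA.pos _ (eval_map_evalAt_mem Q ξ)

variable [IsStrictOrderedRing R]

theorem lt (a b : A) : Def R (fun x => a.1 x < b.1 x) :=
  (hA.pos _ (b - a).2).congr' fun x => by simp

theorem le (a b : A) : Def R (fun x => a.1 x ≤ b.1 x) :=
  (hA.lt b a).not.congr' fun x => by simp

theorem eq (a b : A) : Def R (fun x => a.1 x = b.1 x) :=
  ((hA.le a b).and (hA.le b a)).congr' fun _ => le_antisymm_iff

/-- Multiplying Q(1/a) by the even power a^(2n) clears denominators without changing signs. Where a
= 0 the inverse is 0 by convention, and the constant coefficient of Q decides. -/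
theorem inv_mem (a : A) : (fun x => (a.1 x)⁻¹) ∈ A := by
  refine hA.mem _ fun Q => ?_
  set n := Q.natDegree
  let b : A := ∑ i ∈ Finset.range (n + 1), Q.coeff i * a ^ (2 * n - i)
  refine (((hA.eq a 0).and (hA.pos _ (Q.coeff 0).2)).or
    ((hA.eq a 0).not.and (hA.pos _ b.2))).congr' fun x => ?_
  by_cases h : a.1 x = 0
  · have h' : a.1 x = (0 : A).1 x := h
    simp only [h', true_and, not_true, false_and, or_false]
    have : (0 : A).1 x = 0 := rfl
    rw [this, inv_zero, ← coeff_zero_eq_eval_zero, coeff_map, evalAt_apply]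
  · have h' : ¬ a.1 x = (0 : A).1 x := h
    simp only [h', false_and, not_false_iff, true_and, false_or]
    have hb : b.1 x = (a.1 x) ^ (2 * n) * (Q.map (evalAt A x)).eval ((a.1 x)⁻¹) := by
      rw [← evalAt_apply, map_sum, eval_eq_sum_range' (n := n + 1)
        (lt_of_le_of_lt natDegree_map_le (Nat.lt_succ_self _)), Finset.mul_sum]
      refine Finset.sum_congr rfl fun i hi => ?_
      have hi' : i ≤ n := Nat.lt_succ_iff.1 (Finset.mem_range.1 hi)
      rw [map_mul, map_pow, coeff_map, evalAt_apply A x a, inv_pow]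
      have : (a.1 x) ^ (2 * n) = (a.1 x) ^ (2 * n - i) * (a.1 x) ^ i := by
        rw [← pow_add]; congr 1; omega
      rw [this]
      field_simp
    rw [hb, pow_mul]
    have : 0 < ((a.1 x) ^ 2) ^ n := by positivity
    exact (mul_pos_iff_of_pos_left this).symm

variable [IsRealClosed R]

/-- On p, the function ξ is the only zero of P in (α, β), and P has opposite signs at α and β.
Comparing ξ with an element of A thus reduces to signs of P. The sign of Q(ξ) is that of the
remainder of Q modulo P, whose degree is at most d and whose zeros are covered by finitely many
elements of A. -/
theorem mem_of_isolated {P : A[X]} (hP : P.Monic) {d : ℕ} (hd : P.natDegree = d + 1)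
    (ih : ∀ Q : A[X], Q.natDegree ≤ d → ∃ Ξ : Finset A, ∀ x y, Q.map (evalAt A x) ≠ 0 →
      (Q.map (evalAt A x)).eval y = 0 → ∃ ζ ∈ Ξ, ζ.1 x = y)
    (α β : A) {p : X → Prop} (hp : Def R p) {ξ : X → R} (h0 : ∀ x, ¬ p x → ξ x = 0)
    (hξ : ∀ x, p x → α.1 x < ξ x ∧ ξ x < β.1 x ∧ (P.map (evalAt A x)).eval (ξ x) = 0 ∧
      (P.map (evalAt A x)).eval (α.1 x) * (P.map (evalAt A x)).eval (β.1 x) < 0 ∧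
      ∀ y, α.1 x < y → y < β.1 x → (P.map (evalAt A x)).eval y = 0 → y = ξ x) : ξ ∈ A := by
  classical
  have key1 : ∀ x, p x → ∀ s, α.1 x < s → s < β.1 x →
      (ξ x < s ↔ 0 < (P.map (evalAt A x)).eval s * (P.map (evalAt A x)).eval (β.1 x)) ∧
      (s < ξ x ↔ 0 < (P.map (evalAt A x)).eval s * (P.map (evalAt A x)).eval (α.1 x)) := by
    intro x hx s hs1 hs2
    obtain ⟨h1, h2, h3, h4, h5⟩ := hξ x hx
    set p := P.map (evalAt A x)
    have e1 : ξ x < s → 0 < p.eval s * p.eval (β.1 x) := fun h =>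
      IsRealClosed.eval_mul_eval_pos hs2.le p fun y hy hy0 => by
        rcases hy.2.eq_or_lt with rfl | hlt
        · simp [hy0] at h4
        · have := h5 y (hs1.trans_le hy.1) hlt hy0
          rw [this] at hy; exact absurd hy.1 (not_le.2 h)
    have e2 : s < ξ x → 0 < p.eval s * p.eval (α.1 x) := fun h => by
      rw [mul_comm]
      exact IsRealClosed.eval_mul_eval_pos hs1.le p fun y hy hy0 => by
        rcases hy.1.eq_or_lt with rfl | hlt
        · simp [hy0] at h4
        · have := h5 y hlt (hy.2.trans_lt hs2) hy0
          rw [this] at hy; exact absurd hy.2 (not_le.2 h)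
    have e3 : ¬ (0 < p.eval s * p.eval (α.1 x) ∧ 0 < p.eval s * p.eval (β.1 x)) := by
      rintro ⟨ha, hb⟩
      have := mul_pos ha hb
      rw [mul_mul_mul_comm] at this
      exact absurd (pos_of_mul_pos_right this (mul_self_nonneg _)) (not_lt.2 h4.le)
    refine ⟨⟨e1, fun h => ?_⟩, ⟨e2, fun h => ?_⟩⟩
    · rcases lt_trichotomy (ξ x) s with h' | h' | h'
      · exact h'
      · rw [← h', h3] at h; simp at h
      · exact absurd ⟨e2 h', h⟩ e3
    · rcases lt_trichotomy (ξ x) s with h' | h' | h'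
      · exact absurd ⟨h, e1 h'⟩ e3
      · rw [← h', h3] at h; simp at h
      · exact h'
  have hlt : ∀ s : A, Def R (fun x => p x ∧ ξ x < s.1 x) := by
    intro s
    refine (hp.and ((hA.le β s).or ((hA.lt α s).and ((hA.lt s β).and
      (hA.pos _ (P.eval s * P.eval β).2))))).congr' fun x => and_congr_right fun hx => ?_
    have hev : (P.eval s * P.eval β).1 x =
        (P.map (evalAt A x)).eval (s.1 x) * (P.map (evalAt A x)).eval (β.1 x) := by
      rw [← evalAt_apply, map_mul, ← evalAt_apply, ← evalAt_apply, eval_map, eval_map,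
        eval₂_at_apply, eval₂_at_apply]
    rw [hev]
    obtain ⟨h1, h2, -⟩ := hξ x hx
    constructor
    · intro h
      rcases le_or_gt (β.1 x) (s.1 x) with h' | h'
      · exact Or.inl h'
      · exact Or.inr ⟨h1.trans h, h', ((key1 x hx _ (h1.trans h) h').1).1 h⟩
    · rintro (h | ⟨h3, h4, h⟩)
      · exact h2.trans_le h
      · exact ((key1 x hx _ h3 h4).1).2 h
  have hgt : ∀ s : A, Def R (fun x => p x ∧ s.1 x < ξ x) := by
    intro s
    refine (hp.and ((hA.le s α).or ((hA.lt α s).and ((hA.lt s β).and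
      (hA.pos _ (P.eval s * P.eval α).2))))).congr' fun x => and_congr_right fun hx => ?_
    have hev : (P.eval s * P.eval α).1 x =
        (P.map (evalAt A x)).eval (s.1 x) * (P.map (evalAt A x)).eval (α.1 x) := by
      rw [← evalAt_apply, map_mul, ← evalAt_apply, ← evalAt_apply, eval_map, eval_map,
        eval₂_at_apply, eval₂_at_apply]
    rw [hev]
    obtain ⟨h1, h2, -⟩ := hξ x hx
    constructor
    · intro h
      rcases le_or_gt (s.1 x) (α.1 x) with h' | h'
      · exact Or.inl h'
      · exact Or.inr ⟨h', h.trans h2, ((key1 x hx _ h' (h.trans h2)).2).1 h⟩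
    · rintro (h | ⟨h3, h4, h⟩)
      · exact h.trans_lt h1
      · exact ((key1 x hx _ h3 h4).2).2 h
  refine hA.mem _ fun Q => ?_
  set Q' := Q %ₘ P with hQ'
  have hQ'd : Q'.natDegree ≤ d := by
    rcases subsingleton_or_nontrivial A with h | h
    · simp [Subsingleton.elim Q' 0]
    · have : Q'.natDegree < P.natDegree := natDegree_modByMonic_lt Q hP (by rintro rfl; simp at hd)
      omega
  obtain ⟨Z, hZ⟩ := ih Q' hQ'd
  have hQeval : ∀ x, p x →
      (Q.map (evalAt A x)).eval (ξ x) = (Q'.map (evalAt A x)).eval (ξ x) := by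
    intro x hx
    have h := congrArg (fun q => (q.map (evalAt A x)).eval (ξ x)) (modByMonic_add_div Q P)
    simp only [Polynomial.map_add, Polynomial.map_mul, eval_add, eval_mul, (hξ x hx).2.2.1,
      zero_mul, add_zero] at h
    exact h.symm
  let half : A := algebraMap R A 2⁻¹
  let T : Finset A := insert α (insert β Z)
  -- Here s and t bracket ξ. If Q' is nonzero, its positivity at every member of Z in between
  -- excludes zeros of Q' there, so Q' has the same sign at the midpoint as at ξ.
  have hD : Def R (fun x => (¬ p x ∧ 0 < (Q.coeff 0).1 x) ∨ ∃ s ∈ T, ∃ t ∈ T,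
      ((p x ∧ s.1 x < ξ x) ∧ (p x ∧ ξ x < t.1 x)) ∧
      (∀ k ∈ Z, (s.1 x < k.1 x ∧ k.1 x < t.1 x) → 0 < (Q'.map (evalAt A x)).eval (k.1 x)) ∧
      0 < (Q'.map (evalAt A x)).eval ((half * (s + t)).1 x)) :=
    (hp.not.and (hA.pos _ (Q.coeff 0).2)).or <|
      Def.exists_mem_finset _ fun s _ => Def.exists_mem_finset _ fun t _ =>
        ((hgt s).and (hlt t)).and ((Def.forall_mem_finset _ fun k _ =>
          ((hA.lt s k).and (hA.lt k t)).imp (hA.pos_eval Q' k)).and (hA.pos_eval Q' _))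
  refine hD.congr' fun x => ?_
  by_cases hx : p x
  swap
  · simp only [hx, not_false_iff, true_and, false_and, and_false, exists_false, or_false]
    rw [h0 x hx, ← coeff_zero_eq_eval_zero, coeff_map, evalAt_apply]
  simp only [hx, not_true, false_and, true_and, false_or]
  rw [hQeval x hx]
  obtain ⟨h1, h2, -⟩ := hξ x hx
  have hsame : ∀ s t : A, s.1 x < ξ x → ξ x < t.1 x →
      (∀ k ∈ Z, (s.1 x < k.1 x ∧ k.1 x < t.1 x) → 0 < (Q'.map (evalAt A x)).eval (k.1 x)) →
      (0 < (Q'.map (evalAt A x)).eval (ξ x) ↔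
        0 < (Q'.map (evalAt A x)).eval ((half * (s + t)).1 x)) := by
    intro s t hs ht hst
    have hmid : (half * (s + t)).1 x = (s.1 x + t.1 x) / 2 := by
      rw [← evalAt_apply, map_mul, map_add, evalAt_apply, evalAt_apply, evalAt_apply]
      change (2 : R)⁻¹ * _ = _
      ring
    rw [hmid]
    by_cases hq0 : Q'.map (evalAt A x) = 0
    · simp [hq0]
    have hno : ∀ y, s.1 x < y → y < t.1 x → (Q'.map (evalAt A x)).eval y ≠ 0 := by
      intro y hy1 hy2 hy0
      obtain ⟨k, hk, rfl⟩ := hZ x y hq0 hy0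
      exact (hst k hk ⟨hy1, hy2⟩).ne' hy0
    have hm1 : s.1 x < (s.1 x + t.1 x) / 2 := by linarith
    have hm2 : (s.1 x + t.1 x) / 2 < t.1 x := by linarith
    have hprod : 0 < (Q'.map (evalAt A x)).eval (ξ x) *
        (Q'.map (evalAt A x)).eval ((s.1 x + t.1 x) / 2) := by
      rcases le_total (ξ x) ((s.1 x + t.1 x) / 2) with hle | hle
      · exact IsRealClosed.eval_mul_eval_pos hle _ fun y hy =>
          hno y (hs.trans_le hy.1) (hy.2.trans_lt hm2)
      · rw [mul_comm]
        exact IsRealClosed.eval_mul_eval_pos hle _ fun y hy =>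
          hno y (hm1.trans_le hy.1) (hy.2.trans_lt ht)
    exact ⟨fun h => (mul_pos_iff_of_pos_left h).1 hprod,
      fun h => (mul_pos_iff_of_pos_right h).1 hprod⟩
  constructor
  · intro hpos
    -- With the members of T nearest to ξ on either side, any member of Z strictly in between takes
    -- the value ξ.
    obtain ⟨s, hs, hsmax⟩ := Finset.exists_max_image (T.filter fun s => s.1 x < ξ x)
      (fun s => s.1 x) ⟨α, by simp [T, h1]⟩
    obtain ⟨t, ht, htmin⟩ := Finset.exists_min_image (T.filter fun s => ξ x < s.1 x)
      (fun s => s.1 x) ⟨β, by simp [T, h2]⟩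
    rw [Finset.mem_filter] at hs ht
    have hst : ∀ k ∈ Z, (s.1 x < k.1 x ∧ k.1 x < t.1 x) →
        0 < (Q'.map (evalAt A x)).eval (k.1 x) := by
      rintro k hk ⟨hk1, hk2⟩
      have hkT : k ∈ T := by simp [T, hk]
      have hkx : k.1 x = ξ x := by
        rcases lt_trichotomy (k.1 x) (ξ x) with h | h | h
        · exact absurd (hsmax k (Finset.mem_filter.2 ⟨hkT, h⟩)) (not_le.2 hk1)
        · exact h
        · exact absurd (htmin k (Finset.mem_filter.2 ⟨hkT, h⟩)) (not_le.2 hk2)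
      rwa [hkx]
    exact ⟨s, hs.1, t, ht.1, ⟨hs.2, ht.2⟩, hst, (hsame s t hs.2 ht.2 hst).1 hpos⟩
  · rintro ⟨s, -, t, -, ⟨hs, ht⟩, hst, hpos⟩
    exact (hsame s t hs ht hst).2 hpos

end IsTame

end Elimination

end

section

open Polynomial CoordSpace

/-! ### Root functions and the Tarski–Seidenberg theorem -/

section Projection

variable {R : Type*} [Field R] [LinearOrder R] [IsStrictOrderedRing R]

/-- Cauchy's bound, with 1 + c² in place of |c| to make it polynomial in the coefficients. -/
theorem Polynomial.Monic.abs_lt_of_isRoot {p : R[X]} (hp : p.Monic) {d : ℕ}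
    (hd : p.natDegree = d + 1) {y : R} (hy : p.eval y = 0) :
    |y| < 2 + ∑ i ∈ Finset.range (d + 1), (1 + p.coeff i ^ 2) := by
  have hc : ∀ i ∈ Finset.range (d + 1), |p.coeff i| ≤ 1 + p.coeff i ^ 2 := fun i _ => by
    rw [← sq_abs]; nlinarith [sq_nonneg (|p.coeff i| - 1), abs_nonneg (p.coeff i)]
  have h0 : 0 ≤ ∑ i ∈ Finset.range (d + 1), (1 + p.coeff i ^ 2) :=
    Finset.sum_nonneg fun i _ => by positivity
  by_contra! h
  have h1 : 1 ≤ |y| := by linarith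
  have hlead : p.coeff (d + 1) = 1 := by rw [← hd]; exact hp
  have heq : y ^ (d + 1) = - ∑ i ∈ Finset.range (d + 1), p.coeff i * y ^ i := by
    rw [eval_eq_sum_range, hd, Finset.sum_range_succ, hlead, one_mul] at hy
    linear_combination hy
  have hle : |y| ^ (d + 1) ≤ (∑ i ∈ Finset.range (d + 1), (1 + p.coeff i ^ 2)) * |y| ^ d := by
    rw [← abs_pow, heq, abs_neg, Finset.sum_mul]
    refine (Finset.abs_sum_le_sum_abs _ _).trans (Finset.sum_le_sum fun i hi => ?_)
    rw [abs_mul, abs_pow]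
    exact mul_le_mul (hc i hi) (pow_le_pow_right₀ h1 (Nat.lt_succ_iff.1 (Finset.mem_range.1 hi)))
      (by positivity) (by positivity)
  rw [pow_succ, mul_comm] at hle
  have := le_of_mul_le_mul_right hle (pow_pos (by linarith) d)
  linarith

variable [IsRealClosed R]

/-- A zero of `p` that is isolated by zeros of the derivative is a sign change. -/
theorem IsRealClosed.eval_mul_eval_neg_of_isolated {p : R[X]} {a b y : R} (hay : a < y)
    (hyb : y < b) (hy : p.eval y = 0)
    (hder : ∀ z, a < z → z < b → p.derivative.eval z ≠ 0) :
    p.eval a * p.eval b < 0 ∧ ∀ z, a < z → z < b → p.eval z = 0 → z = y := by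
  have huniq : ∀ z, a ≤ z → z ≤ b → p.eval z = 0 → z = y := by
    intro z hz1 hz2 hz
    rcases lt_trichotomy z y with h | h | h
    · obtain ⟨w, hw1, hw2, hw⟩ := IsRealClosed.exists_derivative_eq_zero h p hz hy
      exact absurd hw (hder w (hz1.trans_lt hw1) (hw2.trans hyb))
    · exact h
    · obtain ⟨w, hw1, hw2, hw⟩ := IsRealClosed.exists_derivative_eq_zero h p hy hz
      exact absurd hw (hder w (hay.trans hw1) (hw2.trans_le hz2))
  refine ⟨?_, fun z h1 h2 => huniq z h1.le h2.le⟩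
  obtain ⟨q, hq⟩ := dvd_iff_isRoot.2 hy
  have hqy : q.eval y ≠ 0 := by
    have := hder y hay hyb
    rw [hq] at this
    simpa using this
  have hpos := IsRealClosed.eval_mul_eval_pos (hay.trans hyb).le q (by
    intro z hz hz0
    have : z = y := huniq z hz.1 hz.2 (by rw [hq, eval_mul, hz0, mul_zero])
    exact hqy (this ▸ hz0))
  have h1 : p.eval a = (a - y) * q.eval a := by rw [hq]; simp
  have h2 : p.eval b = (b - y) * q.eval b := by rw [hq]; simp
  rw [h1, h2]
  have : 0 < (y - a) * (b - y) * (q.eval a * q.eval b) :=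
    mul_pos (mul_pos (sub_pos.2 hay) (sub_pos.2 hyb)) hpos
  linarith

variable {X : Type*} [CoordSpace R X]

namespace IsTame

variable {A : Subalgebra R (X → R)} (hA : IsTame A)

include hA

/-- Let H consist of the functions covering the zeros of P' and of the root bounds ±M. By Rolle, P
has at most one zero strictly between neighbours in H, and it changes sign there, so
`mem_of_isolated` applies to it. -/
theorem exists_roots_of_monic {d : ℕ}
    (ih : ∀ Q : A[X], Q.natDegree ≤ d → ∃ Ξ : Finset A, ∀ x y, Q.map (evalAt A x) ≠ 0 →
      (Q.map (evalAt A x)).eval y = 0 → ∃ ζ ∈ Ξ, ζ.1 x = y)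
    {P : A[X]} (hP : P.Monic) (hd : P.natDegree = d + 1) :
    ∃ Ξ : Finset A, ∀ x y, (P.map (evalAt A x)).eval y = 0 → ∃ ζ ∈ Ξ, ζ.1 x = y := by
  classical
  have hder : P.derivative.natDegree ≤ d := by
    have := natDegree_derivative_le P; omega
  obtain ⟨E, hE⟩ := ih _ hder
  let M : A := 2 + ∑ i ∈ Finset.range (d + 1), (1 + P.coeff i ^ 2)
  let H : Finset A := insert M (insert (-M) E)
  let c : A → A → X → Prop := fun α β x => α.1 x < β.1 x ∧
    (∀ κ ∈ H, ¬ (α.1 x < κ.1 x ∧ κ.1 x < β.1 x)) ∧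
    ∃ y, α.1 x < y ∧ y < β.1 x ∧ (P.map (evalAt A x)).eval y = 0 ∧
      (P.map (evalAt A x)).eval (α.1 x) * (P.map (evalAt A x)).eval (β.1 x) < 0 ∧
      ∀ z, α.1 x < z → z < β.1 x → (P.map (evalAt A x)).eval z = 0 → z = y
  have hne : ∀ x, (derivative P).map (evalAt A x) ≠ 0 := by
    intro x h
    rw [← derivative_map] at h
    have h1 := derivative_eq_zero.1 h
    rw [hP.natDegree_map, hd] at h1
    omega
  have hderne : ∀ x (α β : A), (∀ κ ∈ H, ¬ (α.1 x < κ.1 x ∧ κ.1 x < β.1 x)) →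
      ∀ z, α.1 x < z → z < β.1 x → (P.map (evalAt A x)).derivative.eval z ≠ 0 := by
    intro x α β hαβ z h1 h2 h
    rw [derivative_map] at h
    obtain ⟨κ, hκ, rfl⟩ := hE x z (hne x) h
    exact hαβ κ (by simp [H, hκ]) ⟨h1, h2⟩
  -- For neighbours α, β the clause on y amounts to the sign condition P(α)P(β) < 0, which is free
  -- of quantifiers.
  have hcdef : ∀ α β, Def R (c α β) := by
    intro α β
    refine ((hA.lt α β).and ((Def.forall_mem_finset H fun κ _ =>
      ((hA.lt α κ).and (hA.lt κ β)).not).and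
      (hA.pos _ (-(P.eval α * P.eval β)).2))).congr' fun x =>
        and_congr_right fun h1 => and_congr_right fun h2 => ?_
    have hev : (-(P.eval α * P.eval β)).1 x =
        -((P.map (evalAt A x)).eval (α.1 x) * (P.map (evalAt A x)).eval (β.1 x)) := by
      rw [← evalAt_apply, map_neg, map_mul, ← evalAt_apply, ← evalAt_apply, eval_map, eval_map,
        eval₂_at_apply, eval₂_at_apply]
    rw [hev, neg_pos]
    constructor
    · rintro ⟨y, -, -, -, h, -⟩
      exact h
    · intro h
      obtain ⟨y, hy1, hy2, hy⟩ := IsRealClosed.exists_eval_eq_zero h1.le _ h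
      exact ⟨y, hy1, hy2, hy, IsRealClosed.eval_mul_eval_neg_of_isolated hy1 hy2 hy
        (hderne x α β h2)⟩
  let ξ : A → A → X → R := fun α β x => if h : c α β x then h.2.2.choose else 0
  have hξ : ∀ α β, ξ α β ∈ A := by
    intro α β
    refine hA.mem_of_isolated hP hd ih α β (hcdef α β) (ξ := ξ α β) ?_ ?_
    · intro x hx
      simp only [ξ, dif_neg hx]
    · intro x hx
      simp only [ξ, dif_pos hx]
      exact hx.2.2.choose_spec
  refine ⟨H ∪ (H ×ˢ H).image fun q => ⟨ξ q.1 q.2, hξ q.1 q.2⟩, fun x y hy => ?_⟩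
  by_cases hyH : ∃ κ ∈ H, κ.1 x = y
  · obtain ⟨κ, hκ, h⟩ := hyH
    exact ⟨κ, Finset.mem_union_left _ hκ, h⟩
  have hMx : M.1 x = 2 + ∑ i ∈ Finset.range (d + 1), (1 + (P.map (evalAt A x)).coeff i ^ 2) := by
    rw [← evalAt_apply]
    simp only [M, map_add, map_sum, map_one, map_ofNat, map_pow, coeff_map]
  have hb : |y| < M.1 x := by
    rw [hMx]
    exact (hP.map _).abs_lt_of_isRoot (by rw [hP.natDegree_map, hd]) hy
  obtain ⟨hb1, hb2⟩ := abs_lt.1 hb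
  obtain ⟨α, hα, hαmax⟩ := Finset.exists_max_image (H.filter fun s => s.1 x < y)
    (fun s => s.1 x) ⟨-M, by simpa [H] using hb1⟩
  obtain ⟨β, hβ, hβmin⟩ := Finset.exists_min_image (H.filter fun s => y < s.1 x)
    (fun s => s.1 x) ⟨M, by simpa [H] using hb2⟩
  rw [Finset.mem_filter] at hα hβ
  have hno : ∀ κ ∈ H, ¬ (α.1 x < κ.1 x ∧ κ.1 x < β.1 x) := by
    rintro κ hκ ⟨h1, h2⟩
    rcases lt_trichotomy (κ.1 x) y with h | h | h
    · exact absurd (hαmax κ (Finset.mem_filter.2 ⟨hκ, h⟩)) (not_le.2 h1)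
    · exact hyH ⟨κ, hκ, h⟩
    · exact absurd (hβmin κ (Finset.mem_filter.2 ⟨hκ, h⟩)) (not_le.2 h2)
  have hc : c α β x := ⟨hα.2.trans hβ.2, hno, y, hα.2, hβ.2, hy,
    IsRealClosed.eval_mul_eval_neg_of_isolated hα.2 hβ.2 hy (hderne x α β hno)⟩
  refine ⟨⟨ξ α β, hξ α β⟩, Finset.mem_union_right _ (Finset.mem_image.2
    ⟨(α, β), Finset.mem_product.2 ⟨hα.1, hβ.1⟩, rfl⟩), ?_⟩
  simp only [ξ, dif_pos hc]
  exact (hc.2.2.choose_spec.2.2.2.2 y hα.2 hβ.2 hy).symm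

/-- The zeros of a polynomial with tame coefficients are covered by finitely many tame functions. -/
theorem exists_roots (d : ℕ) : ∀ P : A[X], P.natDegree ≤ d → ∃ Ξ : Finset A, ∀ x y,
    P.map (evalAt A x) ≠ 0 → (P.map (evalAt A x)).eval y = 0 → ∃ ζ ∈ Ξ, ζ.1 x = y := by
  classical
  induction d with
  | zero =>
    intro P hP
    obtain ⟨a, rfl⟩ := natDegree_eq_zero.1 (Nat.le_zero.1 hP)
    refine ⟨∅, fun x y h1 h2 => ?_⟩
    rw [map_C, eval_C] at h2
    rw [map_C, h2, C_0] at h1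
    exact absurd rfl h1
  | succ d ih =>
    intro P hP
    let c : A := P.coeff (d + 1)
    -- Where the leading coefficient c vanishes, P = Q and the induction hypothesis applies;
    -- elsewhere P' is the monic polynomial P / c.
    let ci : A := ⟨fun x => (c.1 x)⁻¹, hA.inv_mem c⟩
    let Q : A[X] := ∑ i ∈ Finset.range (d + 1), C (P.coeff i) * Polynomial.X ^ i
    have hQ : Q.natDegree ≤ d := natDegree_sum_le_of_forall_le _ _ fun i hi =>
      (natDegree_C_mul_X_pow_le _ _).trans (Nat.lt_succ_iff.1 (Finset.mem_range.1 hi))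
    have hPQ : P = Q + C c * Polynomial.X ^ (d + 1) := by
      conv_lhs => rw [P.as_sum_range_C_mul_X_pow' (n := d + 2) (by omega)]
      rw [Finset.sum_range_succ]
    let P' : A[X] := Polynomial.X ^ (d + 1) + C ci * Q
    have hlt : (C ci * Q).degree < (d + 1 : ℕ) :=
      lt_of_le_of_lt (degree_le_of_natDegree_le ((natDegree_C_mul_le _ _).trans hQ))
        (by exact_mod_cast Nat.lt_succ_self d)
    obtain ⟨Ξ₁, h₁⟩ := ih Q hQ
    rcases subsingleton_or_nontrivial A with hs | hs
    · refine ⟨∅, fun x y h => absurd ?_ h⟩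
      rw [Subsingleton.elim P 0, Polynomial.map_zero]
    have hmonic : P'.Monic := monic_X_pow_add hlt
    have hdeg : P'.natDegree = d + 1 := by
      rw [natDegree_eq_of_degree_eq (degree_add_eq_left_of_degree_lt (by rwa [degree_X_pow])),
        natDegree_X_pow]
    obtain ⟨Ξ₂, h₂⟩ := hA.exists_roots_of_monic ih hmonic hdeg
    refine ⟨Ξ₁ ∪ Ξ₂, fun x y hne hy => ?_⟩
    have hPx : P.map (evalAt A x) = Q.map (evalAt A x) + C (c.1 x) * Polynomial.X ^ (d + 1) := by
      conv_lhs => rw [hPQ]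
      simp [evalAt_apply]
    by_cases hc : c.1 x = 0
    · rw [hPx, hc, C_0, zero_mul, add_zero] at hne hy
      obtain ⟨ζ, hζ, h⟩ := h₁ x y hne hy
      exact ⟨ζ, Finset.mem_union_left _ hζ, h⟩
    · have hP'x : P'.map (evalAt A x) = C ((c.1 x)⁻¹) * P.map (evalAt A x) := by
        rw [hPx, mul_add, ← mul_assoc, ← C_mul, inv_mul_cancel₀ hc, C_1, one_mul, add_comm]
        simp [P', ci, evalAt_apply]
      obtain ⟨ζ, hζ, h⟩ := h₂ x y (by rw [hP'x, eval_mul, hy, mul_zero])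
      exact ⟨ζ, Finset.mem_union_right _ hζ, h⟩

/-- Finitely many tame functions meet every cell of the line determined by finitely many
polynomials with tame coefficients. -/
theorem exists_samples (s : Finset A[X]) : ∃ Ξ : Finset A, ∀ x y, ∃ ζ ∈ Ξ, ∀ P ∈ s,
    (0 < (P.map (evalAt A x)).eval y ↔ 0 < (P.map (evalAt A x)).eval (ζ.1 x)) := by
  classical
  choose Ξ hΞ using fun P : A[X] => hA.exists_roots P.natDegree P le_rfl
  let Z : Finset A := s.biUnion Ξ
  let half : A := algebraMap R A 2⁻¹
  have hhalf : ∀ (a b : A) x, (half * (a + b)).1 x = (a.1 x + b.1 x) / 2 := by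
    intro a b x
    rw [← evalAt_apply, map_mul, map_add, evalAt_apply, evalAt_apply, evalAt_apply]
    change (2 : R)⁻¹ * _ = _
    ring
  have hadd : ∀ (a : A) x, (a + 1).1 x = a.1 x + 1 := fun a x => rfl
  have hsub : ∀ (a : A) x, (a - 1).1 x = a.1 x - 1 := fun a x => rfl
  -- The zeros themselves, points one unit beyond them for the unbounded cells, midpoints for the
  -- bounded ones, and 0 in case there are no zeros.
  refine ⟨insert 0 (Z ∪ Z.image (· + 1) ∪ Z.image (· - 1) ∪
    (Z ×ˢ Z).image fun q => half * (q.1 + q.2)), fun x y => ?_⟩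
  by_cases hyZ : ∃ κ ∈ Z, κ.1 x = y
  · obtain ⟨κ, hκ, rfl⟩ := hyZ
    exact ⟨κ, by simp [hκ], fun P _ => Iff.rfl⟩
  have good : ∀ ζ : A, (∀ κ ∈ Z, κ.1 x < y → κ.1 x < ζ.1 x) →
      (∀ κ ∈ Z, y < κ.1 x → ζ.1 x < κ.1 x) → ∀ P ∈ s,
      (0 < (P.map (evalAt A x)).eval y ↔ 0 < (P.map (evalAt A x)).eval (ζ.1 x)) := by
    intro ζ h1 h2 P hP
    by_cases hP0 : P.map (evalAt A x) = 0
    · simp [hP0]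
    have hprod : 0 < (P.map (evalAt A x)).eval y * (P.map (evalAt A x)).eval (ζ.1 x) := by
      rcases le_total y (ζ.1 x) with hle | hle
      · refine IsRealClosed.eval_mul_eval_pos hle _ fun z hz hz0 => ?_
        obtain ⟨κ, hκ, rfl⟩ := hΞ P x z hP0 hz0
        have hκZ : κ ∈ Z := Finset.mem_biUnion.2 ⟨P, hP, hκ⟩
        exact absurd (h2 κ hκZ (hz.1.lt_of_ne fun h => hyZ ⟨κ, hκZ, h.symm⟩)) (not_lt.2 hz.2)
      · rw [mul_comm]
        refine IsRealClosed.eval_mul_eval_pos hle _ fun z hz hz0 => ?_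
        obtain ⟨κ, hκ, rfl⟩ := hΞ P x z hP0 hz0
        have hκZ : κ ∈ Z := Finset.mem_biUnion.2 ⟨P, hP, hκ⟩
        exact absurd (h1 κ hκZ (hz.2.lt_of_ne fun h => hyZ ⟨κ, hκZ, h⟩)) (not_lt.2 hz.1)
    exact ⟨fun h => (mul_pos_iff_of_pos_left h).1 hprod,
      fun h => (mul_pos_iff_of_pos_right h).1 hprod⟩
  by_cases hL : (Z.filter fun κ => κ.1 x < y).Nonempty <;>
    by_cases hU : (Z.filter fun κ => y < κ.1 x).Nonempty
  · obtain ⟨α, hα, hαmax⟩ := Finset.exists_max_image _ (fun κ => κ.1 x) hL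
    obtain ⟨β, hβ, hβmin⟩ := Finset.exists_min_image _ (fun κ => κ.1 x) hU
    rw [Finset.mem_filter] at hα hβ
    refine ⟨half * (α + β), ?_, good _ ?_ ?_⟩
    · refine Finset.mem_insert_of_mem (Finset.mem_union_right _ (Finset.mem_image.2
        ⟨(α, β), Finset.mem_product.2 ⟨hα.1, hβ.1⟩, rfl⟩))
    · intro κ hκ h
      rw [hhalf]
      linarith [hαmax κ (Finset.mem_filter.2 ⟨hκ, h⟩), hα.2, hβ.2]
    · intro κ hκ h
      rw [hhalf]
      linarith [hβmin κ (Finset.mem_filter.2 ⟨hκ, h⟩), hα.2, hβ.2]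
  · obtain ⟨α, hα, hαmax⟩ := Finset.exists_max_image _ (fun κ => κ.1 x) hL
    rw [Finset.mem_filter] at hα
    refine ⟨α + 1, ?_, good _ ?_ ?_⟩
    · simp [hα.1]
    · intro κ hκ h
      rw [hadd]
      linarith [hαmax κ (Finset.mem_filter.2 ⟨hκ, h⟩)]
    · exact fun κ hκ h => absurd ⟨κ, Finset.mem_filter.2 ⟨hκ, h⟩⟩ hU
  · obtain ⟨β, hβ, hβmin⟩ := Finset.exists_min_image _ (fun κ => κ.1 x) hU
    rw [Finset.mem_filter] at hβ
    refine ⟨β - 1, ?_, good _ ?_ ?_⟩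
    · simp [hβ.1]
    · exact fun κ hκ h => absurd ⟨κ, Finset.mem_filter.2 ⟨hκ, h⟩⟩ hL
    · intro κ hκ h
      rw [hsub]
      linarith [hβmin κ (Finset.mem_filter.2 ⟨hκ, h⟩)]
  · exact ⟨0, by simp, good _ (fun κ hκ h => absurd ⟨κ, Finset.mem_filter.2 ⟨hκ, h⟩⟩ hL)
      (fun κ hκ h => absurd ⟨κ, Finset.mem_filter.2 ⟨hκ, h⟩⟩ hU)⟩

set_option linter.unusedSectionVars false in
theorem exists_polynomial {f : X × R → R} (hf : f ∈ coordAlg (R := R) (X := X × R)) :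
    ∃ P : A[X], ∀ x y, f (x, y) = (P.map (evalAt A x)).eval y := by
  have hself : ∀ g ∈ (coordAlg : Subalgebra R (R → R)), ∃ P : A[X], ∀ x y,
      g y = (P.map (evalAt A x)).eval y := by
    intro g hg
    change g ∈ Algebra.adjoin R {id} at hg
    induction hg using Algebra.adjoin_induction with
    | mem g hg => exact ⟨Polynomial.X, fun x y => by simp_all⟩
    | algebraMap r => exact ⟨C (algebraMap R A r), fun x y => by rw [map_C, eval_C]; rfl⟩
    | add g h _ _ hg hh =>
      obtain ⟨P, hP⟩ := hg
      obtain ⟨Q, hQ⟩ := hh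
      exact ⟨P + Q, fun x y => by simp [hP x y, hQ x y]⟩
    | mul g h _ _ hg hh =>
      obtain ⟨P, hP⟩ := hg
      obtain ⟨Q, hQ⟩ := hh
      exact ⟨P * Q, fun x y => by simp [hP x y, hQ x y]⟩
  change f ∈ Algebra.adjoin R _ at hf
  induction hf using Algebra.adjoin_induction with
  | mem f hf =>
    rcases hf with ⟨g, hg, rfl⟩ | ⟨g, hg, rfl⟩
    · exact ⟨C ⟨g, hA.coordAlg_le hg⟩, fun x y => by rw [map_C, eval_C]; rfl⟩
    · exact hself g hg
  | algebraMap r => exact ⟨C (algebraMap R A r), fun x y => by rw [map_C, eval_C]; rfl⟩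
  | add g h _ _ hg hh =>
    obtain ⟨P, hP⟩ := hg
    obtain ⟨Q, hQ⟩ := hh
    exact ⟨P + Q, fun x y => by simp [hP x y, hQ x y]⟩
  | mul g h _ _ hg hh =>
    obtain ⟨P, hP⟩ := hg
    obtain ⟨Q, hQ⟩ := hh
    exact ⟨P * Q, fun x y => by simp [hP x y, hQ x y]⟩

theorem def_section {P : X × R → Prop} (hP : Def R P) (ζ : A) : Def R (fun x => P (x, ζ.1 x)) := by
  induction hP with
  | pos hf =>
    obtain ⟨P, hP⟩ := hA.exists_polynomial hf
    exact (hA.pos_eval P ζ).congr' fun x => by rw [← hP]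
  | not _ ih => exact ih.not
  | and _ _ ih1 ih2 => exact ih1.and ih2

/-- Membership depends on the last coordinate only through the signs of finitely many polynomials
over A; sample functions can therefore replace the quantifier over it. -/
theorem exists_finset_of_def {P : X × R → Prop} (hP : Def R P) : ∃ s : Finset A[X], ∀ x y y',
    (∀ Q ∈ s, (0 < (Q.map (evalAt A x)).eval y ↔ 0 < (Q.map (evalAt A x)).eval y')) →
    (P (x, y) ↔ P (x, y')) := by
  classical
  induction hP with
  | pos hf =>
    obtain ⟨P, hP⟩ := hA.exists_polynomial hf
    exact ⟨{P}, fun x y y' h => by simpa [hP] using h⟩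
  | not _ ih =>
    obtain ⟨s, hs⟩ := ih
    exact ⟨s, fun x y y' h => not_congr (hs x y y' h)⟩
  | and _ _ ih1 ih2 =>
    obtain ⟨s, hs⟩ := ih1
    obtain ⟨t, ht⟩ := ih2
    exact ⟨s ∪ t, fun x y y' h => and_congr
      (hs x y y' fun Q hQ => h Q (Finset.mem_union_left _ hQ))
      (ht x y y' fun Q hQ => h Q (Finset.mem_union_right _ hQ))⟩

end IsTame

namespace Def

/-- The Tarski–Seidenberg theorem. -/
theorem exists_of_prod {P : X × R → Prop} (hP : Def R P) : Def R (fun x => ∃ y, P (x, y)) := by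
  obtain ⟨A, hA⟩ := exists_isTame (R := R) (X := X)
  obtain ⟨s, hs⟩ := hA.exists_finset_of_def hP
  obtain ⟨Ξ, hΞ⟩ := hA.exists_samples s
  refine (exists_mem_finset Ξ fun ζ _ => hA.def_section hP ζ).congr' fun x => ⟨?_, ?_⟩
  · rintro ⟨y, hy⟩
    obtain ⟨ζ, hζ, h⟩ := hΞ x y
    exact ⟨ζ, hζ, (hs x y _ h).1 hy⟩
  · rintro ⟨ζ, -, h⟩
    exact ⟨_, h⟩

theorem ex {P : X → R → Prop} (hP : Def R (fun p : X × R => P p.1 p.2)) :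
    Def R (fun x => ∃ y, P x y) := exists_of_prod hP

theorem all {P : X → R → Prop} (hP : Def R (fun p : X × R => P p.1 p.2)) :
    Def R (fun x => ∀ y, P x y) :=
  (ex (P := fun x y => ¬ P x y) hP.not).not.congr' fun x => by simp

theorem exVec {n : ℕ} {P : X → (Fin n → R) → Prop}
    (hP : Def R (fun p : X × (Fin n → R) => P p.1 p.2)) : Def R (fun x => ∃ v, P x v) := by
  induction n generalizing X with
  | zero =>
    refine (hP.comp (g := fun x : X => (x, fun i => Fin.elim0 i)) (by fun_prop)).congr'
      fun x => ?_
    simp only [Unique.exists_iff]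
    exact iff_of_eq (congrArg (P x) (Subsingleton.elim _ _))
  | succ n ih =>
    have h1 : Def R (fun p : (X × (Fin n → R)) × R => P p.1.1 (Fin.cons p.2 p.1.2)) := by
      refine hP.comp (g := fun p : (X × (Fin n → R)) × R => (p.1.1, Fin.cons p.2 p.1.2))
        (PolyMap.prodMk (by fun_prop) (PolyMap.pi fun i => ?_))
      refine Fin.cases ?_ (fun j => ?_) i
      · simp only [Fin.cons_zero]; fun_prop
      · simp only [Fin.cons_succ]; fun_prop
    refine (ih (P := fun x v => ∃ y, P x (Fin.cons y v))
      (ex (P := fun (p : X × (Fin n → R)) y => P p.1 (Fin.cons y p.2)) h1)).congr' fun x => ?_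
    rw [Fin.exists_fin_succ_pi, exists_comm]

theorem allVec {n : ℕ} {P : X → (Fin n → R) → Prop}
    (hP : Def R (fun p : X × (Fin n → R) => P p.1 p.2)) : Def R (fun x => ∀ v, P x v) :=
  (exVec (P := fun x v => ¬ P x v) hP.not).not.congr' fun x => by simp

end Def

end Projection

end

section

open CoordSpace

/-! ### Definable subsets of the line -/

section Line

variable {R : Type*} [Field R] [LinearOrder R]

theorem def_mem_iff_isSemialgebraic {ι : Type*} {S : Set (ι → R)} :
    Def R (fun x => x ∈ S) ↔ IsSemialgebraic S := by
  constructor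
  · suffices ∀ P : (ι → R) → Prop, Def R P → IsSemialgebraic {x | P x} from this _
    intro P hP
    induction hP with
    | @pos f hf =>
      have : ∃ p : MvPolynomial ι R, ∀ x, MvPolynomial.eval x p = f x := by
        change f ∈ Algebra.adjoin R _ at hf
        induction hf using Algebra.adjoin_induction with
        | mem f hf =>
          obtain ⟨i, rfl⟩ := hf
          exact ⟨MvPolynomial.X i, fun x => by simp⟩
        | algebraMap r => exact ⟨MvPolynomial.C r, fun x => by simp⟩
        | add f g _ _ hf hg =>
          obtain ⟨p, hp⟩ := hf
          obtain ⟨q, hq⟩ := hg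
          exact ⟨p + q, fun x => by simp [hp, hq]⟩
        | mul f g _ _ hf hg =>
          obtain ⟨p, hp⟩ := hf
          obtain ⟨q, hq⟩ := hg
          exact ⟨p * q, fun x => by simp [hp, hq]⟩
      obtain ⟨p, hp⟩ := this
      simpa only [hp] using IsSemialgebraic.pos p
    | not _ ih => exact ih.compl
    | and _ _ ih1 ih2 => exact ih1.inter ih2
  · intro h
    induction h with
    | pos p => exact Def.pos (polyMap_iff.1 (PolyMap.mvEval p PolyMap.id'))
    | compl _ ih => exact ih.not
    | inter _ _ ih1 ih2 => exact ih1.and ih2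

variable [IsStrictOrderedRing R]

/-- A function on an interval that is locally constant, and constant on the intervals that avoid
a finite set, takes the same value at both ends. -/
theorem eq_of_locally_eq {Q : Type*} (cl : R → Q) (F : Finset R) {a b : R} (hab : a ≤ b)
    (hF : ∀ c d, a ≤ c → c ≤ d → d ≤ b → (∀ x ∈ F, c ≤ x → ¬ x ≤ d) → cl c = cl d)
    (hloc : ∀ t, a ≤ t → t ≤ b → ∃ δ > 0, ∀ s, a ≤ s → s ≤ b → |s - t| < δ → cl s = cl t) :
    cl a = cl b := by
  classical
  -- Induction on the number of exceptional points in [a, b]. Local constancy at such a point t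
  -- allows stepping off t to either side, onto intervals with fewer of them. Local constancy alone
  -- would not do, as R need not be connected.
  induction hn : (F.filter fun x => a ≤ x ∧ x ≤ b).card using Nat.strong_induction_on
    generalizing a b with
  | _ n ih =>
    by_cases hempty : ∃ t ∈ F, a ≤ t ∧ t ≤ b
    swap
    · exact hF a b le_rfl hab le_rfl fun x hx h1 h2 => hempty ⟨x, hx, h1, h2⟩
    obtain ⟨t, htF, hat, htb⟩ := hempty
    obtain ⟨δ, hδ, hδt⟩ := hloc t hat htb
    have hl : cl a = cl t := by
      rcases hat.eq_or_lt with rfl | hlt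
      · rfl
      have hs : max a (t - δ / 2) < t := max_lt hlt (by linarith)
      have hs' : |max a (t - δ / 2) - t| < δ := by
        rw [abs_lt]
        constructor <;> linarith [le_max_right a (t - δ / 2)]
      rw [← hδt _ (le_max_left _ _) (hs.le.trans htb) hs']
      refine ih _ ?_ (le_max_left _ _)
        (fun c d h1 h2 h3 => hF c d h1 h2 (h3.trans (hs.le.trans htb)))
        (fun u h1 h2 => ?_) rfl
      · rw [← hn]
        refine Finset.card_lt_card ⟨fun x hx => ?_, fun h => ?_⟩
        · rw [Finset.mem_filter] at hx ⊢
          exact ⟨hx.1, hx.2.1, hx.2.2.trans (hs.le.trans htb)⟩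
        · have := h (Finset.mem_filter.2 ⟨htF, hat, htb⟩)
          exact absurd (Finset.mem_filter.1 this).2.2 (not_le.2 hs)
      · obtain ⟨ε, hε, H⟩ := hloc u h1 (h2.trans (hs.le.trans htb))
        exact ⟨ε, hε, fun s h3 h4 => H s h3 (h4.trans (hs.le.trans htb))⟩
    have hr : cl t = cl b := by
      rcases htb.eq_or_lt with rfl | hlt
      · rfl
      have hs : t < min b (t + δ / 2) := lt_min hlt (by linarith)
      have hs' : |min b (t + δ / 2) - t| < δ := by
        rw [abs_lt]
        constructor <;> linarith [min_le_right b (t + δ / 2)]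
      rw [← hδt _ (hat.trans hs.le) (min_le_left _ _) hs']
      refine ih _ ?_ (min_le_left _ _)
        (fun c d h1 h2 h3 => hF c d ((hat.trans hs.le).trans h1) h2 h3)
        (fun u h1 h2 => ?_) rfl
      · rw [← hn]
        refine Finset.card_lt_card ⟨fun x hx => ?_, fun h => ?_⟩
        · rw [Finset.mem_filter] at hx ⊢
          exact ⟨hx.1, (hat.trans hs.le).trans hx.2.1, hx.2.2⟩
        · have := h (Finset.mem_filter.2 ⟨htF, hat, htb⟩)
          exact absurd (Finset.mem_filter.1 this).2.1 (not_le.2 hs)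
      · obtain ⟨ε, hε, H⟩ := hloc u ((hat.trans hs.le).trans h1) h2
        exact ⟨ε, hε, fun s h3 h4 => H s ((hat.trans hs.le).trans h3) h4⟩
    exact hl.trans hr

variable [IsRealClosed R]

namespace Def

/-- Definable subsets of the line are finite unions of intervals. -/
theorem exists_finset_iff {P : R → Prop} (hP : Def R P) : ∃ F : Finset R, ∀ a b, a ≤ b →
    (∀ x ∈ F, a ≤ x → ¬ x ≤ b) → (P a ↔ P b) := by
  classical
  induction hP with
  | @pos f hf =>
    have : ∃ p : Polynomial R, ∀ x, p.eval x = f x := by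
      change f ∈ Algebra.adjoin R {id} at hf
      induction hf using Algebra.adjoin_induction with
      | mem f hf => exact ⟨Polynomial.X, fun x => by simp_all⟩
      | algebraMap r => exact ⟨Polynomial.C r, fun x => by simp⟩
      | add f g _ _ hf hg =>
        obtain ⟨p, hp⟩ := hf
        obtain ⟨q, hq⟩ := hg
        exact ⟨p + q, fun x => by simp [hp, hq]⟩
      | mul f g _ _ hf hg =>
        obtain ⟨p, hp⟩ := hf
        obtain ⟨q, hq⟩ := hg
        exact ⟨p * q, fun x => by simp [hp, hq]⟩
    obtain ⟨p, hp⟩ := this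
    refine ⟨p.roots.toFinset, fun a b hab h => ?_⟩
    simp only [← hp]
    by_cases hp0 : p = 0
    · simp [hp0]
    have := IsRealClosed.eval_mul_eval_pos hab p fun x hx hx0 =>
      h x (by simp [hp0, hx0]) hx.1 hx.2
    exact ⟨fun h => (mul_pos_iff_of_pos_left h).1 this,
      fun h => (mul_pos_iff_of_pos_right h).1 this⟩
  | not _ ih =>
    obtain ⟨F, hF⟩ := ih
    exact ⟨F, fun a b hab h => not_congr (hF a b hab h)⟩
  | and _ _ ih1 ih2 =>
    obtain ⟨F, hF⟩ := ih1
    obtain ⟨G, hG⟩ := ih2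
    exact ⟨F ∪ G, fun a b hab h => and_congr
      (hF a b hab fun x hx => h x (Finset.mem_union_left _ hx))
      (hG a b hab fun x hx => h x (Finset.mem_union_right _ hx))⟩

theorem exists_finset_forall {ι : Type*} [Finite ι] {P : ι → R → Prop} (hP : ∀ i, Def R (P i)) :
    ∃ F : Finset R, ∀ i a b, a ≤ b → (∀ x ∈ F, a ≤ x → ¬ x ≤ b) → (P i a ↔ P i b) := by
  classical
  have := Fintype.ofFinite ι
  choose F hF using fun i => (hP i).exists_finset_iff
  exact ⟨Finset.univ.biUnion F, fun i a b hab h => hF i a b hab fun x hx =>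
    h x (Finset.mem_biUnion.2 ⟨i, Finset.mem_univ i, hx⟩)⟩

/-- Without a least upper bound there would be upper bounds v' < v and a point t ≤ v satisfying P,
with no exceptional point in [t, v]. Then P holds at v, against v' being an upper bound. -/
theorem exists_isLUB {P : R → Prop} (hP : Def R P) (hne : ∃ x, P x)
    (hbdd : ∃ u, ∀ x, P x → x ≤ u) : ∃ c, IsLUB {x | P x} c := by
  classical
  obtain ⟨F, hF⟩ := hP.exists_finset_iff
  by_contra! hno
  have hnot : ∀ u ∈ upperBounds {x | P x}, ∃ v ∈ upperBounds {x | P x}, v < u := by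
    intro u hu
    by_contra! h
    exact hno u ⟨hu, h⟩
  obtain ⟨u₀, hu₀, hu₀F⟩ : ∃ u ∈ upperBounds {x | P x}, ∀ e ∈ F, e < u →
      e ∉ upperBounds {x | P x} := by
    by_cases h : (F.filter fun e => e ∈ upperBounds {x | P x}).Nonempty
    · have hm := Finset.min'_mem _ h
      refine ⟨_, (Finset.mem_filter.1 hm).2, fun e he hlt hU => ?_⟩
      exact absurd (Finset.min'_le _ e (Finset.mem_filter.2 ⟨he, hU⟩)) (not_le.2 hlt)
    · obtain ⟨u, hu⟩ := hbdd
      exact ⟨u, hu, fun e he _ hU => h ⟨e, Finset.mem_filter.2 ⟨he, hU⟩⟩⟩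
  obtain ⟨v, hv, hvu⟩ := hnot u₀ hu₀
  obtain ⟨v', hv', hvv'⟩ := hnot v hv
  obtain ⟨t, ht, htF⟩ : ∃ t, P t ∧ ∀ e ∈ F, e ≤ v → e < t := by
    by_cases h : (F.filter fun e => e ≤ v).Nonempty
    · have hm := Finset.max'_mem _ h
      rw [Finset.mem_filter] at hm
      have := hu₀F _ hm.1 (hm.2.trans_lt hvu)
      simp only [mem_upperBounds, not_forall, not_le] at this
      obtain ⟨t, ht, hlt⟩ := this
      exact ⟨t, ht, fun e he hev =>
        (Finset.le_max' _ e (Finset.mem_filter.2 ⟨he, hev⟩)).trans_lt hlt⟩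
    · obtain ⟨t, ht⟩ := hne
      exact ⟨t, ht, fun e he hev => absurd ⟨e, Finset.mem_filter.2 ⟨he, hev⟩⟩ h⟩
  have htv : t ≤ v := hv ht
  have hPv : P v := (hF t v htv fun x hx h1 h2 => absurd h1 (not_le.2 (htF x hx h2))).1 ht
  exact absurd (hv' hPv) (not_le.2 hvv')

/-- A definable property of the points of an interval that is locally constant is constant. -/
theorem iff_of_locally_iff {P : R → Prop} (hP : Def R P) {a b : R} (hab : a ≤ b)
    (hloc : ∀ t, a ≤ t → t ≤ b → ∃ δ > 0, ∀ s, a ≤ s → s ≤ b → |s - t| < δ → (P s ↔ P t)) :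
    P a ↔ P b := by
  obtain ⟨F, hF⟩ := hP.exists_finset_iff
  refine iff_of_eq (eq_of_locally_eq P F hab (fun c d _ hcd _ h => propext (hF c d hcd h))
    fun t h1 h2 => ?_)
  obtain ⟨δ, hδ, H⟩ := hloc t h1 h2
  exact ⟨δ, hδ, fun s h3 h4 h5 => propext (H s h3 h4 h5)⟩

end Def

end Line

end

section

open CoordSpace Topology

/-! ### The inverse function theorem for polynomial maps -/

section Distance

/-- The square of the Euclidean distance. -/
def sqd {R : Type*} [Field R] {n : ℕ} (z w : Fin n → R) : R := ∑ i, (z i - w i) ^ 2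

theorem sqd_comm {R : Type*} [Field R] {n : ℕ} (z w : Fin n → R) : sqd z w = sqd w z :=
  Finset.sum_congr rfl fun _ _ => by ring

@[simp] theorem sqd_self {R : Type*} [Field R] {n : ℕ} (z : Fin n → R) : sqd z z = 0 := by
  simp [sqd]

@[fun_prop]
theorem PolyMap.sqd {R : Type*} [Field R] {n : ℕ} {X : Type*} [CoordSpace R X]
    {f g : X → Fin n → R} (hf : PolyMap R f) (hg : PolyMap R g) :
    PolyMap R (fun x => sqd (f x) (g x)) := by
  unfold _root_.sqd
  fun_prop

/-- The polynomial map with components `H i`. -/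
noncomputable def polyEval {R : Type*} [Field R] {n m : ℕ} (H : Fin m → MvPolynomial (Fin n) R)
    (z : Fin n → R) : Fin m → R :=
  fun i => MvPolynomial.eval z (H i)

@[fun_prop]
theorem PolyMap.polyEval {R : Type*} [Field R] {n : ℕ} {X : Type*} [CoordSpace R X] {m : ℕ}
    (H : Fin m → MvPolynomial (Fin n) R) {f : X → Fin n → R} (hf : PolyMap R f) :
    PolyMap R (fun x => polyEval H (f x)) := by
  unfold _root_.polyEval
  fun_prop

variable {R : Type*} [Field R] [LinearOrder R] [IsStrictOrderedRing R] {n : ℕ}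

theorem sqd_nonneg (z w : Fin n → R) : 0 ≤ sqd z w := Finset.sum_nonneg fun _ _ => sq_nonneg _

theorem sq_sub_le_sqd (z w : Fin n → R) (i : Fin n) : (z i - w i) ^ 2 ≤ sqd z w :=
  Finset.single_le_sum (f := fun i => (z i - w i) ^ 2) (fun _ _ => sq_nonneg _) (Finset.mem_univ i)

theorem sqd_eq_zero {z w : Fin n → R} (h : sqd z w ≤ 0) : z = w := by
  ext i
  have := (sq_sub_le_sqd z w i).trans h
  exact sub_eq_zero.1 (pow_eq_zero_iff two_ne_zero |>.1 (le_antisymm this (sq_nonneg _)))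

theorem sqd_le (a b c : Fin n → R) : sqd a c ≤ 2 * sqd a b + 2 * sqd b c := by
  simp only [sqd, Finset.mul_sum, ← Finset.sum_add_distrib]
  exact Finset.sum_le_sum fun i _ => by nlinarith [sq_nonneg (a i - b i - (b i - c i))]

/-- `H` is expanding with invertible differential on the ball of squared radius `r` about `x`. -/
def GoodBall (H : Fin n → MvPolynomial (Fin n) R) (x : Fin n → R) (r : R) : Prop :=
  0 < r ∧ ∀ z, sqd z x ≤ r → (jacobianMatrixAt H z).det ≠ 0 ∧
    ∀ w, sqd w x ≤ r → r * sqd z w ≤ sqd (polyEval H z) (polyEval H w)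

/-- As r is both the squared radius and the expansion factor, lowering it only weakens the
requirements. -/
theorem GoodBall.mono {H : Fin n → MvPolynomial (Fin n) R} {x y : Fin n → R} {r s : R}
    (h : GoodBall H x r) (hs : 0 < s) (hsr : s ≤ r) (hsub : ∀ z, sqd z y ≤ s → sqd z x ≤ r) :
    GoodBall H y s :=
  ⟨hs, fun z hz => ⟨(h.2 z (hsub z hz)).1, fun w hw =>
    (mul_le_mul_of_nonneg_right hsr (sqd_nonneg _ _)).trans ((h.2 z (hsub z hz)).2 w (hsub w hw))⟩⟩

variable [TopologicalSpace R] [OrderTopology R]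

@[fun_prop]
theorem Continuous.sqd {X : Type*} [TopologicalSpace X] {f g : X → Fin n → R} (hf : Continuous f)
    (hg : Continuous g) : Continuous (fun x => sqd (f x) (g x)) := by
  unfold _root_.sqd
  fun_prop

theorem setOf_sqd_lt_mem_nhds (x : Fin n → R) {ρ : R} (hρ : 0 < ρ) : {z | sqd z x < ρ} ∈ 𝓝 x :=
  (isOpen_lt (by fun_prop) continuous_const).mem_nhds (by simpa using hρ)

theorem exists_sqd_le_subset {x : Fin n → R} {N : Set (Fin n → R)} (hN : N ∈ 𝓝 x) :
    ∃ ρ > 0, ∀ z, sqd z x ≤ ρ → z ∈ N := by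
  classical
  rw [nhds_pi, Filter.mem_pi] at hN
  obtain ⟨I, -, t, ht, hsub⟩ := hN
  choose ε hε h using fun i => (nhds_basis_abs_sub_lt (x i)).mem_iff.1 (ht i)
  obtain ⟨δ, hδ, hδε⟩ : ∃ δ > 0, ∀ i, δ ≤ ε i := by
    by_cases hne : (Finset.univ : Finset (Fin n)).Nonempty
    · obtain ⟨i, -, hi⟩ := Finset.exists_min_image _ ε hne
      exact ⟨ε i, hε i, fun j => hi j (Finset.mem_univ j)⟩
    · exact ⟨1, one_pos, fun i => absurd ⟨i, Finset.mem_univ i⟩ hne⟩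
  refine ⟨(δ / 2) ^ 2, by positivity, fun z hz => hsub fun i _ => h i ?_⟩
  have := abs_le_of_sq_le_sq ((sq_sub_le_sqd z x i).trans hz) (by positivity)
  change |z i - x i| < ε i
  linarith [hδε i]

theorem exists_abs_le_subset {x : R} {N : Set R} (hN : N ∈ 𝓝 x) :
    ∃ ρ > 0, ∀ z, |z - x| ≤ ρ → z ∈ N := by
  obtain ⟨ε, hε, h⟩ := (nhds_basis_abs_sub_lt x).mem_iff.1 hN
  exact ⟨ε / 2, by positivity, fun z hz => h (show |z - x| < ε by linarith)⟩

end Distance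

/-! ### Definable substitutes for compactness -/

section Extremum

variable {R : Type*} [Field R] [LinearOrder R] [IsStrictOrderedRing R] [IsRealClosed R] {n : ℕ}

/-- A bounded definable family of sets indexed by small positive parameters accumulates. -/
theorem Def.exists_cluster {A : (Fin n → R) → R → Prop}
    (hA : Def R (fun p : (Fin n → R) × R => A p.1 p.2)) {M : R}
    (hb : ∀ v s, A v s → ∀ i, |v i| ≤ M)
    (hne : ∀ s > 0, ∃ v s', 0 < s' ∧ s' ≤ s ∧ A v s') :
    ∃ c : Fin n → R, ∀ s > 0, ∃ v s', 0 < s' ∧ s' ≤ s ∧ A v s' ∧ ∀ i, |v i - c i| ≤ s := by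
  classical
  -- Bolzano–Weierstrass, treating one coordinate after the other.
  suffices ∀ I : Finset (Fin n), ∃ c : Fin n → R, ∀ s > 0, ∃ v s', 0 < s' ∧ s' ≤ s ∧ A v s' ∧
      ∀ i ∈ I, |v i - c i| ≤ s by simpa using this Finset.univ
  intro I
  induction I using Finset.induction_on with
  | empty => exact ⟨0, by simpa using hne⟩
  | insert k I hk ih =>
    obtain ⟨c, hc⟩ := ih
    let B : (Fin n → R) → R → Prop := fun v s => 0 < s ∧ (∀ i ∈ I, v i - c i ≤ s ∧ c i - v i ≤ s) ∧
      ∃ s', 0 < s' ∧ s' ≤ s ∧ A v s'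
    have hB : Def R (fun p : (Fin n → R) × R => B p.1 p.2) :=
      (Def.lt (by fun_prop) (by fun_prop)).and ((Def.forall_mem_finset _ fun i _ =>
        (Def.le (by fun_prop) (by fun_prop)).and (Def.le (by fun_prop) (by fun_prop))).and
        (Def.ex (P := fun (p : (Fin n → R) × R) s' => 0 < s' ∧ s' ≤ p.2 ∧ A p.1 s')
          ((Def.lt (by fun_prop) (by fun_prop)).and ((Def.le (by fun_prop) (by fun_prop)).and
            (hA.comp (g := fun q : ((Fin n → R) × R) × R => (q.1.1, q.2)) (by fun_prop))))))
    have hBne : ∀ s > 0, ∃ v, B v s := by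
      intro s hs
      obtain ⟨v, s', h1, h2, h3, h4⟩ := hc s hs
      exact ⟨v, hs, fun i hi => ⟨(abs_le.1 (h4 i hi)).2, by linarith [(abs_le.1 (h4 i hi)).1]⟩,
        s', h1, h2, h3⟩
    have hBb : ∀ v s, B v s → |v k| ≤ M := by
      rintro v s ⟨-, -, s', -, -, h⟩
      exact hb v s' h k
    -- The supremum of L is the lower limit of the k-th coordinate over the members of B as the
    -- parameter tends to 0.
    let L : R → Prop := fun y => ∃ s₀, 0 < s₀ ∧ ∀ v s, (B v s ∧ s ≤ s₀) → y < v k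
    have hL : Def R L := by
      refine Def.ex (P := fun y s₀ => 0 < s₀ ∧ ∀ v s, (B v s ∧ s ≤ s₀) → y < v k)
        ((Def.lt (by fun_prop) (by fun_prop)).and ?_)
      refine Def.allVec (P := fun (p : R × R) v => ∀ s, (B v s ∧ s ≤ p.2) → p.1 < v k) ?_
      refine Def.all (P := fun (p : (R × R) × (Fin n → R)) s =>
        (B p.2 s ∧ s ≤ p.1.2) → p.1.1 < p.2 k) ?_
      exact ((hB.comp (g := fun q : ((R × R) × (Fin n → R)) × R => (q.1.2, q.2))
        (by fun_prop)).and (Def.le (by fun_prop) (by fun_prop))).imp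
        (Def.lt (by fun_prop) (by fun_prop))
    obtain ⟨y₀, hy₀⟩ := hL.exists_isLUB
      ⟨-M - 1, 1, one_pos, fun v s h => by linarith [(abs_le.1 (hBb v s h.1)).1]⟩
      ⟨M, fun y hy => by
        obtain ⟨s₀, hs₀, h⟩ := hy
        obtain ⟨v, hv⟩ := hBne s₀ hs₀
        linarith [(abs_le.1 (hBb v s₀ hv)).2, h v s₀ ⟨hv, le_rfl⟩]⟩
    refine ⟨Function.update c k y₀, fun s hs => ?_⟩
    obtain ⟨y, ⟨s₀, hs₀, hy⟩, hys⟩ : ∃ y, L y ∧ y₀ - s < y := by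
      by_contra! h
      have := hy₀.2 (show y₀ - s ∈ upperBounds {x | L x} from fun y hy => h y hy)
      linarith
    have hnot : ¬ L (y₀ + s) := fun h => by
      have := hy₀.1 h
      linarith
    have h' : ∃ v s', B v s' ∧ s' ≤ min s s₀ ∧ v k ≤ y₀ + s := by
      by_contra! h
      exact hnot ⟨min s s₀, lt_min hs hs₀, fun v s' hv => h v s' hv.1 hv.2⟩
    obtain ⟨v, s', hv, hs', hvk⟩ := h'
    have hv' := hy v s' ⟨hv, hs'.trans (min_le_right _ _)⟩
    obtain ⟨h1, h2, s'', h3, h4, h5⟩ := hv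
    have hs's : s' ≤ s := hs'.trans (min_le_left _ _)
    refine ⟨v, s'', h3, h4.trans hs's, h5, fun i hi => ?_⟩
    rcases Finset.mem_insert.1 hi with rfl | hi
    · rw [Function.update_self, abs_le]
      constructor <;> linarith
    · have : i ≠ k := fun h => hk (h ▸ hi)
      rw [Function.update_of_ne this, abs_le]
      constructor <;> linarith [(h2 i hi).1, (h2 i hi).2]

variable [TopologicalSpace R] [OrderTopology R]

/-- A nonnegative polynomial function attains its minimum on a closed ball. -/
theorem exists_min_on_ball {f : (Fin n → R) → R} (hf : PolyMap R f) (hcont : Continuous f)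
    (h0 : ∀ z, 0 ≤ f z) (x : Fin n → R) {r : R} (hr : 0 ≤ r) :
    ∃ z, sqd z x ≤ r ∧ ∀ w, sqd w x ≤ r → f z ≤ f w := by
  -- Signs are reversed so that the supremum m of P is minus the infimum of f on the ball. A cluster
  -- point of the sets {f ≤ -m + s} is then a minimum.
  let P : R → Prop := fun y => ∃ z, sqd z x ≤ r ∧ f z ≤ -y
  have hP : Def R P := Def.exVec (P := fun y z => sqd z x ≤ r ∧ f z ≤ -y)
    ((Def.le (by fun_prop) (by fun_prop)).and (Def.le (by fun_prop) (by fun_prop)))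
  obtain ⟨m, hm⟩ := hP.exists_isLUB ⟨-f x, x, by simpa using hr, by simp⟩
    ⟨0, fun y ⟨z, _, hz⟩ => by linarith [h0 z]⟩
  have hlow : ∀ w, sqd w x ≤ r → -m ≤ f w := fun w hw => by
    have := hm.1 (show P (-f w) from ⟨w, hw, by simp⟩)
    linarith
  obtain ⟨c, hc⟩ := Def.exists_cluster (A := fun z s => sqd z x ≤ r ∧ f z ≤ -m + s)
    (M := (r + 1) + ∑ i, |x i|)
    ((Def.le (by fun_prop) (by fun_prop)).and (Def.le (by fun_prop) (by fun_prop)))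
    (by
      rintro v s ⟨h, -⟩ i
      have h1 : (v i - x i) ^ 2 ≤ (r + 1) ^ 2 :=
        ((sq_sub_le_sqd v x i).trans h).trans (by nlinarith)
      have h2 := abs_le_of_sq_le_sq h1 (by positivity)
      have h3 : |x i| ≤ ∑ i, |x i| :=
        Finset.single_le_sum (f := fun i => |x i|) (fun _ _ => abs_nonneg _) (Finset.mem_univ i)
      have h4 : |v i| ≤ |v i - x i| + |x i| := by simpa using abs_add_le (v i - x i) (x i)
      linarith)
    (by
      intro s hs
      obtain ⟨y, ⟨z, hz1, hz2⟩, hy⟩ : ∃ y, P y ∧ m - s < y := by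
        by_contra! h
        have := hm.2 (show m - s ∈ upperBounds {x | P x} from fun y hy => h y hy)
        linarith
      exact ⟨z, s, hs, le_rfl, hz1, by linarith⟩)
  have hclose : ∀ ρ > 0, ∀ s > 0, ∃ v, sqd v c ≤ ρ ∧ sqd v x ≤ r ∧ f v ≤ -m + s := by
    intro ρ hρ s hs
    have hn : (0 : R) < n + 1 := by positivity
    set t := min s (min 1 (ρ / (n + 1))) with ht
    have ht0 : 0 < t := lt_min hs (lt_min one_pos (by positivity))
    have ht1 : t ≤ 1 := (min_le_right _ _).trans (min_le_left _ _)
    have htρ : t ≤ ρ / (n + 1) := (min_le_right _ _).trans (min_le_right _ _)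
    obtain ⟨v, s', h1, h2, ⟨h3, h4⟩, h5⟩ := hc t ht0
    refine ⟨v, ?_, h3, by linarith [min_le_left s (min 1 (ρ / (n + 1)))]⟩
    calc sqd v c ≤ ∑ _i : Fin n, t := Finset.sum_le_sum fun i _ => by
          rw [← sq_abs]; nlinarith [h5 i, abs_nonneg (v i - c i)]
      _ = n * t := by simp
      _ ≤ (n + 1) * (ρ / (n + 1)) := by nlinarith
      _ = ρ := by field_simp
  refine ⟨c, ?_, fun w hw => ?_⟩
  · by_contra! h
    obtain ⟨ρ, hρ, hsub⟩ := exists_sqd_le_subset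
      ((isOpen_lt continuous_const (by fun_prop : Continuous fun z => sqd z x)).mem_nhds h)
    obtain ⟨v, h1, h2, -⟩ := hclose ρ hρ 1 one_pos
    exact absurd h2 (not_le.2 (hsub v h1))
  · refine le_trans ?_ (hlow w hw)
    by_contra! h
    have h' : -m < (f c - m) / 2 := by linarith
    have h'' : (f c - m) / 2 < f c := by linarith
    obtain ⟨ρ, hρ, hsub⟩ := exists_sqd_le_subset
      ((isOpen_lt continuous_const hcont).mem_nhds h'')
    obtain ⟨v, h1, -, h3⟩ := hclose ρ hρ ((f c + m) / 2) (by linarith)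
    have h4 : (f c - m) / 2 < f v := hsub v h1
    linarith

end Extremum

section Inverse

open MvPolynomial

variable {R : Type*} [Field R] [LinearOrder R] [IsStrictOrderedRing R]
  [TopologicalSpace R] [OrderTopology R] {n : ℕ}

/-- Hadamard's lemma. -/
theorem MvPolynomial.exists_hadamard (p : MvPolynomial (Fin n) R) :
    ∃ Q : Fin n → (Fin n → R) → (Fin n → R) → R,
      (∀ j, Continuous fun q : (Fin n → R) × (Fin n → R) => Q j q.1 q.2) ∧
      (∀ z w, eval z p - eval w p = ∑ j, Q j z w * (z j - w j)) ∧
      ∀ z j, Q j z z = eval z (pderiv j p) := by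
  classical
  induction p using MvPolynomial.induction_on with
  | C a => exact ⟨fun _ _ _ => 0, fun _ => continuous_const, by simp, by simp⟩
  | add p q hp hq =>
    obtain ⟨P, hP1, hP2, hP3⟩ := hp
    obtain ⟨Q, hQ1, hQ2, hQ3⟩ := hq
    refine ⟨fun j z w => P j z w + Q j z w, fun j => (hP1 j).add (hQ1 j), fun z w => ?_,
      fun z j => by simp [hP3, hQ3]⟩
    simp only [add_mul, Finset.sum_add_distrib, ← hP2, ← hQ2, map_add]
    ring
  | mul_X p i hp =>
    obtain ⟨P, hP1, hP2, hP3⟩ := hp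
    have hc : Continuous fun z : Fin n → R => eval z p := MvPolynomial.continuous_eval p
    -- From p(z) z_i - p(w) w_i = (p(z) - p(w)) z_i + p(w) (z_i - w_i).
    refine ⟨fun j z w => P j z w * z i + if j = i then eval w p else 0, fun j => ?_,
      fun z w => ?_, fun z j => ?_⟩
    · refine ((hP1 j).mul (by fun_prop)).add ?_
      by_cases h : j = i
      · simp only [h, if_true]; fun_prop
      · simp only [h, if_false]; fun_prop
    · have : ∀ j, (P j z w * z i + if j = i then eval w p else 0) * (z j - w j) =
          z i * (P j z w * (z j - w j)) + if j = i then eval w p * (z j - w j) else 0 := by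
        intro j; split_ifs <;> ring
      simp only [this, Finset.sum_add_distrib, ← Finset.mul_sum, ← hP2, Finset.sum_ite_eq',
        Finset.mem_univ, if_true, map_mul, eval_X]
      ring
    · simp only [hP3, Derivation.leibniz, map_add, smul_eq_mul, map_mul, eval_X, pderiv_X,
        Pi.single_apply]
      by_cases h : j = i
      · subst h; simp; ring
      · simp [h, Ne.symm h, mul_comm]

/-- A polynomial has vanishing derivatives at a local minimum. -/
theorem MvPolynomial.eval_pderiv_eq_zero_of_isLocalMin {p : MvPolynomial (Fin n) R}
    {x : Fin n → R} (hx : ∀ᶠ z in 𝓝 x, eval x p ≤ eval z p) (j : Fin n) :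
    eval x (pderiv j p) = 0 := by
  classical
  obtain ⟨Q, hQ1, hQ2, hQ3⟩ := p.exists_hadamard
  let l : R → Fin n → R := fun t => x + Pi.single j t
  have hl0 : l 0 = x := by simp [l]
  have hl : Continuous l := by
    refine continuous_pi fun i => ?_
    simp only [l, Pi.add_apply, Pi.single_apply]
    by_cases h : i = j
    · simp only [h, if_true]; fun_prop
    · simp only [h, if_false]; fun_prop
  have hdiff : ∀ t, eval (l t) p - eval x p = t * Q j (l t) x := by
    intro t
    rw [hQ2, Finset.sum_eq_single j]
    · simp [l, mul_comm]
    · intro i _ hi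
      simp [l, hi]
    · simp
  have hg : Continuous fun t => Q j (l t) x := (hQ1 j).comp (hl.prodMk continuous_const)
  have hmin : ∀ᶠ t in 𝓝 (0 : R), 0 ≤ t * Q j (l t) x := by
    have : Filter.Tendsto l (𝓝 0) (𝓝 x) := by
      have := hl.tendsto 0
      rwa [hl0] at this
    filter_upwards [this.eventually hx] with t ht
    rw [← hdiff]
    exact sub_nonneg.2 ht
  rw [← hQ3]
  -- If Q_j(x, x) is nonzero, the increment t Q_j(l t, x) takes negative values for arbitrarily
  -- small t of a suitable sign.
  rcases lt_trichotomy (Q j x x) 0 with h | h | h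
  · have : ∀ᶠ t in 𝓝 (0 : R), Q j (l t) x < 0 :=
      (isOpen_lt hg continuous_const).mem_nhds (by simpa [hl0] using h)
    obtain ⟨ρ, hρ, hN⟩ := exists_abs_le_subset (hmin.and this)
    obtain ⟨h1, h2⟩ := hN ρ (by simp [abs_of_pos hρ])
    exact absurd h1 (not_le.2 (mul_neg_of_pos_of_neg hρ h2))
  · exact h
  · have : ∀ᶠ t in 𝓝 (0 : R), 0 < Q j (l t) x :=
      (isOpen_lt continuous_const hg).mem_nhds (by simpa [hl0] using h)
    obtain ⟨ρ, hρ, hN⟩ := exists_abs_le_subset (hmin.and this)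
    obtain ⟨h1, h2⟩ := hN (-ρ) (by simp [abs_of_pos hρ])
    exact absurd h1 (not_le.2 (mul_neg_of_neg_of_pos (neg_neg_of_pos hρ) h2))

@[fun_prop]
theorem continuous_polyEval {m : ℕ} (H : Fin m → MvPolynomial (Fin n) R) :
    Continuous (polyEval H) :=
  continuous_pi fun i => MvPolynomial.continuous_eval (H i)

/-- Hadamard's lemma gives H z - H w = q(z, w)(z - w) with q(x, x) the Jacobian matrix. Multiplying
by the adjugate and using Cauchy–Schwarz, det² |z - w|² ≤ N |H z - H w|², where N is the sum of the
squares of the adjugate entries; near (x, x) one has κ N < det². -/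
theorem exists_goodBall {H : Fin n → MvPolynomial (Fin n) R} {x : Fin n → R}
    (hx : (jacobianMatrixAt H x).det ≠ 0) : ∃ r, GoodBall H x r := by
  choose Q hQ1 hQ2 hQ3 using fun i => (H i).exists_hadamard
  let q : (Fin n → R) × (Fin n → R) → Matrix (Fin n) (Fin n) R :=
    fun p => Matrix.of fun i j => Q i j p.1 p.2
  have hqc : Continuous q := continuous_matrix fun i j => hQ1 i j
  have hqd : ∀ z, q (z, z) = jacobianMatrixAt H z := fun z => by
    ext i j; exact hQ3 i z j
  let N : (Fin n → R) × (Fin n → R) → R := fun p => ∑ i, ∑ j, (q p).adjugate i j ^ 2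
  have hNc : Continuous N := continuous_finsetSum _ fun i _ => continuous_finsetSum _ fun j _ =>
    (hqc.matrix_adjugate.matrix_elem i j).pow 2
  have hN0 : ∀ p, 0 ≤ N p := fun p =>
    Finset.sum_nonneg fun i _ => Finset.sum_nonneg fun j _ => sq_nonneg _
  have hDc : Continuous fun p => (q p).det := hqc.matrix_det
  set D₀ := (q (x, x)).det with hD₀
  have hD₀0 : D₀ ≠ 0 := by rw [hD₀, hqd]; exact hx
  have hN0x := hN0 (x, x)
  -- The + 1 avoids a zero denominator, and the 2 makes κ N < det² at (x, x) with room to spare.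
  set κ := D₀ ^ 2 / (2 * (N (x, x) + 1)) with hκ
  have hκ0 : 0 < κ := by positivity
  have hpos : κ * N (x, x) < D₀ ^ 2 := by
    have h1 : κ * (2 * (N (x, x) + 1)) = D₀ ^ 2 := by rw [hκ]; field_simp
    nlinarith
  have hev : ∀ᶠ p in 𝓝 (x, x), κ * N p < (q p).det ^ 2 :=
    (isOpen_lt (by fun_prop) (by fun_prop)).mem_nhds hpos
  obtain ⟨U, hU, V, hV, hUV⟩ := mem_nhds_prod_iff.1 hev
  obtain ⟨ρ, hρ, hsub⟩ := exists_sqd_le_subset (Filter.inter_mem hU hV)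
  refine ⟨min ρ κ, lt_min hρ hκ0, fun z hz => ⟨?_, fun w hw => ?_⟩⟩
  · have hz' := hsub z (hz.trans (min_le_left _ _))
    intro h0
    have h' : κ * N (z, z) < (q (z, z)).det ^ 2 := hUV ⟨hz'.1, hz'.2⟩
    rw [hqd, h0] at h'
    have := mul_nonneg hκ0.le (hN0 (z, z))
    linarith [h'.trans_le (by simp : (0 : R) ^ 2 ≤ 0)]
  · have h : κ * N (z, w) < (q (z, w)).det ^ 2 :=
      hUV ⟨(hsub z (hz.trans (min_le_left _ _))).1, (hsub w (hw.trans (min_le_left _ _))).2⟩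
    have hmul : (q (z, w)).mulVec (z - w) = polyEval H z - polyEval H w := by
      ext i
      simp only [Matrix.mulVec, dotProduct, Pi.sub_apply, polyEval, hQ2 i z w]
      rfl
    have hadj : ∀ i, (q (z, w)).det * (z i - w i) =
        ∑ j, (q (z, w)).adjugate i j * (polyEval H z j - polyEval H w j) := by
      intro i
      have h1 : (q (z, w)).adjugate.mulVec ((q (z, w)).mulVec (z - w)) =
          (q (z, w)).det • (z - w) := by
        rw [Matrix.mulVec_mulVec, Matrix.adjugate_mul, Matrix.smul_mulVec, Matrix.one_mulVec]
      have h2 := congrFun h1 i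
      rw [hmul] at h2
      simpa [Matrix.mulVec, dotProduct] using h2.symm
    have hle : (q (z, w)).det ^ 2 * sqd z w ≤ N (z, w) * sqd (polyEval H z) (polyEval H w) := by
      rw [sqd, Finset.mul_sum]
      simp only [N]
      rw [Finset.sum_mul]
      refine Finset.sum_le_sum fun i _ => ?_
      rw [← mul_pow, hadj i]
      exact Finset.sum_mul_sq_le_sq_mul_sq _ _ _
    have hz0 := sqd_nonneg z w
    by_contra! hlt
    have hlt' : sqd (polyEval H z) (polyEval H w) < κ * sqd z w :=
      hlt.trans_le (mul_le_mul_of_nonneg_right (min_le_right _ _) hz0)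
    have hz1 : 0 < sqd z w := by
      rcases hz0.eq_or_lt with h0 | h0
      · rw [← h0, mul_zero] at hlt'
        exact absurd hlt' (not_lt.2 (sqd_nonneg _ _))
      · exact h0
    nlinarith [mul_le_mul_of_nonneg_left hlt'.le (hN0 (z, w)), mul_lt_mul_of_pos_right h hz1]

/-- The inverse function theorem: the image of a good ball contains a ball. -/
theorem GoodBall.exists_polyEval_eq [IsRealClosed R] {H : Fin n → MvPolynomial (Fin n) R}
    {x : Fin n → R} {r : R} (h : GoodBall H x r) {w : Fin n → R}
    (hw : 4 * sqd (polyEval H x) w < r * r) : ∃ z, sqd z x ≤ r ∧ polyEval H z = w := by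
  obtain ⟨hr, h⟩ := h
  let F : MvPolynomial (Fin n) R := ∑ i, (H i - C (w i)) ^ 2
  have hF : ∀ z, eval z F = sqd (polyEval H z) w := fun z => by simp [F, sqd, polyEval]
  -- Take the point of the ball whose image is nearest to w. Expansion keeps it off the boundary, so
  -- H z - w is annihilated by the invertible Jacobian.
  obtain ⟨z, hz, hmin⟩ := exists_min_on_ball (f := fun z => sqd (polyEval H z) w) (by fun_prop)
    (by fun_prop) (fun z => sqd_nonneg _ _) x hr.le
  refine ⟨z, hz, ?_⟩
  have hx : sqd x x ≤ r := by simpa using hr.le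
  have h1 : sqd (polyEval H z) w ≤ sqd (polyEval H x) w := hmin x hx
  have hlt : sqd z x < r := by
    refine hz.lt_of_ne fun heq => ?_
    have h2 := (h z hz).2 x hx
    have h3 := sqd_le (polyEval H z) w (polyEval H x)
    rw [heq] at h2
    rw [sqd_comm w] at h3
    linarith
  have hcrit := fun j => MvPolynomial.eval_pderiv_eq_zero_of_isLocalMin (p := F) (x := z) (by
    have : {y | sqd y x < r} ∈ 𝓝 z := (isOpen_lt (by fun_prop) continuous_const).mem_nhds hlt
    filter_upwards [this] with y hy
    rw [hF, hF]
    exact hmin y (le_of_lt hy)) j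
  have hvec : Matrix.vecMul (polyEval H z - w) (jacobianMatrixAt H z) = 0 := by
    ext j
    have hj := hcrit j
    simp only [F, map_sum, Derivation.leibniz_pow, map_sub, pderiv_C, sub_zero, smul_eq_mul,
      nsmul_eq_mul, map_mul, eval_C, Nat.cast_ofNat, map_ofNat, pow_one,
      Nat.add_one_sub_one] at hj
    rw [← Finset.mul_sum] at hj
    simpa [Matrix.vecMul, dotProduct, jacobianMatrixAt, polyEval] using hj
  exact sub_eq_zero.1 (Matrix.eq_zero_of_vecMul_eq_zero (h z hz).1 hvec)

end Inverse

end

section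

open IsLocalRing

/-! ### Regular systems of parameters -/

section RegularLocal

theorem IsLocalRing.maximalIdeal_quotient_eq_map {B : Type*} [CommRing B] [IsLocalRing B]
    (I : Ideal B) [IsLocalRing (B ⧸ I)] (hI : I ≤ maximalIdeal B) :
    maximalIdeal (B ⧸ I) = (maximalIdeal B).map (Ideal.Quotient.mk I) :=
  (eq_maximalIdeal (Ideal.IsMaximal.map_of_surjective_of_ker_le Ideal.Quotient.mk_surjective
    (by rwa [Ideal.mk_ker]))).symm

/-- A Noetherian local ring whose maximal ideal is generated by at most as many elements as its
height is a domain. -/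
theorem IsLocalRing.isDomain_of_span_eq_maximalIdeal (e : ℕ) : ∀ {B : Type*} [CommRing B]
    [IsLocalRing B] [IsNoetherianRing B] (h : Fin e → B),
    Ideal.span (Set.range h) = maximalIdeal B → (e : ℕ∞) ≤ (maximalIdeal B).height →
    IsDomain B := by
  induction e with
  | zero =>
    intro B _ _ _ h hspan _
    have : maximalIdeal B = ⊥ := by rw [← hspan]; simp
    exact (isField_iff_maximalIdeal_eq.2 this).isDomain
  | succ e ih =>
    intro B _ _ _ h hspan hht
    classical
    set M := maximalIdeal B with hM
    have hfin := minimalPrimes.finite_of_isNoetherianRing B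
    -- Prime avoidance, with M² occupying both slots for ideals that need not be prime. Otherwise M
    -- = M², so M = 0 by Nakayama, or M is a minimal prime; both contradict positive height.
    have hav : ¬ ((M : Set B) ⊆ (M ^ 2 : Ideal B) ∪ (M ^ 2 : Ideal B) ∪
        ⋃ q ∈ (hfin.toFinset : Set (Ideal B)), (q : Set B)) := by
      intro hsub
      rcases (Ideal.subset_union_prime' (f := fun I : Ideal B => I) (a := M ^ 2) (b := M ^ 2)
        (fun q hq => (hfin.mem_toFinset.1 hq).isPrime)).1 hsub with
        h1 | h1 | ⟨q, hq, h1⟩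
      iterate 2
        · have hb : M = ⊥ := Submodule.eq_bot_of_le_smul_of_le_jacobson_bot M M
            (IsNoetherian.noetherian M) (by rwa [smul_eq_mul, ← sq])
            (jacobson_eq_maximalIdeal ⊥ bot_ne_top).ge
          have hd : IsDomain B := (isField_iff_maximalIdeal_eq.2 hb).isDomain
          rw [hb, Ideal.height_bot] at hht
          simp at hht
      · have hqm := hfin.mem_toFinset.1 hq
        have hqp : q.IsPrime := hqm.isPrime
        have : M = q := le_antisymm h1 (le_maximalIdeal hqp.ne_top)
        rw [this, Ideal.height_eq_zero_iff.2 hqm] at hht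
        simp at hht
    obtain ⟨x, hxM, hx⟩ := Set.not_subset.1 hav
    simp only [Set.mem_union, not_or, Set.mem_iUnion, SetLike.mem_coe,
      not_exists, Set.Finite.coe_toFinset] at hx
    obtain ⟨⟨hx2, -⟩, hxq⟩ := hx
    have hxle : Ideal.span {x} ≤ M := (Ideal.span_singleton_le_iff_mem _).2 hxM
    have hnt : Nontrivial (B ⧸ Ideal.span {x}) :=
      Ideal.Quotient.nontrivial_iff.2 fun htop => (maximalIdeal.isMaximal B).ne_top
        (top_le_iff.1 (htop ▸ hxle))
    have hloc : IsLocalRing (B ⧸ Ideal.span {x}) :=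
      .of_surjective' (Ideal.Quotient.mk _) Ideal.Quotient.mk_surjective
    have hmax := maximalIdeal_quotient_eq_map _ hxle
    set π := Ideal.Quotient.mk (Ideal.span {x})
    obtain ⟨a, ha⟩ := (Ideal.mem_span_range_iff_exists_fun (R := B)).1
      (show x ∈ Ideal.span (Set.range h) by rwa [hspan])
    -- Since x is not in M², some coefficient of x = ∑ a_i h_i is a unit, and h_i is redundant
    -- modulo x.
    obtain ⟨i, hi⟩ : ∃ i, a i ∉ M := by
      by_contra! hall
      refine hx2 (ha ▸ Ideal.sum_mem _ fun i _ => ?_)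
      rw [sq]
      exact Ideal.mul_mem_mul (hall i) (hspan ▸ Ideal.subset_span ⟨i, rfl⟩)
    have hai : IsUnit (a i) := by
      by_contra hn; exact hi ((mem_maximalIdeal _).2 hn)
    have hspan' : Ideal.span (Set.range fun j => π (h (i.succAbove j))) = maximalIdeal _ := by
      rw [hmax, ← hM, ← hspan, Ideal.map_span]
      refine le_antisymm (Ideal.span_mono ?_) (Ideal.span_le.2 ?_)
      · rintro _ ⟨j, rfl⟩
        exact Set.mem_image_of_mem _ (Set.mem_range_self _)
      · rintro _ ⟨_, ⟨j, rfl⟩, rfl⟩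
        rcases Fin.eq_self_or_eq_succAbove i j with rfl | ⟨k, rfl⟩
        · have hπx : π (∑ i, a i * h i) = 0 := by
            rw [ha]
            exact Ideal.Quotient.eq_zero_iff_mem.2 (Ideal.mem_span_singleton_self x)
          rw [map_sum, Fin.sum_univ_succAbove _ j, map_mul] at hπx
          have hmem : π (a j) * π (h j) ∈
              Ideal.span (Set.range fun k => π (h (j.succAbove k))) := by
            rw [eq_neg_of_add_eq_zero_left hπx]
            refine Ideal.neg_mem_iff _ |>.2 (Ideal.sum_mem _ fun k _ => ?_)
            rw [map_mul]
            exact Ideal.mul_mem_left _ _ (Ideal.subset_span ⟨k, rfl⟩)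
          exact (Ideal.unit_mul_mem_iff_mem _ (hai.map π)).1 hmem
        · exact Ideal.subset_span ⟨k, rfl⟩
    have hht' : (e : ℕ∞) ≤ (maximalIdeal (B ⧸ Ideal.span {x})).height := by
      have h1 := hht.trans (Ideal.height_le_height_add_one_of_mem hxM)
      rw [hmax]
      push_cast at h1
      exact (ENat.add_le_add_iff_right (by simp)).1 h1
    have hdom := ih _ hspan' hht'
    have hprime : (Ideal.span {x}).IsPrime := (Ideal.Quotient.isDomain_iff_prime _).1 hdom
    -- A minimal prime q inside the prime (x) does not contain x, so q = xq, and Nakayama gives q =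
    -- 0.
    obtain ⟨q, hqmin, hqle⟩ := Ideal.exists_minimalPrimes_le (bot_le : ⊥ ≤ Ideal.span {x})
    have hqp : q.IsPrime := hqmin.isPrime
    have hq0 : q = ⊥ := by
      refine Submodule.eq_bot_of_le_smul_of_le_jacobson_bot (Ideal.span {x}) q
        (IsNoetherian.noetherian q) ?_ (hxle.trans (jacobson_eq_maximalIdeal ⊥ bot_ne_top).ge)
      intro y hy
      obtain ⟨z, rfl⟩ := Ideal.mem_span_singleton'.1 (hqle hy)
      rw [mul_comm, smul_eq_mul]
      exact Ideal.mul_mem_mul (Ideal.mem_span_singleton_self x)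
        ((hqp.mem_or_mem hy).resolve_right (hxq q hqmin))
    have : (⊥ : Ideal B).IsPrime := hq0 ▸ hqp
    exact IsDomain.of_bot_isPrime B

/-- Part of a regular system of parameters generates a prime ideal. -/
theorem IsLocalRing.isPrime_span_image {S : Type*} [CommRing S] [IsLocalRing S]
    [IsNoetherianRing S] {n : ℕ} (h : Fin n → S)
    (hspan : Ideal.span (Set.range h) = maximalIdeal S) (hht : (n : ℕ∞) ≤ (maximalIdeal S).height)
    (T : Finset (Fin n)) : (Ideal.span (h '' T)).IsPrime := by
  classical
  set P := Ideal.span (h '' T) with hP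
  have hle : P ≤ maximalIdeal S := by
    rw [← hspan]; exact Ideal.span_mono (Set.image_subset_range _ _)
  have hnt : Nontrivial (S ⧸ P) :=
    Ideal.Quotient.nontrivial_iff.2 fun htop => (maximalIdeal.isMaximal S).ne_top
      (top_le_iff.1 (htop ▸ hle))
  have hloc : IsLocalRing (S ⧸ P) :=
    .of_surjective' (Ideal.Quotient.mk _) Ideal.Quotient.mk_surjective
  have hmax := maximalIdeal_quotient_eq_map _ hle
  rw [← Ideal.Quotient.isDomain_iff_prime]
  have hcard : Tᶜ.card = n - T.card := by rw [Finset.card_compl, Fintype.card_fin]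
  have hTn : T.card ≤ n := by simpa using T.card_le_univ
  -- Modulo the span of T, the other n - |T| elements generate the maximal ideal, and the height
  -- drops by at most |T|.
  refine isDomain_of_span_eq_maximalIdeal Tᶜ.card
    (fun j => Ideal.Quotient.mk P (h (Tᶜ.orderEmbOfFin rfl j))) ?_ ?_
  · rw [hmax, ← hspan, Ideal.map_span]
    refine le_antisymm (Ideal.span_mono ?_) (Ideal.span_le.2 ?_)
    · rintro _ ⟨j, rfl⟩
      exact Set.mem_image_of_mem _ (Set.mem_range_self _)
    · rintro _ ⟨_, ⟨j, rfl⟩, rfl⟩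
      by_cases hj : j ∈ T
      · rw [Ideal.Quotient.eq_zero_iff_mem.2 (Ideal.subset_span (Set.mem_image_of_mem h hj))]
        exact Ideal.zero_mem _
      · have : j ∈ Set.range (Tᶜ.orderEmbOfFin rfl) := by
          rw [Finset.range_orderEmbOfFin]; simpa using hj
        obtain ⟨k, rfl⟩ := this
        exact Ideal.subset_span ⟨k, rfl⟩
  · have h1 := hht.trans (Ideal.height_le_height_add_encard_of_subset (h '' T)
      (p := maximalIdeal S) (Ideal.span_le.1 hle))
    have h2 : (h '' T).encard ≤ T.card :=
      (Set.encard_image_le _ _).trans (by rw [Set.encard_coe_eq_coe_finsetCard])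
    have h3 := h1.trans (add_le_add_right h2 _)
    rw [hmax, hcard]
    have h4 : (n : ℕ∞) = ((n - T.card : ℕ) : ℕ∞) + (T.card : ℕ∞) := by
      rw [← Nat.cast_add, Nat.sub_add_cancel hTn]
    rw [h4] at h3
    exact (ENat.add_le_add_iff_right (by simp)).1 h3

end RegularLocal

end

section

universe u

open IsLocalRing

/-! ### Bounding the Krull dimension by the Jacobian criterion -/

/-- Incomparability: contraction of primes along an integral extension is strictly monotone. -/
theorem ringKrullDim_le_of_isIntegral {A B : Type*} [CommRing A] [CommRing B] [Algebra A B]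
    [Algebra.IsIntegral A B] : ringKrullDim B ≤ ringKrullDim A :=
  Order.krullDim_le_of_strictMono (PrimeSpectrum.comap (algebraMap A B)) fun _ _ h =>
    Ideal.IsIntegral.comap_lt_comap h

/-- The Krull dimension of an affine domain is at most its transcendence degree. -/
theorem ringKrullDim_le_of_isAlgebraic_adjoin {k B L : Type u} [Field k] [CommRing B] [Field L]
    [Algebra k B] [Algebra k L] [Algebra B L] [IsScalarTower k B L] [FaithfulSMul B L]
    [Algebra.FiniteType k B] {d : ℕ} (s : Finset L) (hs : s.card ≤ d)
    [Algebra.IsAlgebraic (Algebra.adjoin k (s : Set L)) L] : ringKrullDim B ≤ d := by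
  have hinj : Function.Injective (algebraMap B L) := FaithfulSMul.algebraMap_injective B L
  have : Nontrivial B := (algebraMap B L).domain_nontrivial
  -- Noether normalization: B is integral over a polynomial ring in e variables, whose images are
  -- algebraically independent in L, so e is at most the number of elements of s.
  obtain ⟨e, g, hg, hint⟩ := exists_integral_inj_algHom_of_fg k B
  have h1 : ringKrullDim B ≤ e := by
    let := g.toRingHom.toAlgebra
    have : Algebra.IsIntegral (MvPolynomial (Fin e) k) B := ⟨hint⟩
    refine (ringKrullDim_le_of_isIntegral (A := MvPolynomial (Fin e) k)).trans ?_
    rw [MvPolynomial.ringKrullDim_of_isNoetherianRing]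
    simp
  have h2 : AlgebraicIndependent k fun i => algebraMap B L (g (MvPolynomial.X i)) := by
    rw [AlgebraicIndependent]
    have : MvPolynomial.aeval (fun i => algebraMap B L (g (MvPolynomial.X i))) =
        (IsScalarTower.toAlgHom k B L).comp g := by
      ext i; simp
    rw [this]
    exact hinj.comp hg
  have h3 := h2.lift_cardinalMk_le_trdeg
  have h4 := Algebra.IsAlgebraic.trdeg_le_cardinalMk k (s : Set L)
  have h5 : e ≤ d := by
    refine le_trans ?_ hs
    have := h3.trans (Cardinal.lift_le.2 h4)
    simpa using this
  exact h1.trans (by exact_mod_cast h5)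

theorem Derivation.apply_aeval {k A M : Type*} [CommRing k] [CommRing A] [Algebra k A] {n : ℕ}
    [AddCommGroup M] [Module k M] [Module A M] (D : Derivation k A M) (x : Fin n → A)
    (f : MvPolynomial (Fin n) k) : D (MvPolynomial.aeval x f) =
      ∑ j, MvPolynomial.aeval x (MvPolynomial.pderiv j f) • D (x j) := by
  classical
  induction f using MvPolynomial.induction_on with
  | C a => simp
  | add p q hp hq => simp [hp, hq, add_smul, Finset.sum_add_distrib]
  | mul_X p i hp =>
    simp [hp, MvPolynomial.pderiv_X, Pi.single_apply, apply_ite (MvPolynomial.aeval x), add_smul, Finset.sum_add_distrib,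
      Finset.smul_sum, smul_smul, mul_comm, add_comm]

theorem Matrix.eq_zero_of_sum_smul_eq_zero {A M : Type*} [CommRing A] [AddCommGroup M] [Module A M]
    {n : ℕ} (J : Matrix (Fin n) (Fin n) A) (hJ : IsUnit J.det) (v : Fin n → M)
    (h : ∀ i, ∑ j, J i j • v j = 0) (j : Fin n) : v j = 0 := by
  have : ∑ i, J⁻¹ j i • ∑ k, J i k • v k = v j := by
    simp only [Finset.smul_sum, smul_smul]
    rw [Finset.sum_comm]
    simp only [← Finset.sum_smul, ← Matrix.mul_apply, Matrix.nonsing_inv_mul J hJ,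
      Matrix.one_apply, ite_smul, one_smul, zero_smul, Finset.sum_ite_eq, Finset.mem_univ, if_true]
  simpa [h] using this.symm

/-- The polynomial Jacobian matrix. -/
noncomputable def jacobianPoly {K : Type*} [Field K] {n m : ℕ}
    (g : Fin m → MvPolynomial (Fin n) K) : Matrix (Fin m) (Fin n) (MvPolynomial (Fin n) K) :=
  Matrix.of fun i j => MvPolynomial.pderiv j (g i)

theorem eval_det_jacobianPoly {K : Type*} [Field K] {n : ℕ}
    (g : Fin n → MvPolynomial (Fin n) K) (y : Fin n → K) :
    MvPolynomial.eval y (jacobianPoly g).det = (jacobianMatrixAt g y).det := by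
  rw [RingHom.map_det]
  rfl

/-- The universal derivation of L over K(s) kills every H_i(x). The Jacobian being invertible, it
kills every x_j and hence all of L. So L is unramified over K(s), that is, separable algebraic. -/
theorem isAlgebraic_adjoin_of_det_ne_zero {K L : Type u} [Field K] [CharZero K] [Field L]
    [Algebra K L] [Algebra.EssFiniteType K L] {n : ℕ} (x : Fin n → L)
    (hx : ∀ y : L, ∃ a b : MvPolynomial (Fin n) K,
      MvPolynomial.aeval x a / MvPolynomial.aeval x b = y)
    (H : Fin n → MvPolynomial (Fin n) K) (s : Set L)
    (hs : ∀ i, MvPolynomial.aeval x (H i) = 0 ∨ MvPolynomial.aeval x (H i) ∈ s)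
    (hdet : MvPolynomial.aeval x (jacobianPoly H).det ≠ 0) :
    Algebra.IsAlgebraic (Algebra.adjoin K s) L := by
  let F := IntermediateField.adjoin K s
  have hessFL : Algebra.EssFiniteType F L := .of_comp K F L
  have hunr : Algebra.FormallyUnramified F L := by
    constructor
    let D : Derivation K L (Ω[L⁄F]) := (KaehlerDifferential.D F L).restrictScalars K
    have hDX : ∀ j, D (x j) = 0 := by
      have hJ : IsUnit (((jacobianPoly H).map (MvPolynomial.aeval x)).det) := by
        rw [isUnit_iff_ne_zero, ← AlgHom.mapMatrix_apply, ← AlgHom.map_det]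
        exact hdet
      refine Matrix.eq_zero_of_sum_smul_eq_zero _ hJ _ fun i => ?_
      have h1 := D.apply_aeval x (H i)
      have h2 : D (MvPolynomial.aeval x (H i)) = 0 := by
        rcases hs i with hi | hi
        · rw [hi, map_zero]
        · exact (KaehlerDifferential.D F L).map_algebraMap
            ⟨_, IntermediateField.subset_adjoin _ _ hi⟩
      rw [h2] at h1
      exact h1.symm
    have hDP : ∀ f, D (MvPolynomial.aeval x f) = 0 := fun f =>
      (D.apply_aeval x f).trans (Finset.sum_eq_zero fun j _ => by rw [hDX, smul_zero])
    have hDL : ∀ y : L, KaehlerDifferential.D F L y = 0 := by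
      intro y
      obtain ⟨a, b, rfl⟩ := hx y
      change D _ = 0
      rw [Derivation.leibniz_div, hDP a, hDP b]; simp
    refine subsingleton_of_forall_eq 0 fun w => ?_
    have : w ∈ (⊤ : Submodule L (Ω[L⁄F])) := trivial
    rw [← KaehlerDifferential.span_range_derivation] at this
    induction this using Submodule.span_induction with
    | mem x hx => obtain ⟨y, rfl⟩ := hx; exact hDL y
    | zero => rfl
    | add x y _ _ hx hy => rw [hx, hy, add_zero]
    | smul a x _ hx => rw [hx, smul_zero]
  have hsep : Algebra.IsSeparable F L := (Algebra.FormallyUnramified.iff_isSeparable F L).1 hunr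
  open scoped IntermediateField.algebraAdjoinAdjoin in
  exact (IsFractionRing.comap_isAlgebraic_iff (A := Algebra.adjoin K s) (K := F)).2 inferInstance

/-- In the fraction field of the quotient the H_i with i in T vanish, so that field is algebraic
over the subalgebra generated by the d others. -/
theorem ringKrullDim_quotient_le_of_det_notMem {K : Type u} [Field K] [CharZero K] {n d : ℕ}
    (H : Fin n → MvPolynomial (Fin n) K) (T : Finset (Fin n)) (hT : T.card + d = n)
    (q : Ideal (MvPolynomial (Fin n) K)) [q.IsPrime] (hH : ∀ i ∈ T, H i ∈ q)
    (hdet : (jacobianPoly H).det ∉ q) : ringKrullDim (MvPolynomial (Fin n) K ⧸ q) ≤ d := by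
  classical
  let B := MvPolynomial (Fin n) K ⧸ q
  let L := FractionRing B
  have hessKL : Algebra.EssFiniteType K L := by
    have : Algebra.EssFiniteType B L := .of_isLocalization L (nonZeroDivisors B)
    exact .comp K B L
  let ψ : MvPolynomial (Fin n) K →ₐ[K] L :=
    (IsScalarTower.toAlgHom K B L).comp (Ideal.Quotient.mkₐ K q)
  have hψ0 : ∀ f, ψ f = 0 ↔ f ∈ q := fun f => by
    rw [← Ideal.Quotient.eq_zero_iff_mem, ← map_eq_zero_iff _ (IsFractionRing.injective B L)]
    rfl
  have hψ : MvPolynomial.aeval (fun j => ψ (MvPolynomial.X j)) = ψ := by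
    ext j; simp
  let s : Finset L := Tᶜ.image fun j => ψ (H j)
  have hs : s.card ≤ d := by
    refine Finset.card_image_le.trans ?_
    rw [Finset.card_compl, Fintype.card_fin]; omega
  have halg := isAlgebraic_adjoin_of_det_ne_zero (fun j => ψ (MvPolynomial.X j)) (fun y => by
      obtain ⟨a, b, hb, rfl⟩ := IsFractionRing.div_surjective (A := B) y
      obtain ⟨a, rfl⟩ := Ideal.Quotient.mk_surjective a
      obtain ⟨b, rfl⟩ := Ideal.Quotient.mk_surjective b
      exact ⟨a, b, by rw [hψ]; rfl⟩) H (s : Set L) (fun i => by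
      rw [hψ]
      by_cases hi : i ∈ T
      · exact .inl ((hψ0 _).2 (hH i hi))
      · exact .inr (Finset.mem_coe.2 (Finset.mem_image_of_mem _ (by simpa using hi)))) (by
      rw [hψ, Ne, hψ0]; exact hdet)
  exact ringKrullDim_le_of_isAlgebraic_adjoin (k := K) (L := L) s hs

end

section

open IsLocalRing

/-! ### The Jacobian criterion -/

section JacobianCriterion

open MvPolynomial

variable {K : Type*} [Field K] {n : ℕ}

/-- Some maximal ideal has height n. By the Nullstellensatz it is the ideal of a point, and a
translation carries it to that of a. -/
theorem MvPolynomial.natCast_le_height_ker_eval [IsAlgClosed K] (a : Fin n → K) :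
    (n : ℕ∞) ≤ (RingHom.ker (eval a)).height := by
  have hdim : ringKrullDim (MvPolynomial (Fin n) K) = n := by
    rw [MvPolynomial.ringKrullDim_of_isNoetherianRing]
    simp
  have : FiniteRingKrullDim (MvPolynomial (Fin n) K) :=
    finiteRingKrullDim_iff_ne_bot_and_top.2 (by rw [hdim]; exact ⟨WithBot.coe_ne_bot, fun h => ENat.natCast_ne_top n (WithBot.coe_injective h)⟩)
  obtain ⟨p, hp, hpn⟩ := Ideal.exists_isMaximal_height (R := MvPolynomial (Fin n) K)
  obtain ⟨b, rfl⟩ := isMaximal_iff_eq_vanishingIdeal_singleton.1 hp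
  let e : MvPolynomial (Fin n) K ≃ₐ[K] MvPolynomial (Fin n) K :=
    AlgEquiv.ofAlgHom (aeval fun i => X i + C (b i - a i)) (aeval fun i => X i - C (b i - a i))
      (by ext i; simp [algebraMap_eq]) (by ext i; simp [algebraMap_eq])
  have h1 := RingEquiv.height_comap e.toRingEquiv (RingHom.ker (eval a))
  have h2 : Ideal.comap e.toRingEquiv (RingHom.ker (eval a)) = vanishingIdeal K {b} := by
    ext f
    have : (eval a).comp (e.toRingEquiv : _ →+* MvPolynomial (Fin n) K) = eval b := by
      ext i
      · simp [e]
      · simp [e]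
    rw [Ideal.mem_comap, RingHom.mem_ker, mem_vanishingIdeal_singleton_iff]
    exact iff_of_eq (congrArg (· = 0) ((RingHom.congr_fun this f).trans (by simp [aeval_eq_eval])))
  rw [← h1, h2]
  rw [hdim] at hpn
  exact (WithBot.coe_injective hpn).ge

/-- The linear part of the Taylor expansion of `f` at `a`. -/
noncomputable def linearPart (a : Fin n → K) (f : MvPolynomial (Fin n) K) :
    MvPolynomial (Fin n) K :=
  ∑ j, C (eval a (pderiv j f)) * (X j - C (a j))

theorem MvPolynomial.X_sub_C_mem_ker_eval (a : Fin n → K) (j : Fin n) :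
    X j - C (a j) ∈ RingHom.ker (eval a) := by
  simp [RingHom.mem_ker]

theorem linearPart_mem_ker_eval (a : Fin n → K) (f : MvPolynomial (Fin n) K) :
    linearPart a f ∈ RingHom.ker (eval a) :=
  Ideal.sum_mem _ fun j _ => Ideal.mul_mem_left _ _ (X_sub_C_mem_ker_eval a j)

theorem sub_linearPart_mem_sq (a : Fin n → K) (f : MvPolynomial (Fin n) K) :
    f - C (eval a f) - linearPart a f ∈ RingHom.ker (eval a) ^ 2 := by
  classical
  induction f using MvPolynomial.induction_on with
  | C c => simp [linearPart]
  | add p q hp hq =>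
    convert Ideal.add_mem _ hp hq using 1
    simp only [linearPart, map_add, add_mul, Finset.sum_add_distrib]
    ring
  | mul_X p i hp =>
    have h1 : linearPart a (p * X i) =
        linearPart a p * C (a i) + C (eval a p) * (X i - C (a i)) := by
      simp [linearPart, pderiv_X, Pi.single_apply, apply_ite (eval a), add_mul,
        Finset.sum_add_distrib, Finset.sum_mul, apply_ite C, ite_mul]
      rw [add_comm]
      refine congrArg (· + _) (Finset.sum_congr rfl fun j _ => by ring)
    have h2 : linearPart a p * (X i - C (a i)) ∈ RingHom.ker (eval a) ^ 2 := by
      rw [sq]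
      exact Ideal.mul_mem_mul (linearPart_mem_ker_eval a p) (X_sub_C_mem_ker_eval a i)
    convert Ideal.add_mem _ (Ideal.mul_mem_right (X i) _ hp) h2 using 1
    rw [h1, map_mul, map_mul, eval_X]
    ring

/-- Modulo the square of the maximal ideal, each H_i equals its linear part, and inverting the
Jacobian expresses the X_j - a_j through these. -/
theorem MvPolynomial.ker_eval_le_span_sup_sq (a : Fin n → K) (H : Fin n → MvPolynomial (Fin n) K)
    (hH : ∀ i, eval a (H i) = 0) (hdet : (jacobianMatrixAt H a).det ≠ 0) :
    RingHom.ker (eval a) ≤ Ideal.span (Set.range H) ⊔ RingHom.ker (eval a) ^ 2 := by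
  set J := jacobianMatrixAt H a with hJ
  set I := Ideal.span (Set.range H) ⊔ RingHom.ker (eval a) ^ 2 with hI
  have hlin : ∀ i, ∑ j, C (J i j) * (X j - C (a j)) ∈ I := by
    intro i
    have h1 := sub_linearPart_mem_sq a (H i)
    rw [hH, C_0, sub_zero] at h1
    have h2 : linearPart a (H i) ∈ I := by
      rw [← sub_sub_cancel (H i) (linearPart a (H i))]
      exact Ideal.sub_mem _ (Ideal.mem_sup_left (Ideal.subset_span ⟨i, rfl⟩))
        (Ideal.mem_sup_right h1)
    exact h2
  have hX : ∀ j, X j - C (a j) ∈ I := by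
    intro j
    have := Matrix.eq_zero_of_sum_smul_eq_zero (J.map (C (σ := Fin n)))
      (by rw [← RingHom.mapMatrix_apply, ← RingHom.map_det]
          exact (isUnit_iff_ne_zero.2 hdet).map (C (σ := Fin n)))
      (fun j => Ideal.Quotient.mk I (X j - C (a j))) (fun i => by
        rw [← Ideal.Quotient.eq_zero_iff_mem.2 (hlin i), map_sum]
        refine Finset.sum_congr rfl fun j _ => ?_
        rw [Matrix.map_apply, Algebra.smul_def, Ideal.Quotient.algebraMap_eq, map_mul]) j
    exact Ideal.Quotient.eq_zero_iff_mem.1 this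
  intro f hf
  have h1 := sub_linearPart_mem_sq a f
  rw [(RingHom.mem_ker).1 hf, C_0, sub_zero] at h1
  rw [← sub_add_cancel f (linearPart a f)]
  exact Ideal.add_mem _ (Ideal.mem_sup_right h1)
    (Ideal.sum_mem _ fun j _ => Ideal.mul_mem_left _ _ (hX j))

/-- The Jacobian criterion: near a point `a` of an equidimensional algebraic set `Z`, the ideal of
`Z` is generated by any `n - d` of its elements with independent differentials at `a`. -/
theorem exists_mul_mem_span_of_isEquidimensional [IsAlgClosed K] [CharZero K] {d : ℕ}
    {Z : Set (Fin n → K)} (hZ : IsEquidimensional Z d) {a : Fin n → K} (ha : a ∈ Z)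
    (H : Fin n → MvPolynomial (Fin n) K) (T : Finset (Fin n)) (hT : T.card + d = n)
    (hH : ∀ i ∈ T, H i ∈ vanishingIdeal K Z) (hdet : (jacobianMatrixAt H a).det ≠ 0)
    {f : MvPolynomial (Fin n) K} (hf : f ∈ vanishingIdeal K Z) :
    ∃ h, eval a h ≠ 0 ∧ h * f ∈ Ideal.span (H '' T) := by
  set m := RingHom.ker (eval a) with hm
  have hIm : vanishingIdeal K Z ≤ m := fun g hg => by
    have := mem_vanishingIdeal_iff.1 hg a ha
    rwa [aeval_eq_eval] at this
  have hmp : m.IsPrime := RingHom.ker_isPrime _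
  -- Subtracting constants moves all n polynomials into m, without affecting the Jacobian or the
  -- members of T, which vanish at a already.
  let G : Fin n → MvPolynomial (Fin n) K := fun i => H i - C (eval a (H i))
  have hGT : H '' T = G '' T := Set.image_congr fun i hi => by
    have : eval a (H i) = 0 := hIm (hH i hi)
    simp [G, this]
  have hGm : ∀ i, eval a (G i) = 0 := fun i => by simp [G]
  have hJ : jacobianMatrixAt G a = jacobianMatrixAt H a := by
    ext i j; simp [G, jacobianMatrixAt]
  rw [hGT]
  let S := Localization.AtPrime m
  have hmax : m.map (algebraMap _ S) = maximalIdeal S := Localization.AtPrime.map_eq_maximalIdeal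
  have hspan : Ideal.span (Set.range fun i => algebraMap _ S (G i)) = maximalIdeal S := by
    have h1 : Ideal.span (Set.range fun i => algebraMap _ S (G i)) =
        (Ideal.span (Set.range G)).map (algebraMap _ S) := by
      rw [Ideal.map_span, ← Set.range_comp]; rfl
    rw [h1]
    refine le_antisymm ?_ ?_
    · rw [← hmax]
      refine Ideal.map_mono (Ideal.span_le.2 ?_)
      rintro _ ⟨i, rfl⟩
      exact hGm i
    · refine Submodule.le_of_le_smul_of_le_jacobson_bot (IsNoetherian.noetherian _)
        (jacobson_eq_maximalIdeal ⊥ bot_ne_top).ge ?_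
      rw [smul_eq_mul, ← sq, ← hmax, ← Ideal.map_pow, ← Ideal.map_sup]
      exact Ideal.map_mono (ker_eval_le_span_sup_sq a G hGm (hJ ▸ hdet))
  have hht : (n : ℕ∞) ≤ (maximalIdeal S).height := by
    have h1 := IsLocalization.AtPrime.ringKrullDim_eq_height m S
    rw [← maximalIdeal_height_eq_ringKrullDim] at h1
    rw [WithBot.coe_injective h1]
    exact natCast_le_height_ker_eval a
  -- The G_i form a regular system of parameters of the local ring at a.
  have hprime := isPrime_span_image _ hspan hht T
  set Q := Ideal.span ((fun i => algebraMap _ S (G i)) '' T) with hQ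
  have hQmap : Q = (Ideal.span (G '' T)).map (algebraMap _ S) := by
    rw [Ideal.map_span, ← Set.image_comp]; rfl
  set q := Q.comap (algebraMap (MvPolynomial (Fin n) K) S) with hq
  have hqp : q.IsPrime := Ideal.comap_isPrime _ _
  have hqmem : ∀ g ∈ q, ∃ h, eval a h ≠ 0 ∧ h * g ∈ Ideal.span (G '' T) := by
    intro g hg
    rw [hq, Ideal.mem_comap, hQmap, IsLocalization.mem_map_algebraMap_iff m.primeCompl] at hg
    obtain ⟨⟨x, s⟩, hxs⟩ := hg
    refine ⟨s, s.2, ?_⟩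
    rw [← map_mul] at hxs
    rw [mul_comm, IsLocalization.injective S m.primeCompl_le_nonZeroDivisors hxs]
    exact x.2
  refine hqmem f ?_
  obtain ⟨p, hpI, hpm⟩ := Ideal.exists_minimalPrimes_le hIm
  have hpp : p.IsPrime := hpI.isPrime
  have hGp : Ideal.span (G '' T) ≤ p := by
    rw [← hGT, Ideal.span_le]
    rintro _ ⟨i, hi, rfl⟩
    exact hpI.1.2 (hH i hi)
  have hqle : q ≤ p := fun g hg => by
    obtain ⟨h, hh, hhg⟩ := hqmem g hg
    exact (hpp.mem_or_mem (hGp hhg)).resolve_left fun h' => hh (hpm h')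
  have hdimq := ringKrullDim_quotient_le_of_det_notMem G T hT q
    (fun i hi => Ideal.mem_comap.2 (Ideal.subset_span ⟨i, hi, rfl⟩))
    (fun h' => hdet (by rw [← hJ, ← eval_det_jacobianPoly]; exact hpm (hqle h')))
  -- Now q ⊆ p and dim K[x]/q ≤ d = dim K[x]/p, whereas a proper inclusion of primes would lower the
  -- dimension.
  have hqe : q = p := by
    by_contra hne
    obtain ⟨r, hrp, hrq⟩ := SetLike.exists_of_lt (lt_of_le_of_ne hqle hne)
    have h1 := ringKrullDim_succ_le_of_surjective (Ideal.Quotient.factor hqle)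
      (Ideal.Quotient.factor_surjective hqle) (r := Ideal.Quotient.mk q r)
      (mem_nonZeroDivisors_of_ne_zero (by rwa [Ne, Ideal.Quotient.eq_zero_iff_mem]))
      (by rwa [Ideal.Quotient.factor_mk, Ideal.Quotient.eq_zero_iff_mem])
    rw [hZ p hpI] at h1
    have h2 := h1.trans hdimq
    have h3 : d + 1 ≤ d := by exact_mod_cast h2
    omega
  rw [hqe]
  exact hpI.1.2 hf

end JacobianCriterion

end

/-! ### Real charts adapted to Z and φ -/

section

open Submodule in
/-- Vectors spanning a space of dimension `k`, followed by a vector outside this space, can be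
completed to a basis of `K^n` by unit vectors. -/
theorem exists_linearIndependent_selection {K : Type*} [Field K] {n m k : ℕ}
    (v : Fin m ⊕ Unit ⊕ Fin n → (Fin n → K)) (he : ∀ j, v (.inr (.inr j)) = Pi.single j 1)
    (hk : Module.finrank K (span K (Set.range (v ∘ Sum.inl))) = k)
    (hw : v (.inr (.inl ())) ∉ span K (Set.range (v ∘ Sum.inl))) :
    ∃ c : Fin n → Fin m ⊕ Unit ⊕ Fin n, LinearIndependent K (v ∘ c) ∧
      (Finset.univ.filter fun i => (c i).isLeft = true).card = k ∧
      ∃ i₀, c i₀ = .inr (.inl ()) := by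
  classical
  -- Three greedy extensions: a basis among the left vectors, then the distinguished vector, then
  -- unit vectors. The later stages add no left index, so exactly k of these occur.
  have h0 : LinearIndepOn K v ∅ := linearIndepOn_empty K v
  set b₀ := h0.extend (Set.empty_subset (Set.range Sum.inl)) with hb₀
  have hb₀sub : b₀ ⊆ Set.range Sum.inl := h0.extend_subset _
  have hb₀span : span K (v '' b₀) = span K (Set.range (v ∘ Sum.inl)) := by
    rw [Set.range_comp]; exact h0.span_image_extend_eq_span_image _
  have hb₀li : LinearIndepOn K v b₀ := h0.linearIndepOn_extend _
  have h1 : LinearIndepOn K v (insert (.inr (.inl ())) b₀) := hb₀li.insert (hb₀span ▸ hw)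
  set b₁ : Set (Fin m ⊕ Unit ⊕ Fin n) := insert (.inr (.inl ())) b₀ with hb₁
  have hsub : b₁ ⊆ b₁ ∪ Set.range (Sum.inr ∘ Sum.inr) := Set.subset_union_left
  set b := h1.extend hsub with hb
  have hbli : LinearIndepOn K v b := h1.linearIndepOn_extend _
  have hb₁b : b₁ ⊆ b := h1.subset_extend _
  have hbsub : b ⊆ b₁ ∪ Set.range (Sum.inr ∘ Sum.inr) := h1.extend_subset _
  have hbspan : span K (v '' b) = ⊤ := by
    rw [h1.span_image_extend_eq_span_image, eq_top_iff, ← (Pi.basisFun K (Fin n)).span_eq]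
    refine span_mono ?_
    rintro _ ⟨j, rfl⟩
    exact ⟨_, .inr ⟨j, rfl⟩, by simp [he]⟩
  have hcard : Fintype.card b = n := by
    have := finrank_span_eq_card (R := K) (b := fun i : b => v i) hbli
    rw [← this, ← Set.image_eq_range, hbspan]
    simp
  let e : Fin n ≃ b := (Fintype.equivFinOfCardEq hcard).symm
  refine ⟨fun i => (e i : _), hbli.comp e e.injective, ?_, ?_⟩
  · have hcard₀ : Fintype.card b₀ = k := by
      have := finrank_span_eq_card (R := K) (b := fun i : b₀ => v i) hb₀li
      rw [← this, ← Set.image_eq_range, hb₀span, hk]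
    rw [← hcard₀, ← Fintype.card_coe]
    refine Fintype.card_congr ((e.subtypeEquiv (p := fun i => (e i : _).1.isLeft = true)
      (q := fun x => x.1.isLeft = true) fun i => Iff.rfl).trans ?_ |> fun f =>
        (Equiv.subtypeEquivRight (by simp)).trans f)
    have hmem : ∀ x, x ∈ b₀ ↔ x ∈ b ∧ x.isLeft = true := by
      refine fun x => ⟨fun hx => ⟨hb₁b (Set.mem_insert_of_mem _ hx), ?_⟩, ?_⟩
      · obtain ⟨y, rfl⟩ := hb₀sub hx; rfl
      · rintro ⟨hx, hl⟩
        rcases hbsub hx with (rfl | hx) | ⟨j, rfl⟩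
        · simp at hl
        · exact hx
        · simp at hl
    exact (Equiv.subtypeSubtypeEquivSubtypeInter (· ∈ b) (fun x => x.isLeft = true)).trans
      (Equiv.subtypeEquivRight fun x => (hmem x).symm)
  · exact ⟨e.symm ⟨_, hb₁b (Set.mem_insert _ _)⟩, by simp⟩

section RealPart

open MvPolynomial

variable {R : Type*} [Field R] [LinearOrder R] [IsStrictOrderedRing R]
  {K : Type*} [Field K] [Algebra R K] {n : ℕ}

theorem MvPolynomial.exists_re_im [IsRealClosed R] [IsAlgClosure R K] {σ : Type*} {ι : K} (hι : ι * ι = -1)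
    (f : MvPolynomial σ K) : ∃ g h : MvPolynomial σ R,
      f = map (algebraMap R K) g + C ι * map (algebraMap R K) h := by
  induction f using MvPolynomial.induction_on with
  | C a =>
    obtain ⟨x, y, rfl⟩ := IsRealClosed.exists_re_im (R := R) hι a
    exact ⟨C x, C y, by simp [mul_comm]⟩
  | add p q hp hq =>
    obtain ⟨g, h, rfl⟩ := hp
    obtain ⟨g', h', rfl⟩ := hq
    exact ⟨g + g', h + h', by simp only [map_add]; ring⟩
  | mul_X p i hp =>
    obtain ⟨g, h, rfl⟩ := hp
    exact ⟨g * X i, h * X i, by simp only [map_mul, map_X]; ring⟩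

/-- The polynomial X² + 1 is irreducible over the ordered field R, and ±ι are conjugate roots of it
in the normal extension K. -/
theorem exists_conj [IsAlgClosure R K] {ι : K} (hι : ι * ι = -1) :
    ∃ τ : K ≃ₐ[R] K, τ ι = -ι := by
  have : Normal R K := IsAlgClosure.normal R K
  let p : Polynomial R := Polynomial.X ^ 2 + Polynomial.C 1
  have hdeg : p.natDegree = 2 := by simp only [p]; compute_degree!
  have hm : p.Monic := by simp only [p]; monicity!
  have hirr : Irreducible p := by
    refine Polynomial.irreducible_of_degree_le_three_of_not_isRoot (by simp [hdeg]) fun x hx => ?_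
    have : x ^ 2 + 1 = 0 := by simpa [p] using hx
    nlinarith [sq_nonneg x]
  have h1 := minpoly.eq_of_irreducible_of_monic hirr (x := ι)
    (by simp [p, sq, hι]) hm
  have h2 := minpoly.eq_of_irreducible_of_monic hirr (x := -ι)
    (by simp [p, sq, hι]) hm
  exact isConjRoot_iff_exists_algEquiv.1 (h2.symm.trans h1)

/-- As Z is defined over k, it is stable under τ, so both g + ιh and g - ιh vanish on it. -/
theorem re_im_mem_vanishingIdeal {k : Type*} [Field k] [Algebra k K] [CharZero K] {ι : K} (hι : ι * ι = -1) (τ : K ≃ₐ[k] K) (hτ : τ ι = -ι)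
    {Z : Set (Fin n → K)} (hZ : IsAlgebraicSetOver k Z) {g h : MvPolynomial (Fin n) k}
    (hgh : map (algebraMap k K) g + C ι * map (algebraMap k K) h ∈ vanishingIdeal K Z) :
    g ∈ vanishingIdeal k Z ∧ h ∈ vanishingIdeal k Z := by
  have key : ∀ z ∈ Z, aeval z g = 0 ∧ aeval z h = 0 := by
    intro z hz
    have hτz : (fun j => τ (z j)) ∈ Z := by
      obtain ⟨s, rfl⟩ := hZ
      intro f hf
      have : aeval (fun j => τ (z j)) f = τ (aeval z f) := by
        rw [← AlgEquiv.coe_toAlgHom, ← AlgHom.comp_apply, comp_aeval]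
      rw [this, hz f hf, map_zero]
    have hτe : ∀ f : MvPolynomial (Fin n) k, aeval (fun j => τ (z j)) f = τ (aeval z f) := by
      intro f
      rw [← AlgEquiv.coe_toAlgHom, ← AlgHom.comp_apply, comp_aeval]
    have h1 := hgh z hz
    have h2 := hgh _ hτz
    simp only [map_add, map_mul, aeval_map_algebraMap, aeval_C, Algebra.algebraMap_self,
      RingHom.id_apply, hτe] at h1 h2
    have h3 := congrArg τ h1
    rw [map_add, map_mul, hτ, map_zero] at h3
    have hι0 : ι ≠ 0 := by rintro rfl; simp at hι
    have h4 : (2 * ι) * τ (aeval z h) = 0 := by linear_combination h2 - h3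
    have h5 : τ (aeval z h) = 0 :=
      (mul_eq_zero.1 h4).resolve_left (mul_ne_zero two_ne_zero hι0)
    have h6 : aeval z h = 0 := (map_eq_zero τ).1 h5
    exact ⟨by simpa [h6] using h1, h6⟩
  exact ⟨fun z hz => (key z hz).1, fun z hz => (key z hz).2⟩

/-- The gradient of `f` at `y`. -/
noncomputable def gradAt (y : Fin n → K) (f : MvPolynomial (Fin n) K) : Fin n → K :=
  fun j => eval y (pderiv j f)

/-- In the product rule at y, the terms containing a value g_i(y) drop out. -/
theorem gradAt_mem_span {m : ℕ} (y : Fin n → K) (g : Fin m → MvPolynomial (Fin n) K)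
    (hg : ∀ i, eval y (g i) = 0) {f : MvPolynomial (Fin n) K}
    (hf : f ∈ Ideal.span (Set.range g)) :
    gradAt y f ∈ Submodule.span K (Set.range fun i => gradAt y (g i)) := by
  obtain ⟨c, rfl⟩ := Ideal.mem_span_range_iff_exists_fun.1 hf
  refine (Submodule.mem_span_range_iff_exists_fun K).2 ⟨fun i => eval y (c i), ?_⟩
  ext j
  simp [gradAt, hg]

/-- With every polynomial the ideal of Z contains its real and imaginary parts, so generators of the
real vanishing ideal generate it. -/
theorem exists_real_generators [IsRealClosed R] [IsAlgClosure R K] [CharZero K]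
    {Z : Set (Fin n → K)} (hZ : IsAlgebraicSetOver R Z) :
    ∃ (m : ℕ) (G : Fin m → MvPolynomial (Fin n) R), (∀ i, G i ∈ vanishingIdeal R Z) ∧
      Ideal.span (Set.range fun i => map (algebraMap R K) (G i)) = vanishingIdeal K Z := by
  have : IsAlgClosed K := IsAlgClosure.isAlgClosed R
  obtain ⟨ι, hι⟩ := IsAlgClosed.exists_eq_mul_self (-1 : K)
  obtain ⟨τ, hτ⟩ := exists_conj (R := R) hι.symm
  obtain ⟨m, G, hG⟩ := Submodule.fg_iff_exists_fin_generating_family.1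
    (IsNoetherian.noetherian (vanishingIdeal R Z))
  have hGm : ∀ i, G i ∈ vanishingIdeal R Z := fun i => hG ▸ Submodule.subset_span ⟨i, rfl⟩
  have hmap : Ideal.span (Set.range fun i => map (algebraMap R K) (G i)) =
      (vanishingIdeal R Z).map (map (algebraMap R K)) := by
    have h1 : Ideal.span (Set.range G) = vanishingIdeal R Z := hG
    rw [← h1, Ideal.map_span, ← Set.range_comp]; rfl
  refine ⟨m, G, hGm, le_antisymm (Ideal.span_le.2 ?_) fun f hf => ?_⟩
  · rintro _ ⟨i, rfl⟩ z hz
    rw [aeval_map_algebraMap]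
    exact hGm i z hz
  · obtain ⟨g, h, rfl⟩ := MvPolynomial.exists_re_im (R := R) hι.symm f
    obtain ⟨hg, hh⟩ := re_im_mem_vanishingIdeal hι.symm τ hτ hZ hf
    rw [hmap]
    exact Ideal.add_mem _ (Ideal.mem_map_of_mem _ hg)
      (Ideal.mul_mem_left _ _ (Ideal.mem_map_of_mem _ hh))

theorem polyDifferential_eq_sum (f : MvPolynomial (Fin n) K) (y v : Fin n → K) :
    polyDifferential f y v = ∑ j, gradAt y f j * v j := by
  simp [polyDifferential, gradAt]

/-- Otherwise the differential of f would be a combination of those of the g_i, hence zero on the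
tangent space. -/
theorem gradAt_notMem_span_of_notMem_critPoints {Z : Set (Fin n → K)} {d m : ℕ}
    (g : Fin m → MvPolynomial (Fin n) K) (hg : ∀ i, g i ∈ vanishingIdeal K Z)
    {f : MvPolynomial (Fin n) K} {y : Fin n → K} (hy : y ∈ regPoints Z d)
    (hf : y ∉ critPoints f Z d) :
    gradAt y f ∉ Submodule.span K (Set.range fun i => gradAt y (g i)) := by
  intro hmem
  obtain ⟨c, hc⟩ := (Submodule.mem_span_range_iff_exists_fun K).1 hmem
  refine hf ⟨hy, fun htop => ?_⟩
  have h1 : (1 : K) ∈ (algTangentSpace Z y).map (polyDifferential f y) := htop ▸ trivial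
  obtain ⟨v, hv, hv1⟩ := h1
  have hv0 : ∀ i, polyDifferential (g i) y v = 0 := by
    intro i
    have := hv
    simp only [algTangentSpace, SetLike.mem_coe, Submodule.mem_iInf, LinearMap.mem_ker] at this
    exact this _ (hg i)
  refine zero_ne_one (α := K) ?_
  rw [← hv1, polyDifferential_eq_sum, ← hc]
  simp only [Finset.sum_apply, Pi.smul_apply, smul_eq_mul, Finset.sum_mul, mul_assoc]
  rw [Finset.sum_comm]
  simp only [← Finset.mul_sum, ← polyDifferential_eq_sum, hv0, mul_zero, Finset.sum_const_zero]

/-- Regularity provides the rank for some generators; the span of the gradients at a point of Z is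
the same for all of them. -/
theorem finrank_span_gradAt {Z : Set (Fin n → K)} {d m : ℕ}
    (g : Fin m → MvPolynomial (Fin n) K)
    (hg : Ideal.span (Set.range g) = vanishingIdeal K Z) {y : Fin n → K} (hy : y ∈ regPoints Z d) :
    Module.finrank K (Submodule.span K (Set.range fun i => gradAt y (g i))) + d = n := by
  obtain ⟨hyZ, m', g', hg', hrank⟩ := hy
  have h0 : ∀ {l : ℕ} {q : Fin l → MvPolynomial (Fin n) K},
      Ideal.span (Set.range q) = vanishingIdeal K Z → ∀ i, eval y (q i) = 0 := fun {l q} hq i => by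
    have hm : q i ∈ vanishingIdeal K Z := hq ▸ Ideal.subset_span (Set.mem_range_self i)
    have := mem_vanishingIdeal_iff.1 hm y hyZ
    rwa [aeval_eq_eval] at this
  have h1 : Submodule.span K (Set.range fun i => gradAt y (g i)) =
      Submodule.span K (Set.range fun i => gradAt y (g' i)) := by
    refine le_antisymm (Submodule.span_le.2 ?_) (Submodule.span_le.2 ?_)
    · rintro _ ⟨i, rfl⟩
      exact gradAt_mem_span y g' (h0 hg') (hg'.trans hg.symm ▸ Ideal.subset_span ⟨i, rfl⟩)
    · rintro _ ⟨i, rfl⟩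
      exact gradAt_mem_span y g (h0 hg) (hg.trans hg'.symm ▸ Ideal.subset_span ⟨i, rfl⟩)
  rw [h1]
  rw [Matrix.rank_eq_finrank_span_row] at hrank
  exact hrank

theorem eval_toExtension {k : Type*} [Field k] [Algebra k K] (x : Fin n → k)
    (f : MvPolynomial (Fin n) k) :
    eval (toExtension K x) (map (algebraMap k K) f) = algebraMap k K (eval x f) := by
  rw [eval_map, ← aeval_def]
  exact aeval_algebraMap_apply K x f

theorem aeval_toExtension_eq_zero_iff {k : Type*} [Field k] [Algebra k K] (x : Fin n → k)
    (f : MvPolynomial (Fin n) k) :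
    aeval (toExtension K x) f = 0 ↔ eval x f = 0 := by
  rw [← map_eq_zero (algebraMap k K), ← eval_toExtension, eval_map, aeval_def]

theorem det_jacobianMatrixAt_map {k : Type*} [Field k] [Algebra k K] (x : Fin n → k)
    (H : Fin n → MvPolynomial (Fin n) k) :
    (jacobianMatrixAt (fun i => map (algebraMap k K) (H i)) (toExtension K x)).det =
      algebraMap k K (jacobianMatrixAt H x).det := by
  rw [RingHom.map_det]
  congr 1
  ext i j
  simp only [jacobianMatrixAt, Matrix.of_apply, RingHom.mapMatrix_apply, Matrix.map_apply,
    pderiv_map, eval_toExtension]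

-- Write h = f + ιg with f, g real. At real points h ≠ 0 means f² + g² > 0, an open condition.
open Topology Filter in
theorem eventually_eval_toExtension_ne_zero [IsRealClosed R] [IsAlgClosure R K]
    [TopologicalSpace R] [OrderTopology R] {x : Fin n → R} {h : MvPolynomial (Fin n) K}
    (hx : eval (toExtension K x) h ≠ 0) : ∀ᶠ z in 𝓝 x, eval (toExtension K z) h ≠ 0 := by
  have : IsAlgClosed K := IsAlgClosure.isAlgClosed R
  obtain ⟨ι, hι⟩ := IsAlgClosed.exists_eq_mul_self (-1 : K)
  obtain ⟨f, g, rfl⟩ := MvPolynomial.exists_re_im (R := R) hι.symm h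
  have hev : ∀ z, eval (toExtension K z) (map (algebraMap R K) f + C ι * map (algebraMap R K) g) =
      algebraMap R K (eval z f) + ι * algebraMap R K (eval z g) := fun z => by
    simp only [map_add, map_mul, eval_C, eval_toExtension]
  simp only [hev] at hx ⊢
  have hpos : 0 < eval x (f ^ 2 + g ^ 2) := by
    simp only [map_add, map_pow]
    refine lt_of_le_of_ne (by positivity) fun h0 => hx ?_
    have hf : eval x f = 0 := by nlinarith [sq_nonneg (eval x f), sq_nonneg (eval x g)]
    have hg : eval x g = 0 := by nlinarith [sq_nonneg (eval x f), sq_nonneg (eval x g)]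
    simp [hf, hg]
  filter_upwards [(continuous_eval (f ^ 2 + g ^ 2)).continuousAt.eventually (lt_mem_nhds hpos)]
    with z hz h0
  have h1 : algebraMap R K (eval z (f ^ 2 + g ^ 2)) = 0 := by
    simp only [map_add, map_pow]
    linear_combination (algebraMap R K (eval z f) - ι * algebraMap R K (eval z g)) * h0 -
      (algebraMap R K (eval z g)) ^ 2 * hι
  exact hz.ne' ((map_eq_zero _).1 h1)

open Topology Filter in
/-- Finitely many coordinate systems for `R^n`, polynomial and each containing `φ` among its
coordinates, that straighten the real points of `Z` near all points where `φ = u`. -/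
theorem exists_charts [IsRealClosed R] [IsAlgClosure R K] [TopologicalSpace R] [OrderTopology R]
    {d : ℕ} {Z : Set (Fin n → K)} (hZR : IsAlgebraicSetOver R Z) (hZd : IsEquidimensional Z d)
    (φ : MvPolynomial (Fin n) R) (u : R)
    (hu : ∀ x ∈ realFiber Z φ {u}, toExtension K x ∉ singPointsOf (map (algebraMap R K) φ) Z d) :
    ∃ (I : Type) (_ : Fintype I) (H : I → Fin n → MvPolynomial (Fin n) R)
      (T : I → Finset (Fin n)) (i₀ : I → Fin n),
      (∀ c, ∀ i ∈ T c, ∀ x, toExtension K x ∈ Z → eval x (H c i) = 0) ∧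
      (∀ c, i₀ c ∉ T c ∧ H c (i₀ c) = φ) ∧
      (∀ x ∈ realFiber Z φ {u}, ∃ c, (jacobianMatrixAt (H c) x).det ≠ 0) ∧
      ∀ c x, toExtension K x ∈ Z → (jacobianMatrixAt (H c) x).det ≠ 0 →
        ∀ᶠ z in 𝓝 x, (∀ i ∈ T c, eval z (H c i) = 0) → toExtension K z ∈ Z := by
  have : IsAlgClosed K := IsAlgClosure.isAlgClosed R
  have : CharZero K := charZero_of_injective_algebraMap (algebraMap R K).injective
  obtain ⟨m, G, hG, hspan⟩ := exists_real_generators hZR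
  -- The candidate coordinates: real generators of I(Z), then φ, then the variables. A chart is a
  -- choice of n of them that includes φ and exactly n - d generators; there are finitely many.
  let F : Fin m ⊕ Unit ⊕ Fin n → MvPolynomial (Fin n) R :=
    Sum.elim G (Sum.elim (fun _ => φ) X)
  let T (c : Fin n → Fin m ⊕ Unit ⊕ Fin n) : Finset (Fin n) :=
    Finset.univ.filter fun i => (c i).isLeft = true
  have hT : ∀ c, ∀ i ∈ T c, F (c i) ∈ vanishingIdeal R Z := by
    intro c i hi
    obtain ⟨j, hj⟩ := Sum.isLeft_iff.1 (Finset.mem_filter.1 hi).2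
    rw [hj]; exact hG j
  refine ⟨{c : Fin n → Fin m ⊕ Unit ⊕ Fin n //
    (T c).card + d = n ∧ ∃ i₀, c i₀ = .inr (.inl ())}, Fintype.ofFinite _, fun c i => F (c.1 i),
    fun c => T c.1, fun c => c.2.2.choose, ?_, ?_, ?_, ?_⟩
  · exact fun c i hi x hx => (aeval_toExtension_eq_zero_iff x _).1 (hT c.1 i hi _ hx)
  · intro c
    have := c.2.2.choose_spec
    exact ⟨by simp [T, this], by simp [F, this]⟩
  · intro x hx
    have hns := hu x hx
    set y := toExtension K x with hy
    have hreg : y ∈ regPoints Z d := by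
      by_contra h; exact hns (.inr ⟨hx.1, h⟩)
    have hcrit : y ∉ critPoints (map (algebraMap R K) φ) Z d := fun h => hns (.inl h)
    have hGm : ∀ i, map (algebraMap R K) (G i) ∈ vanishingIdeal K Z :=
      fun i => hspan ▸ Ideal.subset_span (Set.mem_range_self i)
    have hk := finrank_span_gradAt _ hspan hreg
    obtain ⟨c, hc, hck, hc₀⟩ := exists_linearIndependent_selection
      (fun j => gradAt y (map (algebraMap R K) (F j))) (fun j => by
        ext i
        classical
        simp [F, gradAt, pderiv_X, Pi.single_apply, apply_ite (eval y), eq_comm]) rfl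
      (gradAt_notMem_span_of_notMem_critPoints _ hGm hreg hcrit)
    refine ⟨⟨c, ?_, hc₀⟩, ?_⟩
    · rw [hck]; exact hk
    · rw [← map_ne_zero_iff _ (algebraMap R K).injective, ← det_jacobianMatrixAt_map,
        ← isUnit_iff_ne_zero, ← Matrix.isUnit_iff_isUnit_det,
        ← Matrix.linearIndependent_rows_iff_isUnit]
      exact hc
  · intro c x hx hdet
    rw [← map_ne_zero_iff _ (algebraMap R K).injective, ← det_jacobianMatrixAt_map] at hdet
    have hs := hZR
    obtain ⟨s, hs⟩ := hs
    have h1 : ∀ f ∈ s, ∀ᶠ z in 𝓝 x, (∀ i ∈ T c.1, eval z (F (c.1 i)) = 0) →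
        aeval (toExtension K z) f = 0 := by
      intro f hf
      have hfZ : map (algebraMap R K) f ∈ vanishingIdeal K Z := fun z hz => by
        rw [aeval_map_algebraMap]; rw [hs] at hz; exact hz f hf
      -- The factor h stays nonzero near x, so f vanishes wherever the chosen generators do.
      obtain ⟨h, hh, hmem⟩ := exists_mul_mem_span_of_isEquidimensional hZd hx _ (T c.1) c.2.1
        (fun i hi z hz => by rw [aeval_map_algebraMap]; exact hT c.1 i hi z hz) hdet hfZ
      filter_upwards [eventually_eval_toExtension_ne_zero hh] with z hz hzT
      have h2 : Ideal.span ((fun i => map (algebraMap R K) (F (c.1 i))) '' T c.1) ≤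
          RingHom.ker (eval (toExtension K z)) := by
        rw [Ideal.span_le]
        rintro _ ⟨i, hi, rfl⟩
        change eval _ _ = 0
        rw [eval_toExtension, hzT i hi, map_zero]
      have h3 : eval (toExtension K z) (h * map (algebraMap R K) f) = 0 := h2 hmem
      rw [map_mul] at h3
      have h4 := (mul_eq_zero.1 h3).resolve_left hz
      rwa [eval_map, ← aeval_def] at h4
    filter_upwards [(Finset.eventually_all s).2 h1] with z hz hzT
    rw [hs]
    exact fun f hf => hz f hf hzT

end RealPart

end

section

/-! ### Semi-algebraic paths -/

set_option linter.unusedSectionVars false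

section Paths

open Set Topology

variable {R : Type*} [Field R] [LinearOrder R] [IsStrictOrderedRing R]
  [TopologicalSpace R] [OrderTopology R] {n : ℕ}

/-- `γ` restricts to a continuous map on `[a, b]` with semi-algebraic graph. -/
structure IsPathOn (γ : R → Fin n → R) (a b : R) : Prop where
  continuousOn : ContinuousOn γ (Icc a b)
  graph : Def R (fun p : R × (Fin n → R) => (a ≤ p.1 ∧ p.1 ≤ b) ∧ p.2 = γ p.1)

/-- `x` and `y` are joined by a continuous semi-algebraic path in `S`. -/
def PathJoined (S : Set (Fin n → R)) (x y : Fin n → R) : Prop :=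
  ∃ (γ : R → Fin n → R) (a b : R), a ≤ b ∧ IsPathOn γ a b ∧ (∀ t, a ≤ t → t ≤ b → γ t ∈ S) ∧
    γ a = x ∧ γ b = y

namespace IsPathOn

variable {γ : R → Fin n → R} {a b : R}

theorem exists_near (hγ : IsPathOn γ a b) {t : R} (hat : a ≤ t) (htb : t ≤ b)
    {N : Set (Fin n → R)} (hN : N ∈ 𝓝 (γ t)) :
    ∃ δ > 0, ∀ s, a ≤ s → s ≤ b → |s - t| < δ → γ s ∈ N := by
  have := mem_nhdsWithin_iff_exists_mem_nhds_inter.1 (hγ.continuousOn t ⟨hat, htb⟩ hN)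
  obtain ⟨u, hu, hsub⟩ := this
  obtain ⟨δ, hδ, h⟩ := exists_abs_le_subset hu
  exact ⟨δ, hδ, fun s h1 h2 h3 => hsub ⟨h s h3.le, h1, h2⟩⟩

theorem restrict (hγ : IsPathOn γ a b) {c d : R} (hac : a ≤ c) (hdb : d ≤ b) : IsPathOn γ c d where
  continuousOn := hγ.continuousOn.mono (Icc_subset_Icc hac hdb)
  graph := by
    have h1 : Def R (fun p : R × (Fin n → R) => c ≤ p.1 ∧ p.1 ≤ d) :=
      (Def.le (by fun_prop) (by fun_prop)).and (Def.le (by fun_prop) (by fun_prop))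
    refine (h1.and hγ.graph).congr' fun p => ?_
    constructor
    · rintro ⟨h, h'⟩; exact ⟨h, ⟨hac.trans h.1, h.2.trans hdb⟩, h'⟩
    · rintro ⟨h, -, h'⟩; exact ⟨h, h'⟩

/-- A semi-algebraic condition on the points of a semi-algebraic path is semi-algebraic. -/
theorem def_comp [IsRealClosed R] (hγ : IsPathOn γ a b) {X : Type*} [CoordSpace R X] {g : X → R}
    (hg : PolyMap R g) {P : X → (Fin n → R) → Prop}
    (hP : Def R (fun p : X × (Fin n → R) => P p.1 p.2)) :
    Def R (fun x => (a ≤ g x ∧ g x ≤ b) ∧ P x (γ (g x))) := by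
  refine (Def.exVec (P := fun x z => ((a ≤ g x ∧ g x ≤ b) ∧ z = γ (g x)) ∧ P x z)
    ((hγ.graph.comp (g := fun p : X × (Fin n → R) => (g p.1, p.2)) ?_).and hP)).congr' fun x => ?_
  · have : PolyMap R (fun p : X × (Fin n → R) => g p.1) := PolyMap.comp hg (by fun_prop)
    fun_prop
  · constructor
    · rintro ⟨h, h'⟩; exact ⟨_, ⟨h, rfl⟩, h'⟩
    · rintro ⟨_, ⟨h, rfl⟩, h'⟩; exact ⟨h, h'⟩

/-- Composition with an affine change of the parameter. -/
theorem comp_affine (hγ : IsPathOn γ a b) {k m a' b' : R}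
    (h : ∀ t, a' ≤ t → t ≤ b' → a ≤ k * t + m ∧ k * t + m ≤ b) :
    IsPathOn (fun t => γ (k * t + m)) a' b' where
  continuousOn := hγ.continuousOn.comp (by fun_prop) fun t ht => h t ht.1 ht.2
  graph := by
    have h1 : Def R (fun p : R × (Fin n → R) => a' ≤ p.1 ∧ p.1 ≤ b') :=
      (Def.le (by fun_prop) (by fun_prop)).and (Def.le (by fun_prop) (by fun_prop))
    have h2 := hγ.graph.comp (g := fun p : R × (Fin n → R) => (k * p.1 + m, p.2)) (by fun_prop)
    refine (h1.and h2).congr' fun p => ?_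
    constructor
    · rintro ⟨hp, h'⟩; exact ⟨hp, h _ hp.1 hp.2, h'⟩
    · rintro ⟨hp, -, h'⟩; exact ⟨hp, h'⟩

theorem const (x : Fin n → R) (a b : R) : IsPathOn (fun _ => x) a b where
  continuousOn := continuousOn_const
  graph := by
    refine ((Def.le (by fun_prop) (by fun_prop)).and (Def.le (by fun_prop) (by fun_prop))).and
      ((Def.forall_fintype (P := fun i (p : R × (Fin n → R)) => p.2 i = x i)
        fun i => Def.eq (by fun_prop) (by fun_prop)).congr' fun p => funext_iff)

theorem append {γ' : R → Fin n → R} {c : R} (hγ : IsPathOn γ a b) (hγ' : IsPathOn γ' b c)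
    (hab : a ≤ b) (hbc : b ≤ c) (h : γ b = γ' b) :
    IsPathOn (fun t => if t ≤ b then γ t else γ' t) a c where
  continuousOn := by
    rw [← Icc_union_Icc_eq_Icc hab hbc]
    refine ContinuousOn.union_of_isClosed ?_ ?_ isClosed_Icc isClosed_Icc
    · exact hγ.continuousOn.congr fun t ht => if_pos ht.2
    · refine hγ'.continuousOn.congr fun t ht => ?_
      rcases ht.1.eq_or_lt with rfl | hlt
      · simp [h]
      · exact if_neg (not_le.2 hlt)
  graph := by
    refine (hγ.graph.or hγ'.graph).congr' fun p => ?_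
    constructor
    · rintro ⟨⟨h1, h2⟩, h3⟩
      by_cases hp : p.1 ≤ b
      · exact .inl ⟨⟨h1, hp⟩, by simpa [hp] using h3⟩
      · exact .inr ⟨⟨(not_le.1 hp).le, h2⟩, by simpa [hp] using h3⟩
    · rintro (⟨⟨h1, h2⟩, h3⟩ | ⟨⟨h1, h2⟩, h3⟩)
      · exact ⟨⟨h1, h2.trans hbc⟩, by simpa [h2] using h3⟩
      · refine ⟨⟨hab.trans h1, h2⟩, ?_⟩
        rcases h1.eq_or_lt with h1 | hlt
        · rw [if_pos h1.ge, h3, ← h1, h]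
        · rw [if_neg (not_le.2 hlt), h3]

end IsPathOn

namespace PathJoined

variable {S : Set (Fin n → R)} {x y z : Fin n → R}

theorem refl (hx : x ∈ S) : PathJoined S x x :=
  ⟨fun _ => x, 0, 0, le_rfl, .const x 0 0, fun _ _ _ => hx, rfl, rfl⟩

theorem symm (h : PathJoined S x y) : PathJoined S y x := by
  obtain ⟨γ, a, b, hab, hγ, hS, rfl, rfl⟩ := h
  refine ⟨fun t => γ (-1 * t + 0), -b, -a, by simpa using hab,
    hγ.comp_affine fun t h1 h2 => ⟨by linarith, by linarith⟩,
    fun t h1 h2 => hS _ (by linarith) (by linarith), by simp, by simp⟩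

theorem trans (h : PathJoined S x y) (h' : PathJoined S y z) : PathJoined S x z := by
  obtain ⟨γ, a, b, hab, hγ, hS, rfl, hb⟩ := h
  obtain ⟨γ', c, d, hcd, hγ', hS', rfl, rfl⟩ := h'
  have h2 : IsPathOn (fun t => γ' (1 * t + (c - b))) b (b + (d - c)) :=
    hγ'.comp_affine fun t h1 h2 => ⟨by linarith, by linarith⟩
  refine ⟨_, a, b + (d - c), by linarith, hγ.append h2 hab (by linarith) (by simp [hb]),
    fun t h1 h2 => ?_, by simp [hab], ?_⟩
  · by_cases h : t ≤ b
    · simpa [h] using hS t h1 h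
    · simp only [h, if_false]
      exact hS' _ (by linarith) (by linarith)
  · rcases hcd.eq_or_lt with rfl | hlt
    · simp [hb]
    · rw [if_neg (by linarith)]
      congr 1; ring

theorem of_isPathOn {γ : R → Fin n → R} {a b : R} (hab : a ≤ b) (hγ : IsPathOn γ a b)
    (hS : ∀ t, a ≤ t → t ≤ b → γ t ∈ S) : PathJoined S (γ a) (γ b) :=
  ⟨γ, a, b, hab, hγ, hS, rfl, rfl⟩

end PathJoined

theorem IsSemialgebraicPath.isPathOn {S : Set (Fin n → R)} {γ : R → Fin n → R}
    (h : IsSemialgebraicPath S γ) : IsPathOn γ 0 1 where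
  continuousOn := h.continuousOn
  graph := by
    have h1 := def_mem_iff_isSemialgebraic.2 h.semialgebraic
    have h2 : PolyMap R (fun p : R × (Fin n → R) => (Fin.cons p.1 p.2 : Fin (n + 1) → R)) := by
      refine PolyMap.pi fun i => ?_
      refine Fin.cases ?_ (fun j => ?_) i
      · simp only [Fin.cons_zero]; fun_prop
      · simp only [Fin.cons_succ]; fun_prop
    exact (h1.comp h2).congr' fun p => by simp

theorem IsPathOn.isSemialgebraicPath {S : Set (Fin n → R)} {γ : R → Fin n → R}
    (h : IsPathOn γ 0 1) (hS : ∀ t, 0 ≤ t → t ≤ 1 → γ t ∈ S) : IsSemialgebraicPath S γ where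
  continuousOn := h.continuousOn
  semialgebraic := by
    refine def_mem_iff_isSemialgebraic.1 ((h.graph.comp
      (g := fun p : Fin (n + 1) → R => (p 0, Fin.tail p)) ?_).congr' fun p => by simp)
    exact PolyMap.prodMk (by fun_prop) (PolyMap.pi fun i => by simp only [Fin.tail]; fun_prop)
  mapsTo := fun t ht => hS t ht.1 ht.2

/-- Free parameter intervals make concatenation easy; an affine change brings them back to [0, 1].
-/
theorem PathJoined.exists_isSemialgebraicPath {S : Set (Fin n → R)} {x y : Fin n → R}
    (h : PathJoined S x y) : ∃ γ, IsSemialgebraicPath S γ ∧ γ 0 = x ∧ γ 1 = y := by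
  obtain ⟨γ, a, b, hab, hγ, hS, rfl, rfl⟩ := h
  have key : ∀ t : R, 0 ≤ t → t ≤ 1 → a ≤ (b - a) * t + a ∧ (b - a) * t + a ≤ b := fun t h0 h1 =>
    ⟨by nlinarith, by nlinarith⟩
  exact ⟨_, (hγ.comp_affine key).isSemialgebraicPath
    fun t h0 h1 => hS _ (key t h0 h1).1 (key t h0 h1).2, by simp, by simp⟩

end Paths

/-! ### Lifting paths along polynomial coordinate systems -/

section Lift

open Set Topology

variable {R : Type*} [Field R] [LinearOrder R] [IsStrictOrderedRing R] {n : ℕ}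

theorem GoodBall.injOn {H : Fin n → MvPolynomial (Fin n) R} {x : Fin n → R} {r : R}
    (h : GoodBall H x r) {z w : Fin n → R} (hz : sqd z x ≤ r) (hw : sqd w x ≤ r)
    (hzw : polyEval H z = polyEval H w) : z = w := by
  have h1 := (h.2 z hz).2 w hw
  rw [hzw, sqd_self] at h1
  exact sqd_eq_zero (le_of_mul_le_mul_left (by simpa using h1) h.1)

theorem Def.goodBall {X : Type*} [CoordSpace R X] [IsRealClosed R]
    (H : Fin n → MvPolynomial (Fin n) R)
    {f : X → Fin n → R} {g : X → R} (hf : PolyMap R f) (hg : PolyMap R g) :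
    Def R (fun x => GoodBall H (f x) (g x)) := by
  have h1 : Def R (fun p : (Fin n → R) × R => GoodBall H p.1 p.2) := by
    unfold GoodBall
    refine (Def.lt (by fun_prop) (by fun_prop)).and (Def.allVec
      (P := fun (p : (Fin n → R) × R) z => sqd z p.1 ≤ p.2 →
      (jacobianMatrixAt H z).det ≠ 0 ∧
      ∀ w, sqd w p.1 ≤ p.2 → p.2 * sqd z w ≤ sqd (polyEval H z) (polyEval H w)) ?_)
    refine (Def.le (by fun_prop) (by fun_prop)).imp ((Def.not ?_).and (Def.allVec
      (P := fun (p : ((Fin n → R) × R) × (Fin n → R)) w => sqd w p.1.1 ≤ p.1.2 →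
        p.1.2 * sqd p.2 w ≤ sqd (polyEval H p.2) (polyEval H w)) ?_))
    · simp only [← eval_det_jacobianPoly]
      exact Def.eq (by fun_prop) (by fun_prop)
    · exact (Def.le (by fun_prop) (by fun_prop)).imp (Def.le (by fun_prop) (by fun_prop))
  exact h1.comp (PolyMap.prodMk hf hg)

variable [TopologicalSpace R] [OrderTopology R] [IsRealClosed R]

/-- Solving `H z = Ω(t, σ(t))` near a path `σ` along which `H` has good balls of constant size. -/
theorem IsPathOn.exists_lift {H : Fin n → MvPolynomial (Fin n) R} {σ : R → Fin n → R} {a b : R}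
    (hσ : IsPathOn σ a b) {r : R} (hr : 0 < r) (hgood : ∀ t, a ≤ t → t ≤ b → GoodBall H (σ t) r)
    {Ω : R × (Fin n → R) → Fin n → R} (hΩ : PolyMap R Ω) (hΩc : Continuous Ω)
    (hsmall : ∀ t, a ≤ t → t ≤ b → 256 * sqd (polyEval H (σ t)) (Ω (t, σ t)) < r * r) :
    ∃ γ, IsPathOn γ a b ∧ ∀ t, a ≤ t → t ≤ b →
      sqd (γ t) (σ t) ≤ r ∧ polyEval H (γ t) = Ω (t, σ t) := by
  -- Solutions are sought in balls of size r/8, where the inverse function theorem requires the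
  -- constant 4 · 8² = 256. Solutions at nearby parameters then lie in a common ball of size r,
  -- whose expansion property gives continuity.
  have hgood' : ∀ t, a ≤ t → t ≤ b → GoodBall H (σ t) (r / 8) := fun t h1 h2 =>
    (hgood t h1 h2).mono (by positivity) (by linarith) fun z hz => by linarith
  have hex : ∀ t, ∃ z, a ≤ t → t ≤ b → sqd z (σ t) ≤ r / 8 ∧ polyEval H z = Ω (t, σ t) := by
    intro t
    by_cases ht : a ≤ t ∧ t ≤ b
    · obtain ⟨z, hz⟩ := (hgood' t ht.1 ht.2).exists_polyEval_eq
        (w := Ω (t, σ t)) (by nlinarith [hsmall t ht.1 ht.2])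
      exact ⟨z, fun _ _ => hz⟩
    · exact ⟨0, fun h1 h2 => absurd ⟨h1, h2⟩ ht⟩
  choose γ hγ using hex
  refine ⟨γ, ⟨?_, ?_⟩, fun t h1 h2 => ⟨by linarith [(hγ t h1 h2).1], (hγ t h1 h2).2⟩⟩
  · intro t₀ ht₀
    refine Filter.tendsto_def.2 fun N hN => ?_
    obtain ⟨ρ, hρ, hρN⟩ := exists_sqd_le_subset hN
    have hω : ContinuousOn (fun t => Ω (t, σ t)) (Icc a b) :=
      hΩc.comp_continuousOn (continuousOn_id.prodMk hσ.continuousOn)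
    filter_upwards [self_mem_nhdsWithin, (hσ.continuousOn t₀ ht₀)
      (setOf_sqd_lt_mem_nhds (σ t₀) (show 0 < r / 8 by positivity)), (hω t₀ ht₀)
      (setOf_sqd_lt_mem_nhds (Ω (t₀, σ t₀)) (show 0 < r * ρ by positivity))] with t ht h1 h2
    refine hρN _ (le_of_mul_le_mul_left ?_ hr)
    have h3 : sqd (γ t) (σ t₀) ≤ r := by
      have := sqd_le (γ t) (σ t) (σ t₀)
      have := (hγ t ht.1 ht.2).1
      have h1 : sqd (σ t) (σ t₀) < r / 8 := h1
      linarith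
    have h4 := ((hgood t₀ ht₀.1 ht₀.2).2 _ h3).2 (γ t₀) (by linarith [(hγ t₀ ht₀.1 ht₀.2).1])
    rw [(hγ t ht.1 ht.2).2, (hγ t₀ ht₀.1 ht₀.2).2] at h4
    exact h4.trans (le_of_lt h2)
  -- The graph is definable because γ t is the only solution in its ball.
  · refine (hσ.def_comp (X := R × (Fin n → R)) (g := Prod.fst) (by fun_prop)
      (P := fun p s => sqd p.2 s ≤ r / 8 ∧ polyEval H p.2 = Ω (p.1, s)) ?_).congr' fun p => ?_
    · refine (Def.le (by fun_prop) (by fun_prop)).and ((Def.forall_fintype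
        (P := fun i (p : (R × (Fin n → R)) × (Fin n → R)) =>
          polyEval H p.1.2 i = Ω (p.1.1, p.2) i) fun i => Def.eq (by fun_prop) ?_).congr'
        fun p => funext_iff)
      have : PolyMap R (fun p : (R × (Fin n → R)) × (Fin n → R) => Ω (p.1.1, p.2)) :=
        PolyMap.comp hΩ (by fun_prop)
      fun_prop
    · constructor
      · rintro ⟨h, h'⟩
        rw [h']
        exact ⟨h, hγ _ h.1 h.2⟩
      · rintro ⟨h, h1, h2⟩
        obtain ⟨h3, h4⟩ := hγ p.1 h.1 h.2
        exact ⟨h, (hgood' p.1 h.1 h.2).injOn h1 h3 (h2.trans h4.symm)⟩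

end Lift

end

section

/-! ### Crossing the level set -/

set_option linter.unusedSectionVars false

section Charts

open Set Topology

variable {R : Type*} [Field R] [LinearOrder R] [IsStrictOrderedRing R] [IsRealClosed R]
  [TopologicalSpace R] [OrderTopology R] {n : ℕ}

/-- A good ball of `H` in which the vanishing of the coordinates in `T` forces membership
in `V`. -/
def ChartBall (V : Set (Fin n → R)) (H : Fin n → MvPolynomial (Fin n) R) (T : Finset (Fin n))
    (x : Fin n → R) (r : R) : Prop :=
  GoodBall H x r ∧ ∀ z, sqd z x ≤ r → (∀ i ∈ T, MvPolynomial.eval z (H i) = 0) → z ∈ V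

/-- The charts `(H c, T c)` straighten `V` near the points where `φ`, which is among the coordinates
of each chart, takes the value `u`. -/
structure IsChartSystem {I : Type*} (V : Set (Fin n → R)) (φ : MvPolynomial (Fin n) R) (u : R)
    (H : I → Fin n → MvPolynomial (Fin n) R) (T : I → Finset (Fin n)) (i₀ : I → Fin n) : Prop where
  def_mem : Def R (· ∈ V)
  eval_eq_zero : ∀ c, ∀ i ∈ T c, ∀ x ∈ V, MvPolynomial.eval x (H c i) = 0
  notMem : ∀ c, i₀ c ∉ T c
  eq_coord : ∀ c, H c (i₀ c) = φ
  exists_det : ∀ x ∈ V, MvPolynomial.eval x φ = u → ∃ c, (jacobianMatrixAt (H c) x).det ≠ 0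
  mem_of_vanish : ∀ c, ∀ x ∈ V, (jacobianMatrixAt (H c) x).det ≠ 0 →
    ∀ᶠ z in 𝓝 x, (∀ i ∈ T c, MvPolynomial.eval z (H c i) = 0) → z ∈ V

variable {V : Set (Fin n → R)} {φ : MvPolynomial (Fin n) R} {u : R}

theorem ChartBall.mono {H : Fin n → MvPolynomial (Fin n) R} {T : Finset (Fin n)}
    {x y : Fin n → R} {r s : R} (h : ChartBall V H T x r) (hs : 0 < s) (hsr : s ≤ r)
    (hsub : ∀ z, sqd z y ≤ s → sqd z x ≤ r) : ChartBall V H T y s :=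
  ⟨h.1.mono hs hsr hsub, fun z hz => h.2 z (hsub z hz)⟩

theorem ChartBall.shrink {H : Fin n → MvPolynomial (Fin n) R} {T : Finset (Fin n)}
    {x : Fin n → R} {r s : R} (h : ChartBall V H T x r) (hs : 0 < s) (hsr : s ≤ r) :
    ChartBall V H T x s :=
  h.mono hs hsr fun _ hz => hz.trans hsr

theorem ChartBall.of_near {H : Fin n → MvPolynomial (Fin n) R} {T : Finset (Fin n)}
    {x y : Fin n → R} {r : R} (h : ChartBall V H T x r) (hy : sqd y x ≤ r / 4) :
    ChartBall V H T y (r / 4) :=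
  h.mono (by have := h.1.1; positivity) (by have := h.1.1; linarith) fun z hz => by
    have := sqd_le z y x; linarith

/-- The squared distance to a convex combination. -/
theorem sqd_convex_le {p q x : Fin n → R} {t : R} (h0 : 0 ≤ t) (h1 : t ≤ 1) :
    sqd x (fun i => (1 - t) * p i + t * q i) ≤ sqd x p + sqd x q := by
  simp only [sqd, ← Finset.sum_add_distrib]
  refine Finset.sum_le_sum fun i _ => ?_
  have : x i - ((1 - t) * p i + t * q i) = (1 - t) * (x i - p i) + t * (x i - q i) := by ring
  rw [this]
  nlinarith [sq_nonneg (x i - p i), sq_nonneg (x i - q i), sq_nonneg ((x i - p i) - (x i - q i)),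
    mul_nonneg h0 (sub_nonneg.2 h1), mul_nonneg (mul_nonneg h0 (sub_nonneg.2 h1))
      (sq_nonneg ((x i - p i) - (x i - q i))), mul_nonneg h0 (sq_nonneg (x i - p i)),
    mul_nonneg (sub_nonneg.2 h1) (sq_nonneg (x i - q i))]

/-- Lowering one coordinate. -/
theorem sqd_sub_single (x : Fin n → R) (i : Fin n) (ε : R) :
    sqd x (fun j => x j - Pi.single (M := fun _ => R) i ε j) = ε ^ 2 := by
  rw [sqd, Finset.sum_eq_single i]
  · simp
  · intro j _ hj; simp [hj]
  · simp

theorem exists_small_sq {r : R} (hr : 0 < r) : ∃ ε > 0, ε ^ 2 < r := by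
  refine ⟨min 1 (r / 2), lt_min one_pos (by positivity), ?_⟩
  have h1 := min_le_left 1 (r / 2)
  have h2 := min_le_right 1 (r / 2)
  have h3 : 0 < min 1 (r / 2) := lt_min one_pos (by positivity)
  nlinarith

namespace IsChartSystem

variable {I : Type*} {H : I → Fin n → MvPolynomial (Fin n) R} {T : I → Finset (Fin n)}
  {i₀ : I → Fin n} (hV : IsChartSystem V φ u H T i₀)
include hV

theorem exists_chartBall {c : I} {x : Fin n → R} (hx : x ∈ V)
    (hdet : (jacobianMatrixAt (H c) x).det ≠ 0) : ∃ r, ChartBall V (H c) (T c) x r := by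
  obtain ⟨r, hr⟩ := exists_goodBall hdet
  obtain ⟨s, hs, hsV⟩ := exists_sqd_le_subset (hV.mem_of_vanish c x hx hdet)
  exact ⟨min r s, hr.mono (lt_min hr.1 hs) (min_le_left _ _)
    fun z hz => hz.trans (min_le_left _ _), fun z hz => hsV z (hz.trans (min_le_right _ _))⟩

/-- In a chart at x, lower the coordinate φ by ε and keep the others; the equations in T persist. -/
theorem exists_near {x : Fin n → R} (hx : x ∈ V) (hxu : MvPolynomial.eval x φ = u)
    {N : Set (Fin n → R)} (hN : N ∈ 𝓝 x) : ∃ q ∈ N, q ∈ V ∧ MvPolynomial.eval q φ < u := by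
  obtain ⟨c, hc⟩ := hV.exists_det x hx hxu
  obtain ⟨r, hr⟩ := hV.exists_chartBall hx hc
  obtain ⟨s, hs, hsN⟩ := exists_sqd_le_subset hN
  have hb := hr.shrink (lt_min hr.1.1 hs) (min_le_left r s)
  have hpos : 0 < min r s * min r s / 4 := by have := hb.1.1; positivity
  obtain ⟨ε, hε, hεs⟩ := exists_small_sq hpos
  obtain ⟨z, hz, hzw⟩ := hb.1.exists_polyEval_eq
    (w := fun j => polyEval (H c) x j - Pi.single (M := fun _ => R) (i₀ c) ε j)
    (by rw [sqd_sub_single]; linarith)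
  refine ⟨z, hsN z (hz.trans (min_le_right _ _)), hb.2 z hz fun i hi => ?_, ?_⟩
  · have h1 := congrFun hzw i
    have h2 : i ≠ i₀ c := fun h => hV.notMem c (h ▸ hi)
    simpa [polyEval, h2, hV.eval_eq_zero c i hi x hx] using h1
  · have h1 := congrFun hzw (i₀ c)
    simp only [polyEval, hV.eq_coord, hxu, Pi.single_eq_same] at h1
    linarith

/-- Near a point of the level set, the points below the level are joined below the level. -/
theorem exists_joined_near {x : Fin n → R} (hx : x ∈ V) (hxu : MvPolynomial.eval x φ = u) :
    ∃ ρ > 0, ∀ p q, p ∈ V → MvPolynomial.eval p φ < u → q ∈ V → MvPolynomial.eval q φ < u →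
      sqd p x ≤ ρ → sqd q x ≤ ρ → PathJoined {z | z ∈ V ∧ MvPolynomial.eval z φ < u} p q := by
  obtain ⟨c, hc⟩ := hV.exists_det x hx hxu
  obtain ⟨r, hr⟩ := hV.exists_chartBall hx hc
  have hrpos := hr.1.1
  -- The bound is halved to r²/512 because the distance to an interpolated value is estimated by the
  -- sum of those to p and q.
  have hN : {z | sqd (polyEval (H c) x) (polyEval (H c) z) < r * r / 512} ∈ 𝓝 x :=
    (isOpen_lt (by fun_prop) continuous_const).mem_nhds (by
      simp only [mem_ofPred_eq, sqd_self]; positivity)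
  obtain ⟨s, hs, hsN⟩ := exists_sqd_le_subset hN
  refine ⟨min r s, lt_min hrpos hs, fun p q hp hpu hq hqu hps hqs => ?_⟩
  have hp' := hsN p (hps.trans (min_le_right _ _))
  have hq' := hsN q (hqs.trans (min_le_right _ _))
  -- Interpolating the chart values of p and q keeps the coordinates in T zero and φ below u;
  -- injectivity on the ball identifies the end points.
  obtain ⟨γ, hγ, hγt⟩ := (IsPathOn.const x 0 1).exists_lift (H := H c) (r := r) hrpos
    (fun _ _ _ => hr.1) (Ω := fun y i => (1 - y.1) * polyEval (H c) p i + y.1 * polyEval (H c) q i)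
    (by fun_prop) (by fun_prop) (fun t h0 h1 => by
      have := sqd_convex_le (p := polyEval (H c) p) (q := polyEval (H c) q)
        (x := polyEval (H c) x) h0 h1
      have h2 : sqd (polyEval (H c) x) (polyEval (H c) p) < r * r / 512 := hp'
      have h3 : sqd (polyEval (H c) x) (polyEval (H c) q) < r * r / 512 := hq'
      dsimp only
      linarith)
  have e0 : γ 0 = p := hr.1.injOn (hγt 0 le_rfl zero_le_one).1 (hps.trans (min_le_left _ _))
    ((hγt 0 le_rfl zero_le_one).2.trans (by simp))
  have e1 : γ 1 = q := hr.1.injOn (hγt 1 zero_le_one le_rfl).1 (hqs.trans (min_le_left _ _))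
    ((hγt 1 zero_le_one le_rfl).2.trans (by simp))
  rw [← e0, ← e1]
  refine PathJoined.of_isPathOn zero_le_one hγ fun t h0 h1 => ?_
  obtain ⟨h2, h3⟩ := hγt t h0 h1
  refine ⟨hr.2 _ h2 fun i hi => ?_, ?_⟩
  · have := congrFun h3 i
    simpa [polyEval, hV.eval_eq_zero c i hi p hp, hV.eval_eq_zero c i hi q hq] using this
  · have := congrFun h3 (i₀ c)
    simp only [polyEval, hV.eq_coord] at this
    rw [this]
    rcases h0.eq_or_lt with rfl | h0
    · simpa using hpu
    · nlinarith [mul_lt_mul_of_pos_left hqu h0, mul_le_mul_of_nonneg_left hpu.le (sub_nonneg.2 h1)]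

end IsChartSystem

open Classical in
/-- The points below the level that can be joined below the level to points arbitrarily near
`x`. -/
noncomputable def nearClass (V : Set (Fin n → R)) (φ : MvPolynomial (Fin n) R) (u : R)
    (x : Fin n → R) : Set (Fin n → R) :=
  if MvPolynomial.eval x φ < u then {p | PathJoined {z | z ∈ V ∧ MvPolynomial.eval z φ < u} x p}
  else {p | ∀ N ∈ 𝓝 x, ∃ q ∈ N, (q ∈ V ∧ MvPolynomial.eval q φ < u) ∧
    PathJoined {z | z ∈ V ∧ MvPolynomial.eval z φ < u} p q}

theorem nearClass_eq_of_joined {x y : Fin n → R} (hx : MvPolynomial.eval x φ < u)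
    (hy : MvPolynomial.eval y φ < u)
    (h : PathJoined {z | z ∈ V ∧ MvPolynomial.eval z φ < u} x y) :
    nearClass V φ u x = nearClass V φ u y := by
  simp only [nearClass, hx, hy, if_true]
  ext p
  exact ⟨fun hp => h.symm.trans hp, fun hp => h.trans hp⟩

namespace IsChartSystem

variable {I : Type*} {H : I → Fin n → MvPolynomial (Fin n) R} {T : I → Finset (Fin n)}
  {i₀ : I → Fin n} (hV : IsChartSystem V φ u H T i₀)
include hV

/-- The points below the level in a small ball about x form one path class, and each level point of
V in the ball has such points arbitrarily near. -/
theorem exists_nearClass_eq {x : Fin n → R} (hx : x ∈ V) (hxu : MvPolynomial.eval x φ = u) :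
    ∃ ρ > 0, ∀ y ∈ V, MvPolynomial.eval y φ ≤ u → sqd y x < ρ →
      nearClass V φ u y = nearClass V φ u x := by
  obtain ⟨ρ, hρ, h⟩ := hV.exists_joined_near hx hxu
  refine ⟨ρ, hρ, fun y hy hyu hyx => ?_⟩
  have hball : {z | sqd z x < ρ} ∈ 𝓝 y :=
    (isOpen_lt (by fun_prop) continuous_const).mem_nhds hyx
  have hball' : {z | sqd z x < ρ} ∈ 𝓝 x := setOf_sqd_lt_mem_nhds x hρ
  rcases hyu.lt_or_eq with hlt | heq
  · simp only [nearClass, hlt, hxu, lt_irrefl, if_true, if_false]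
    ext p
    constructor
    · intro hp N hN
      obtain ⟨q, ⟨hqN, hqb⟩, hqV, hqu⟩ := hV.exists_near hx hxu (Filter.inter_mem hN hball')
      exact ⟨q, hqN, ⟨hqV, hqu⟩, hp.symm.trans (h y q hy hlt hqV hqu hyx.le (le_of_lt hqb))⟩
    · intro hp
      obtain ⟨q, hqb, ⟨hqV, hqu⟩, hpq⟩ := hp _ hball'
      exact (h y q hy hlt hqV hqu hyx.le (le_of_lt hqb)).trans hpq.symm
  · simp only [nearClass, heq, hxu, lt_irrefl, if_false]
    ext p
    constructor
    · intro hp N hN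
      obtain ⟨q, hqb, ⟨hqV, hqu⟩, hpq⟩ := hp _ hball
      obtain ⟨q', ⟨hqN', hqb'⟩, hqV', hqu'⟩ := hV.exists_near hx hxu (Filter.inter_mem hN hball')
      exact ⟨q', hqN', ⟨hqV', hqu'⟩,
        hpq.trans (h q q' hqV hqu hqV' hqu' (le_of_lt hqb) (le_of_lt hqb'))⟩
    · intro hp N hN
      obtain ⟨q, hqb, ⟨hqV, hqu⟩, hpq⟩ := hp _ hball'
      obtain ⟨q', ⟨hqN', hqb'⟩, hqV', hqu'⟩ := hV.exists_near hy heq (Filter.inter_mem hN hball)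
      exact ⟨q', hqN', ⟨hqV', hqu'⟩,
        hpq.trans (h q q' hqV hqu hqV' hqu' (le_of_lt hqb) (le_of_lt hqb'))⟩

theorem def_chartBall (c : I) {X : Type*} [CoordSpace R X]
    {f : X → Fin n → R} {g : X → R} (hf : PolyMap R f) (hg : PolyMap R g) :
    Def R (fun x => ChartBall V (H c) (T c) (f x) (g x)) := by
  refine (Def.goodBall (H c) hf hg).and (Def.allVec (P := fun x z => sqd z (f x) ≤ g x →
    (∀ i ∈ T c, MvPolynomial.eval z (H c i) = 0) → z ∈ V) ?_)
  have h1 : PolyMap R fun p : X × (Fin n → R) => f p.1 := PolyMap.comp hf (by fun_prop)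
  have h2 : PolyMap R fun p : X × (Fin n → R) => g p.1 := PolyMap.comp hg (by fun_prop)
  exact (Def.le (by fun_prop) h2).imp ((Def.forall_mem_finset (T c)
    (P := fun i (p : X × (Fin n → R)) => MvPolynomial.eval p.2 (H c i) = 0) fun i _ =>
    Def.eq (by fun_prop) (by fun_prop)).imp (hV.def_mem.comp (by fun_prop)))

/-- Along a path in the level set covered by one chart, the chart has balls of constant size. -/
theorem exists_uniform_chartBall (c : I) {σ : R → Fin n → R} {a b : R} (hab : a ≤ b)
    (hσ : IsPathOn σ a b) (hσV : ∀ t, a ≤ t → t ≤ b → σ t ∈ V)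
    (hdet : ∀ t, a ≤ t → t ≤ b → (jacobianMatrixAt (H c) (σ t)).det ≠ 0) :
    ∃ r, 0 < r ∧ ∀ t, a ≤ t → t ≤ b → ChartBall V (H c) (T c) (σ t) r := by
  -- One radius serves up to the parameter y. This property is definable and locally constant, which
  -- replaces compactness of [a, b]. The form with `False` suits `IsPathOn.def_comp`.
  let P : R → Prop := fun y => ∃ r, 0 < r ∧ ∀ t, ((a ≤ t ∧ t ≤ b) ∧
    (t ≤ y ∧ ¬ ChartBall V (H c) (T c) (σ t) r)) → False
  have hP : Def R P := by
    refine Def.ex (P := fun y r => 0 < r ∧ ∀ t, ((a ≤ t ∧ t ≤ b) ∧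
      (t ≤ y ∧ ¬ ChartBall V (H c) (T c) (σ t) r)) → False)
      ((Def.lt (by fun_prop) (by fun_prop)).and (Def.all (P := fun (p : R × R) t =>
        ((a ≤ t ∧ t ≤ b) ∧ (t ≤ p.1 ∧ ¬ ChartBall V (H c) (T c) (σ t) p.2)) → False)
        ((hσ.def_comp (X := (R × R) × R) (g := Prod.snd) (by fun_prop)
          (P := fun p s => p.2 ≤ p.1.1 ∧ ¬ ChartBall V (H c) (T c) s p.1.2) ?_).imp (.const _))))
    exact (Def.le (by fun_prop) (by fun_prop)).and
      (hV.def_chartBall c (by fun_prop) (by fun_prop)).not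
  have hPb : P a ↔ P b := by
    refine hP.iff_of_locally_iff hab fun t hat htb => ?_
    obtain ⟨r, hr⟩ := hV.exists_chartBall (hσV t hat htb) (hdet t hat htb)
    have hrpos := hr.1.1
    obtain ⟨δ, hδ, hnear⟩ := hσ.exists_near hat htb
      (setOf_sqd_lt_mem_nhds (σ t) (show 0 < r / 4 by positivity))
    have key : ∀ y y', a ≤ y → y ≤ b → a ≤ y' → y' ≤ b → |y - t| < δ → |y' - t| < δ →
        P y → P y' := by
      rintro y y' hay hyb hay' hyb' hy hy' ⟨s, hs, hP⟩
      refine ⟨min s (r / 4), lt_min hs (by positivity), ?_⟩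
      rintro t' ⟨⟨h1, h2⟩, h3, h4⟩
      by_cases h5 : t' ≤ y
      · refine hP t' ⟨⟨h1, h2⟩, h5, fun h6 => h4 ?_⟩
        exact h6.shrink (lt_min hs (by positivity)) (min_le_left _ _)
      · have h6 : |t' - t| < δ := by
          rw [abs_lt] at hy hy' ⊢
          constructor <;> linarith
        exact h4 ((hr.of_near (le_of_lt (hnear t' h1 h2 h6))).shrink
          (lt_min hs (by positivity)) (min_le_right _ _))
    refine ⟨δ, hδ, fun s has hsb hst => ⟨?_, ?_⟩⟩
    · exact key s t has hsb hat htb hst (by simpa using hδ)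
    · exact key t s hat htb has hsb (by simpa using hδ) hst
  have hPa : P a := by
    obtain ⟨r, hr⟩ := hV.exists_chartBall (hσV a le_rfl hab) (hdet a le_rfl hab)
    refine ⟨r, hr.1.1, ?_⟩
    rintro t ⟨⟨h1, -⟩, h2, h3⟩
    exact h3 (le_antisymm h2 h1 ▸ hr)
  obtain ⟨r, hr, h⟩ := hPb.1 hPa
  exact ⟨r, hr, fun t h1 h2 => by_contra fun h3 => h t ⟨⟨h1, h2⟩, h2, h3⟩⟩

/-- Lower φ by one ε along the whole path. The lifted path runs below the level, and its ends are so
close to those of σ that they have the same classes. -/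
theorem nearClass_eq_of_level (c : I) {σ : R → Fin n → R} {a b : R} (hab : a ≤ b)
    (hσ : IsPathOn σ a b) (hσV : ∀ t, a ≤ t → t ≤ b → σ t ∈ V)
    (hσu : ∀ t, a ≤ t → t ≤ b → MvPolynomial.eval (σ t) φ = u)
    (hdet : ∀ t, a ≤ t → t ≤ b → (jacobianMatrixAt (H c) (σ t)).det ≠ 0) :
    nearClass V φ u (σ a) = nearClass V φ u (σ b) := by
  obtain ⟨r, hr, hball⟩ := hV.exists_uniform_chartBall c hab hσ hσV hdet
  obtain ⟨ρ, hρ, hρa⟩ := hV.exists_nearClass_eq (hσV a le_rfl hab) (hσu a le_rfl hab)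
  obtain ⟨ρ', hρ', hρb⟩ := hV.exists_nearClass_eq (hσV b hab le_rfl) (hσu b hab le_rfl)
  obtain ⟨s, hs, hsr, hsρ, hsρ'⟩ : ∃ s > 0, s ≤ r ∧ s < ρ ∧ s < ρ' :=
    ⟨min r (min (ρ / 2) (ρ' / 2)), lt_min hr (lt_min (by positivity) (by positivity)),
      min_le_left _ _,
      by have := (min_le_right r (min (ρ / 2) (ρ' / 2))).trans (min_le_left _ _); linarith,
      by have := (min_le_right r (min (ρ / 2) (ρ' / 2))).trans (min_le_right _ _); linarith⟩
  obtain ⟨ε, hε, hεs⟩ := exists_small_sq (show 0 < s * s / 256 by positivity)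
  obtain ⟨γ, hγ, hγt⟩ := hσ.exists_lift (H := H c) hs
    (fun t h1 h2 => ((hball t h1 h2).shrink hs hsr).1)
    (Ω := fun y j => polyEval (H c) y.2 j - Pi.single (M := fun _ => R) (i₀ c) ε j)
    (by fun_prop) (by fun_prop) (fun t h1 h2 => by
      dsimp only
      rw [sqd_sub_single]; linarith)
  have hγS : ∀ t, a ≤ t → t ≤ b → γ t ∈ V ∧ MvPolynomial.eval (γ t) φ < u := by
    intro t h1 h2
    obtain ⟨h3, h4⟩ := hγt t h1 h2
    refine ⟨(hball t h1 h2).2 _ (h3.trans hsr) fun i hi => ?_, ?_⟩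
    · have h5 := congrFun h4 i
      have h6 : i ≠ i₀ c := fun h => hV.notMem c (h ▸ hi)
      simpa [polyEval, h6, hV.eval_eq_zero c i hi _ (hσV t h1 h2)] using h5
    · have h5 := congrFun h4 (i₀ c)
      simp only [polyEval, hV.eq_coord, hσu t h1 h2, Pi.single_eq_same] at h5
      linarith
  have ha := hγS a le_rfl hab
  have hb := hγS b hab le_rfl
  rw [← hρa _ ha.1 ha.2.le ((hγt a le_rfl hab).1.trans_lt hsρ),
    ← hρb _ hb.1 hb.2.le ((hγt b hab le_rfl).1.trans_lt hsρ')]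
  exact nearClass_eq_of_joined ha.2 hb.2 (PathJoined.of_isPathOn hab hγ hγS)

/-- By definability, finitely many parameters cut the path so that on each interval avoiding them it
lies below the level, or in the level within a single chart. At the cutting points local constancy
of the class takes over. -/
theorem nearClass_eq_of_isPathOn [Finite I] {σ : R → Fin n → R} {a b : R} (hab : a ≤ b)
    (hσ : IsPathOn σ a b)
    (hσV : ∀ t, a ≤ t → t ≤ b → σ t ∈ V ∧ MvPolynomial.eval (σ t) φ ≤ u) :
    nearClass V φ u (σ a) = nearClass V φ u (σ b) := by
  obtain ⟨F, hF⟩ := Def.exists_finset_forall (R := R) (ι := Option I)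
    (P := fun o t => (a ≤ t ∧ t ≤ b) ∧ match o with
      | none => MvPolynomial.eval (σ t) φ < u
      | some c => MvPolynomial.eval (σ t) φ = u ∧ (jacobianMatrixAt (H c) (σ t)).det ≠ 0)
    (by
      rintro (_ | c)
      · exact hσ.def_comp (g := fun t : R => t) (by fun_prop)
          (P := fun _ z => MvPolynomial.eval z φ < u) (Def.lt (by fun_prop) (by fun_prop))
      · refine hσ.def_comp (g := fun t : R => t) (by fun_prop)
          (P := fun _ z => MvPolynomial.eval z φ = u ∧ (jacobianMatrixAt (H c) z).det ≠ 0) ?_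
        simp only [← eval_det_jacobianPoly]
        exact (Def.eq (by fun_prop) (by fun_prop)).and (Def.eq (by fun_prop) (by fun_prop)).not)
  have hseg : ∀ c d, a ≤ c → c ≤ d → d ≤ b → (∀ t, c ≤ t → t ≤ d → MvPolynomial.eval (σ t) φ < u) →
      nearClass V φ u (σ c) = nearClass V φ u (σ d) := by
    intro c d hac hcd hdb h
    exact nearClass_eq_of_joined (h c le_rfl hcd) (h d hcd le_rfl)
      (PathJoined.of_isPathOn hcd (hσ.restrict hac hdb) fun t h1 h2 =>
        ⟨(hσV t (hac.trans h1) (h2.trans hdb)).1, h t h1 h2⟩)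
  refine eq_of_locally_eq (fun t => nearClass V φ u (σ t)) F hab ?_ ?_
  · intro c d hac hcd hdb hcdF
    have hcb := hcd.trans hdb
    -- Each alternative that holds at c holds throughout [c, d], so one chart good at σ c is good
    -- along the whole piece.
    have hsub : ∀ o t, c ≤ t → t ≤ d → _ := fun o t h1 h2 =>
      (hF o c t h1 fun x hx h3 h4 => hcdF x hx h3 (h4.trans h2)).1
    rcases (hσV c hac hcb).2.lt_or_eq with hlt | heq
    · exact hseg c d hac hcd hdb fun t h1 h2 => (hsub none t h1 h2 ⟨⟨hac, hcb⟩, hlt⟩).2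
    · obtain ⟨i, hi⟩ := hV.exists_det _ (hσV c hac hcb).1 heq
      have h3 := fun t h1 h2 => (hsub (some i) t h1 h2 ⟨⟨hac, hcb⟩, heq, hi⟩).2
      exact hV.nearClass_eq_of_level i hcd (hσ.restrict hac hdb)
        (fun t h1 h2 => (hσV t (hac.trans h1) (h2.trans hdb)).1)
        (fun t h1 h2 => (h3 t h1 h2).1) (fun t h1 h2 => (h3 t h1 h2).2)
  · intro t hat htb
    rcases (hσV t hat htb).2.lt_or_eq with hlt | heq
    · obtain ⟨δ, hδ, h⟩ := hσ.exists_near hat htb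
        ((isOpen_lt (MvPolynomial.continuous_eval φ) continuous_const).mem_nhds hlt)
      refine ⟨δ, hδ, fun s has hsb hst => ?_⟩
      rw [abs_lt] at hst
      rcases le_total s t with hle | hle
      · exact hseg s t has hle htb fun t' h1 h2 => h t' (has.trans h1) (h2.trans htb) (by
          rw [abs_lt]; constructor <;> linarith)
      · exact (hseg t s hat hle hsb fun t' h1 h2 => h t' (hat.trans h1) (h2.trans hsb) (by
          rw [abs_lt]; constructor <;> linarith)).symm
    · obtain ⟨ρ, hρ, h⟩ := hV.exists_nearClass_eq (hσV t hat htb).1 heq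
      obtain ⟨δ, hδ, h'⟩ := hσ.exists_near hat htb (setOf_sqd_lt_mem_nhds _ hρ)
      exact ⟨δ, hδ, fun s has hsb hst =>
        h _ (hσV s has hsb).1 (hσV s has hsb).2 (h' s has hsb hst)⟩

/-- Two points below the level that are joined up to the level are joined below the level. -/
theorem joined_of_joined [Finite I] {x y : Fin n → R} (hx : MvPolynomial.eval x φ < u)
    (hyV : y ∈ V) (hy : MvPolynomial.eval y φ < u)
    (h : PathJoined {z | z ∈ V ∧ MvPolynomial.eval z φ ≤ u} x y) :
    PathJoined {z | z ∈ V ∧ MvPolynomial.eval z φ < u} x y := by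
  obtain ⟨σ, a, b, hab, hσ, hσV, rfl, rfl⟩ := h
  have h1 := hV.nearClass_eq_of_isPathOn hab hσ hσV
  have h2 : σ b ∈ nearClass V φ u (σ b) := by
    simp only [nearClass, hy, if_true]
    exact PathJoined.refl ⟨hyV, hy⟩
  rw [← h1] at h2
  rwa [nearClass, if_pos hx] at h2

end IsChartSystem

/-- Semi-algebraic paths do not leave semi-algebraic subsets that are open and closed. -/
theorem PathJoined.mem_of_clopen {S C : Set (Fin n → R)} (hC : Def R (· ∈ C))
    {U F : Set (Fin n → R)} (hU : IsOpen U) (hCU : C = U ∩ S) (hF : IsClosed F) (hCF : C = F ∩ S)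
    {x y : Fin n → R} (hx : x ∈ C) (h : PathJoined S x y) : PathJoined C x y := by
  obtain ⟨σ, a, b, hab, hσ, hσS, rfl, rfl⟩ := h
  refine ⟨σ, a, b, hab, hσ, fun t hat htb => ?_, rfl, rfl⟩
  have hP : Def R (fun t => (a ≤ t ∧ t ≤ b) ∧ σ t ∈ C) :=
    hσ.def_comp (g := fun t : R => t) (by fun_prop) (P := fun _ z => z ∈ C)
      (hC.comp (by fun_prop))
  refine ((hP.iff_of_locally_iff hat fun s has hst => ?_).1 ⟨⟨le_rfl, hab⟩, hx⟩).2
  have hsb := hst.trans htb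
  by_cases hs : σ s ∈ C
  · have hsU : σ s ∈ U := (hCU ▸ hs : σ s ∈ U ∩ S).1
    obtain ⟨δ, hδ, h⟩ := hσ.exists_near has hsb (hU.mem_nhds hsU)
    refine ⟨δ, hδ, fun s' h1 h2 h3 => iff_of_true ?_ ⟨⟨has, hsb⟩, hs⟩⟩
    have h4 := h2.trans htb
    exact ⟨⟨h1, h4⟩, hCU ▸ ⟨h s' h1 h4 h3, hσS s' h1 h4⟩⟩
  · have hsF : σ s ∈ Fᶜ := fun h => hs (hCF ▸ ⟨h, hσS s has hsb⟩)
    obtain ⟨δ, hδ, h⟩ := hσ.exists_near has hsb (hF.isOpen_compl.mem_nhds hsF)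
    refine ⟨δ, hδ, fun s' h1 h2 h3 => iff_of_false (fun h5 => ?_) fun h5 => hs h5.2⟩
    exact h s' h1 (h2.trans htb) h3 (hCF ▸ h5.2 : σ s' ∈ F ∩ S).1

end Charts

end

/-! ### Proof of the theorem -/

theorem mainTheorem5
    {R : Type*} [Field R] [LinearOrder R] [IsStrictOrderedRing R] [IsRealClosed R]
    [TopologicalSpace R] [OrderTopology R]
    {K : Type*} [Field K] [Algebra R K] [IsAlgClosure R K]
    {n d : ℕ} (hd : 0 < d)
    (Z : Set (Fin n → K)) (hZR : IsAlgebraicSetOver R Z) (hZd : IsEquidimensional Z d)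
    (φ : MvPolynomial (Fin n) R) (u : R)
    (hu : ∀ x ∈ realFiber Z φ {u},
      toExtension K x ∉ singPointsOf (MvPolynomial.map (algebraMap R K) φ) Z d)
    (C : Set (Fin n → R)) (hC : IsSemialgComponent C (realFiber Z φ (Set.Iic u))) :
    IsSemialgComponent (C ∩ {x | MvPolynomial.eval x φ < u}) (realFiber Z φ (Set.Iio u)) := by
  obtain ⟨I, _, H, T, i₀, h1, h2, h3, h4⟩ := exists_charts hZR hZd φ u hu
  have hZdef : Def R (fun x : Fin n → R => toExtension K x ∈ Z) := by
    obtain ⟨s, rfl⟩ := hZR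
    refine (Def.forall_mem_finset s (P := fun f (x : Fin n → R) => MvPolynomial.eval x f = 0)
      fun f _ => Def.eq (by fun_prop) (by fun_prop)).congr' fun x => ?_
    exact forall₂_congr fun f _ => aeval_toExtension_eq_zero_iff x f
  have hV : IsChartSystem {x : Fin n → R | toExtension K x ∈ Z} φ u H T i₀ :=
    ⟨hZdef, h1, fun c => (h2 c).1, fun c => (h2 c).2, fun x hx hxu => h3 x ⟨hx, hxu⟩, h4⟩
  have hCdef := def_mem_iff_isSemialgebraic.2 hC.connected.semialgebraic
  have hlt : Def R (fun x : Fin n → R => MvPolynomial.eval x φ < u) :=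
    Def.lt (by fun_prop) (by fun_prop)
  obtain ⟨U, hU, hCU⟩ := hC.isOpen_in
  obtain ⟨F, hF, hCF⟩ := hC.isClosed_in
  have hsub : ∀ x, x ∈ realFiber Z φ (Set.Iio u) → x ∈ realFiber Z φ (Set.Iic u) :=
    fun x hx => ⟨hx.1, le_of_lt hx.2⟩
  have hinter : ∀ W : Set (Fin n → R), C = W ∩ realFiber Z φ (Set.Iic u) →
      C ∩ {x | MvPolynomial.eval x φ < u} = W ∩ realFiber Z φ (Set.Iio u) := by
    intro W hW
    ext x
    constructor
    · rintro ⟨hx, hxu⟩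
      have hx' := hx
      rw [hW] at hx'
      exact ⟨hx'.1, hx'.2.1, hxu⟩
    · rintro ⟨hxW, hx⟩
      exact ⟨hW ▸ ⟨hxW, hsub x hx⟩, hx.2⟩
  have hUx := hinter U hCU
  refine ⟨hUx ▸ Set.inter_subset_right, ?_, ⟨?_, ?_⟩, ⟨U, hU, hUx⟩, ⟨F, hF, hinter F hCF⟩⟩
  · obtain ⟨x, hx⟩ := hC.nonempty
    have hxS := hC.subset hx
    rcases (show MvPolynomial.eval x φ ≤ u from hxS.2).lt_or_eq with h | h
    · exact ⟨x, hx, h⟩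
    -- The component is open in {φ ≤ u}, so points of V just below the level near x still belong to
    -- it.
    · have hxU : x ∈ U := (hCU ▸ hx : x ∈ U ∩ _).1
      obtain ⟨q, hqU, hqV, hqu⟩ := hV.exists_near hxS.1 h (hU.mem_nhds hxU)
      exact ⟨q, hUx ▸ ⟨hqU, hqV, hqu⟩⟩
  · exact def_mem_iff_isSemialgebraic.1 (hCdef.and hlt)
  · rintro y ⟨hy, hyu⟩ y' ⟨hy', hyu'⟩
    obtain ⟨γ, hγ, rfl, rfl⟩ := hC.connected.joined y hy y' hy'
    have hj : PathJoined (realFiber Z φ (Set.Iio u)) (γ 0) (γ 1) :=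
      hV.joined_of_joined hyu (hC.subset hy').1 hyu'
        (PathJoined.of_isPathOn zero_le_one hγ.isPathOn fun t ht0 ht1 =>
          hC.subset (hγ.mapsTo ⟨ht0, ht1⟩))
    -- The path below the level might a priori leave C, but the part of C below the level is open
    -- and closed in {φ < u}.
    exact (PathJoined.mem_of_clopen (hCdef.and hlt) hU hUx hF (hinter F hCF) ⟨hy, hyu⟩
      hj).exists_isSemialgebraicPath
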